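/- Let $k$ be an algebraically closed field of characteristic zero, let $e,f,h$ be the standard basis of $\mathfrak{sl}_2$, and let $\Delta=h^2+4ef-2h\in U(\mathfrak{sl}_2)$, so that the center of $U(\mathfrak{sl}_2)$ is $k[\Delta]$. Let $V=kx\oplus ky$ be the standard representation, i.e. $[h,x]=x$, $[h,y]=-y$, $[e,x]=0$, $[e,y]=x$, $[f,x]=y$, $[f,y]=0$. For a nonzero polynomial $z=z(\Delta)$ of degree $m$ in $\Delta$, let $H_z$ be the quotient of $TV\rtimes U(\mathfrak{sl}_2)$ by the relation $[x,y]=z$, and let $[H_z,H_z]$ be the $k$-linear span of all commutators $ab-ba$ with $a,b\in H_z$; the commutator quotient $H_z/[H_z,H_z]$ is a module over the center of $H_z$. (1) If $m=0$, then $H_z/[H_z,H_z]=0$. (2) If $m\ge 1$, then the images of $1,\Delta,\dots,\Delta^{m-1}$ in $H_z/[H_z,H_z]$ are linearly independent over $k$ and generate $H_z/[H_z,H_z]$ as a module over the center of $H_z$. (3) There is a polynomial $q\in k[T]$ such that the element $$t_z=ey^2+hxy-fx^2-\tfrac12 hz-q(\Delta)$$ is central in $H_z$. For every such $q$, the center of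 $H_z$ is the subalgebra $k[t_z]$ generated by $t_z$, and the quotient of $H_z/[H_z,H_z]$ by $t_z\cdot\big(H_z/[H_z,H_z]\big)$ is a $k$-vector space of dimension $m$. -/

import Mathlib

open Polynomial

namespace InfHecke

/-- Names of the five generators: `e, f, h` for `sl₂` and `x, y` for its standard
representation `V`. -/
inductive Gen : Type
  | e | f | h | x | y

section Presentation

variable {k : Type*} [Field k]

/-- A generator, as an element of the free algebra. -/
abbrev gen (g : Gen) : FreeAlgebra k Gen := FreeAlgebra.ι k g

/-- The element `h² + 4ef - 2h` of the free algebra. -/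
def freeCasimir : FreeAlgebra k Gen :=
  gen Gen.h ^ 2 + (4 : k) • (gen Gen.e * gen Gen.f) - (2 : k) • gen Gen.h

/-- Defining relations of the infinitesimal Hecke algebra: the bracket of `sl₂`, the action of
`sl₂` on `V = kx ⊕ ky` (so far this presents `TV ⋊ U(sl₂)`), and `[x, y] = z` for the central
element `z = p(Δ)` of `U(sl₂)`. -/
inductive Rel (p : k[X]) : FreeAlgebra k Gen → FreeAlgebra k Gen → Prop
  | he : Rel p (gen Gen.h * gen Gen.e - gen Gen.e * gen Gen.h) ((2 : k) • gen Gen.e)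
  | hf : Rel p (gen Gen.h * gen Gen.f - gen Gen.f * gen Gen.h) (-((2 : k) • gen Gen.f))
  | ef : Rel p (gen Gen.e * gen Gen.f - gen Gen.f * gen Gen.e) (gen Gen.h)
  | hx : Rel p (gen Gen.h * gen Gen.x - gen Gen.x * gen Gen.h) (gen Gen.x)
  | hy : Rel p (gen Gen.h * gen Gen.y - gen Gen.y * gen Gen.h) (-gen Gen.y)
  | ex : Rel p (gen Gen.e * gen Gen.x - gen Gen.x * gen Gen.e) 0
  | ey : Rel p (gen Gen.e * gen Gen.y - gen Gen.y * gen Gen.e) (gen Gen.x)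
  | fx : Rel p (gen Gen.f * gen Gen.x - gen Gen.x * gen Gen.f) (gen Gen.y)
  | fy : Rel p (gen Gen.f * gen Gen.y - gen Gen.y * gen Gen.f) 0
  | xy : Rel p (gen Gen.x * gen Gen.y - gen Gen.y * gen Gen.x) (aeval freeCasimir p)

/-- The infinitesimal Hecke algebra `H_z` of `sl₂` with parameter `z = p(Δ)`. -/
abbrev Hecke (p : k[X]) : Type _ := RingQuot (Rel p)

/-- The image of a generator in `H_z`. -/
def elt (p : k[X]) (g : Gen) : Hecke p := RingQuot.mkAlgHom k (Rel p) (gen g)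

/-- The Casimir element `Δ = h² + 4ef - 2h` in `H_z`. -/
def casimir (p : k[X]) : Hecke p :=
  elt p Gen.h ^ 2 + (4 : k) • (elt p Gen.e * elt p Gen.f) - (2 : k) • elt p Gen.h

/-- The element `e y² + h x y - f x² - (1/2) h z - q(Δ)` of `H_z`, where `z = p(Δ)`. -/
noncomputable def quadElt (p q : k[X]) : Hecke p :=
  elt p Gen.e * elt p Gen.y ^ 2 + elt p Gen.h * elt p Gen.x * elt p Gen.y
    - elt p Gen.f * elt p Gen.x ^ 2
    - (1 / 2 : k) • (elt p Gen.h * aeval (casimir p) p) - aeval (casimir p) q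

end Presentation

section Commutators

variable (k : Type*) [Field k] (A : Type*) [Ring A] [Algebra k A]

/-- The `k`-linear span `[A, A]` of all commutators, with its structure of a module over the
center of `A`. -/
def commutators : Submodule (Subalgebra.center k A) A where
  __ := Submodule.span k {c : A | ∃ a b : A, c = a * b - b * a}
  smul_mem' := by
    rintro ⟨r, hr⟩ c hc
    have hr' := Subalgebra.mem_center_iff.1 hr
    change r * c ∈ Submodule.span k {c : A | ∃ a b : A, c = a * b - b * a}
    change c ∈ Submodule.span k {c : A | ∃ a b : A, c = a * b - b * a} at hc
    induction hc using Submodule.span_induction with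
    | mem c hc =>
      obtain ⟨a, b, rfl⟩ := hc
      refine Submodule.subset_span ⟨r * a, b, ?_⟩
      rw [mul_sub, mul_assoc, ← mul_assoc r b a, ← hr' b, mul_assoc]
    | zero => simp
    | add c d _ _ hc hd => rw [mul_add]; exact add_mem hc hd
    | smul s c _ hc => rw [mul_smul_comm]; exact Submodule.smul_mem _ s hc

/-- The commutator quotient `A / [A, A]`, a module over the center of `A` (and over `k`). -/
abbrev CommQuot : Type _ := A ⧸ commutators k A

end Commutators

end InfHecke

set_option linter.unusedSimpArgs false

namespace InfHecke

/-! Write `A` for the algebra, `t` for the quadratic element, `m` for the degree of `z`. Under the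
adjoint action of `sl₂` the algebra is a weight module on which `e` and `f` are locally nilpotent,
so the invariants meet `[sl₂, A]` only in zero (`System.eq_zero_of_mem_adImage`). Conversely, `A` is
the sum of `[sl₂, A]` and the span `k[t, Δ]` of the products `tⁱ P(Δ)` (`System.inv_sup_adImage`):
filtering by degree in `x, y`, the layers are spanned by `U(sl₂) · SᵈV`, and modulo `[sl₂, A]` each
layer is reached from lower ones by multiplication by `t` and `Δ`.

Hence `A / [A, A]` is a quotient of `k[t, Δ]`, and the remaining relations come from `[x, A]` and
`[y, A]`. Modulo `[sl₂, A]` only the copies of `V` in `A` contribute, and these are generated over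
`k[t, Δ]` by `V` itself and by `[Δ, V]` (`System.filt_le_of_weight_neg_one`). So `[A, A]` is `[sl₂,
A]` plus the span of `tⁱ · rel(Δⁿ)`, where `rel(P) = x P(Δ) y - y P(Δ) x + P(Δ) z`
(`System.brackets_eq`); the copy `[Δ, V]` gives nothing new (`System.rel_eq_of_comp`).

Products of `Δ` with elements of `V` are controlled by one quadratic equation for `ad Δ`. With `v`
equal to half of `ad Δ`, left and right multiplication by `Δ` on `V` are `v² + v - 3/4` and `v² - v
- 3/4`. Centrality of `t` becomes a functional equation for `q` (`Balanced`), which is solvable and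
fixes the leading coefficient of `q`. The same calculus shows that `rel(Δⁿ)` is `relPoly n`
evaluated at `Δ`, up to a multiple of `t`, and that `relPoly n` has degree exactly `m + n`
(`relPoly_spec`). Therefore `1, …, Δ^(m-1)` generate over `k[t]`, and modulo `t` no nonzero
combination of them is a relation.

Independence needs representations, not a basis theorem: for each scalar `c`, a `model` by
difference operators has `t` acting as `c` while `Δ` satisfies no polynomial equation. These models
also show that an element of `k[t, Δ]` commuting with `x` lies in `k[t]`, which gives the center. -/

lemma aeval_mul_comm {k A : Type*} [Field k] [Ring A] [Algebra k A] {a b : A} (hab : a * b = b * a)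
    (P : k[X]) : aeval a P * b = b * aeval a P := by
  induction P using Polynomial.induction_on' with
  | add P Q hP hQ => rw [map_add, add_mul, mul_add, hP, hQ]
  | monomial n r =>
    rw [aeval_monomial, mul_assoc, ← mul_assoc b, ← Algebra.commutes r b, mul_assoc]
    congr 1
    exact (Commute.pow_left hab n).eq

/-! ### Locally finite `sl₂`-modules: invariants against the image of the action. -/

/-- An `sl₂`-triple of operators. -/
structure OpTriple {k M : Type*} [Field k] [AddCommGroup M] [Module k M]
    (E F H : Module.End k M) : Prop where
  he : H * E = E * H + (2 : k) • E
  hf : H * F = F * H - (2 : k) • F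
  ef : E * F = F * E + H

namespace OpTriple

variable {k M : Type*} [Field k] [AddCommGroup M] [Module k M] {E F H : Module.End k M}

/-- The Casimir operator. -/
def cas (E F H : Module.End k M) : Module.End k M := H * H + (2 : k) • H + (4 : k) • (F * E)

lemma swap (S : OpTriple E F H) : OpTriple F E (-H) where
  he := by rw [neg_mul, S.hf]; simp only [mul_neg]; module
  hf := by rw [neg_mul, S.he]; simp only [mul_neg]; module
  ef := by rw [S.ef]; module

lemma cas_swap (S : OpTriple E F H) : cas F E (-H) = cas E F H := by
  unfold cas; rw [S.ef]; simp only [neg_mul_neg]; module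

lemma cas_comm_E (S : OpTriple E F H) : cas E F H * E = E * cas E F H := by
  have h1 : F * E = E * F - H := by rw [S.ef]; module
  unfold cas
  simp only [add_mul, mul_add, smul_mul_assoc, mul_smul_comm]
  have h2 : H * H * E = E * (H * H) + (4 : k) • (E * H) + (4 : k) • E := by
    rw [mul_assoc, S.he, mul_add, ← mul_assoc, S.he, mul_smul_comm, S.he, add_mul, mul_assoc,
      smul_mul_assoc]
    module
  have h3 : F * E * E = E * (F * E) - E * H - (2 : k) • E := by
    conv_lhs => rw [h1, sub_mul, S.he, mul_assoc]
    module
  rw [h2, h3, S.he]; module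

lemma cas_comm_F (S : OpTriple E F H) : cas E F H * F = F * cas E F H := by
  have := S.swap.cas_comm_E
  rwa [S.cas_swap] at this

lemma cas_comm_H (S : OpTriple E F H) : cas E F H * H = H * cas E F H := by
  have h3 : F * E * H = H * (F * E) := by
    have h4 : E * H = H * E - (2 : k) • E := by rw [S.he]; module
    rw [mul_assoc, h4, mul_sub, ← mul_assoc, ← mul_assoc, S.hf, sub_mul, mul_smul_comm,
      smul_mul_assoc]
  unfold cas
  simp only [add_mul, mul_add, smul_mul_assoc, mul_smul_comm]
  rw [h3, mul_assoc]

/-- `∏_{l < N} (C - (r + 2 l) (r + 2 l + 2))`, which kills vectors `w` of weight `r` with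
`E ^ N w = 0`. -/
noncomputable def casPoly (r : k) : ℕ → k[X]
  | 0 => 1
  | n + 1 => (X - C (r * (r + 2))) * casPoly (r + 2) n

/-- By induction the later factors turn `w` into a vector of weight `r` killed by `E`, and on such a
vector the Casimir operator is the scalar `r (r + 2)`. -/
lemma aeval_casPoly_eq_zero (S : OpTriple E F H) (n : ℕ) : ∀ (r : k) (w : M), H w = r • w →
    (E ^ n) w = 0 → aeval (cas E F H) (casPoly r n) w = 0 := by
  induction n with
  | zero => intro r w _ h; simp only [pow_zero, Module.End.one_apply] at h; simp [h]
  | succ n ih =>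
    intro r w hw h
    have hEw : H (E w) = (r + 2) • E w := by
      have := LinearMap.congr_fun S.he w
      simp only [Module.End.mul_apply, LinearMap.add_apply, LinearMap.smul_apply, hw,
        map_smul] at this
      rw [this]; module
    have h1 := ih (r + 2) (E w) hEw (by rwa [← Module.End.mul_apply, ← pow_succ])
    rw [← Module.End.mul_apply, aeval_mul_comm S.cas_comm_E, Module.End.mul_apply] at h1
    have h2 : H (aeval (cas E F H) (casPoly (r + 2) n) w) =
        r • aeval (cas E F H) (casPoly (r + 2) n) w := by
      rw [← Module.End.mul_apply, ← aeval_mul_comm S.cas_comm_H, Module.End.mul_apply, hw,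
        map_smul]
    rw [casPoly, map_mul, Module.End.mul_apply]
    generalize aeval (cas E F H) (casPoly (r + 2) n) w = u at *
    simp only [map_sub, aeval_X, aeval_C, LinearMap.sub_apply, Module.algebraMap_end_apply]
    simp only [cas, LinearMap.add_apply, Module.End.mul_apply, LinearMap.smul_apply, h1, h2,
      map_smul, map_zero]
    module

/-- The constant term is, up to sign, a product of numbers `r (r + 2)` with `r` positive and even.
This is the only place where a Casimir eigenvalue has to be distinguished from the trivial one. -/
lemma eval_casPoly_ne_zero [CharZero k] (n : ℕ) : ∀ j : ℕ,
    (casPoly (2 * (j + 1) : k) n).eval 0 ≠ 0 := by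
  induction n with
  | zero => simp [casPoly]
  | succ n ih =>
    intro j
    rw [casPoly, eval_mul]
    refine mul_ne_zero ?_ ?_
    · simp only [eval_sub, eval_X, eval_C, zero_sub, neg_ne_zero]
      have h1 : (2 * (j + 1) : k) ≠ 0 := by exact_mod_cast (by omega : 2 * (j + 1) ≠ 0)
      have h2 : (2 * (j + 1) + 2 : k) ≠ 0 := by exact_mod_cast (by omega : 2 * (j + 1) + 2 ≠ 0)
      exact mul_ne_zero h1 h2
    · have h3 : (2 * (j + 1) + 2 : k) = 2 * (((j + 1 : ℕ) : k) + 1) := by push_cast; ring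
      rw [h3]
      exact ih (j + 1)

/-- A polynomial in the Casimir operator with nonzero constant term kills `b`, so `b` is the Casimir
operator applied to another vector of weight 2; `F` commutes with it and lowers the weight to 0. -/
lemma exists_cas_eq [CharZero k] (S : OpTriple E F H) {b : M} (hb : H b = (2 : k) • b) {n : ℕ}
    (hn : (E ^ n) b = 0) : ∃ u, H u = 0 ∧ F b = cas E F H u := by
  have h1 := S.aeval_casPoly_eq_zero n 2 b hb hn
  have h2 : (casPoly (2 : k) n).eval 0 ≠ 0 := by
    have := eval_casPoly_ne_zero (k := k) n 0
    simpa using this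
  obtain ⟨Q, hQ⟩ : X ∣ casPoly (2 : k) n - C ((casPoly (2 : k) n).eval 0) := by
    rw [X_dvd_iff, coeff_zero_eq_eval_zero]; simp
  set c := (casPoly (2 : k) n).eval 0
  have h3 : casPoly (2 : k) n = C c + X * Q := by rw [← hQ]; ring
  rw [h3, map_add, map_mul, aeval_X, aeval_C, LinearMap.add_apply, Module.End.mul_apply,
    Module.algebraMap_end_apply] at h1
  have h4 : b = cas E F H (-c⁻¹ • aeval (cas E F H) Q b) := by
    rw [map_smul]
    have : cas E F H (aeval (cas E F H) Q b) = - c • b := by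
      rw [neg_smul, eq_neg_iff_add_eq_zero, add_comm, h1]
    rw [this, smul_smul, neg_mul_neg, inv_mul_cancel₀ h2, one_smul]
  refine ⟨F (-c⁻¹ • aeval (cas E F H) Q b), ?_, ?_⟩
  · have h5 := LinearMap.congr_fun S.hf (aeval (cas E F H) Q b)
    have h6 : H (aeval (cas E F H) Q b) = (2 : k) • aeval (cas E F H) Q b := by
      rw [← Module.End.mul_apply, ← aeval_mul_comm S.cas_comm_H, Module.End.mul_apply, hb,
        map_smul]
    simp only [Module.End.mul_apply, LinearMap.sub_apply, LinearMap.smul_apply, h6,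
      map_smul, sub_self] at h5
    rw [map_smul, map_smul, h5, smul_zero]
  · conv_lhs => rw [h4]
    rw [← Module.End.mul_apply, ← S.cas_comm_F, Module.End.mul_apply]

/-- In a locally finite weight module over `sl₂`, the invariants meet the image of `sl₂`
trivially. -/
theorem eq_zero_of_invariant [CharZero k] (S : OpTriple E F H)
    (hH : ⨆ r : k, H.eigenspace r = ⊤) (hE : ∀ w, ∃ n, (E ^ n) w = 0)
    (hF : ∀ w, ∃ n, (F ^ n) w = 0) {v : M} (vE : E v = 0) (vH : H v = 0)
    (hv : v ∈ LinearMap.range E ⊔ LinearMap.range F ⊔ LinearMap.range H) : v = 0 := by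
  -- The image of `sl₂` is contained in `Z + W`: components of nonzero weight go to `W`, and those
  -- of weight zero are Casimir multiples of vectors of weight zero.
  set Z : Submodule k M := (H.eigenspace 0).map (cas E F H) with hZ
  set W : Submodule k M := ⨆ r : k, ⨆ _ : r ≠ 0, H.eigenspace r with hW
  have memW : ∀ (r : k) (w : M), r ≠ 0 → H w = r • w → w ∈ W := fun r w hr hw =>
    Submodule.mem_iSup_of_mem r (Submodule.mem_iSup_of_mem hr (Module.End.mem_eigenspace_iff.2 hw))
  have step : ∀ G : Module.End k M, (∀ (r : k) (w : M), H w = r • w → G w ∈ Z ⊔ W) →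
      LinearMap.range G ≤ Z ⊔ W := by
    rintro G hG _ ⟨w, rfl⟩
    have hw : w ∈ ⨆ r : k, H.eigenspace r := hH ▸ Submodule.mem_top
    induction hw using Submodule.iSup_induction' with
    | mem r w hw => exact hG r w (Module.End.mem_eigenspace_iff.1 hw)
    | zero => simp
    | add a b _ _ ha hb => rw [map_add]; exact add_mem ha hb
  have memZ : ∀ u, H u = 0 → cas E F H u ∈ Z := fun u hu =>
    ⟨u, by simpa [Module.End.mem_eigenspace_iff] using hu, rfl⟩
  have hle : LinearMap.range E ⊔ LinearMap.range F ⊔ LinearMap.range H ≤ Z ⊔ W := by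
    refine sup_le (sup_le (step _ ?_) (step _ ?_)) (step _ ?_)
    · intro r w hw
      have hEw : H (E w) = (r + 2) • E w := by
        have := LinearMap.congr_fun S.he w
        simp only [Module.End.mul_apply, LinearMap.add_apply, LinearMap.smul_apply, hw,
          map_smul] at this
        rw [this]; module
      by_cases hr : r + 2 = 0
      -- A vector of weight `-2` has weight 2 for the swapped triple `(F, E, -H)`, which has the
      -- same Casimir operator.
      · obtain ⟨n, hn⟩ := hF w
        obtain ⟨u, hu, hu'⟩ := S.swap.exists_cas_eq (b := w) (n := n)
          (by rw [LinearMap.neg_apply, hw, eq_neg_of_add_eq_zero_left hr]; module) hn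
        rw [hu', S.cas_swap]
        exact Submodule.mem_sup_left (memZ u (by simpa using hu))
      · exact Submodule.mem_sup_right (memW _ _ hr hEw)
    · intro r w hw
      have hFw : H (F w) = (r - 2) • F w := by
        have := LinearMap.congr_fun S.hf w
        simp only [Module.End.mul_apply, LinearMap.sub_apply, LinearMap.smul_apply, hw,
          map_smul] at this
        rw [this]; module
      by_cases hr : r - 2 = 0
      · obtain ⟨n, hn⟩ := hE w
        obtain ⟨u, hu, hu'⟩ := S.exists_cas_eq (b := w) (n := n)
          (by rw [hw, sub_eq_zero.1 hr]) hn
        rw [hu']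
        exact Submodule.mem_sup_left (memZ u hu)
      · exact Submodule.mem_sup_right (memW _ _ hr hFw)
    · intro r w hw
      by_cases hr : r = 0
      · rw [hw, hr, zero_smul]; exact zero_mem _
      · rw [hw]; exact Submodule.mem_sup_right (Submodule.smul_mem _ _ (memW r w hr hw))
  obtain ⟨_, ⟨u, hu, rfl⟩, w, hw, huw⟩ := Submodule.mem_sup.1 (hle hv)
  have hu0 : H u = 0 := by simpa [Module.End.mem_eigenspace_iff] using hu
  have hCu : H (cas E F H u) = 0 := by
    rw [← Module.End.mul_apply, ← S.cas_comm_H, Module.End.mul_apply, hu0, map_zero]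
  have hw0 : w = 0 := by
    have hd := (Module.End.eigenspaces_iSupIndep H) 0
    refine Submodule.disjoint_def.1 hd w ?_ hw
    rw [Module.End.mem_eigenspace_iff, zero_smul, eq_sub_of_add_eq' huw, map_sub, vH, hCu, sub_zero]
  rw [hw0, add_zero] at huw
  obtain ⟨n, hn⟩ := hE u
  have hn' : (E ^ (n + 1)) u = 0 := by rw [pow_succ', Module.End.mul_apply, hn, map_zero]
  -- Now `v = C u` with `C` the Casimir operator. The polynomial killing `u` is `X` times `casPoly 2
  -- n`, so `casPoly 2 n` in `C` kills `v`; but `C v = 0`, so it acts on `v` by its nonzero constant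
  -- term.
  have h1 := S.aeval_casPoly_eq_zero (n + 1) 0 u (by simpa using hu0) hn'
  have h2 : casPoly (0 : k) (n + 1) = casPoly 2 n * X := by simp [casPoly, mul_comm]
  have hCv : cas E F H v = 0 := by
    simp [cas, Module.End.mul_apply, vE, vH]
  rw [h2, map_mul, Module.End.mul_apply, aeval_X, huw] at h1
  have h3 : aeval (cas E F H) (casPoly (2 : k) n) v = (casPoly (2 : k) n).eval 0 • v := by
    have h := Module.End.aeval_apply_of_hasEigenvector (R := k) (M := M) (f := cas E F H)
      (p := casPoly (2 : k) n) (μ := 0) (x := v)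
    by_cases hv0 : v = 0
    · simp [hv0]
    · exact h ⟨by simpa [Module.End.mem_eigenspace_iff] using hCv, hv0⟩
  rw [h3] at h1
  refine (smul_eq_zero.1 h1).resolve_left ?_
  simpa using eval_casPoly_ne_zero (k := k) n 0

end OpTriple

/-! ### Linear maps on polynomials given by triangular families. -/

section Triangular

variable {k : Type*} [Field k]

/-- The linear map on polynomials sending `X ^ n` to `S n`. -/
noncomputable def lin {M : Type*} [AddCommGroup M] [Module k M] (S : ℕ → M) : k[X] →ₗ[k] M :=
  (Polynomial.basisMonomials k).constr k S

lemma lin_monomial {M : Type*} [AddCommGroup M] [Module k M] (S : ℕ → M) (n : ℕ) (a : k) :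
    lin S (monomial n a) = a • S n := by
  have h : monomial n a = a • (Polynomial.basisMonomials k) n := by
    simp [Polynomial.smul_monomial]
  rw [h, map_smul, lin, Module.Basis.constr_basis]

lemma range_lin {M : Type*} [AddCommGroup M] [Module k M] (S : ℕ → M) :
    LinearMap.range (lin (k := k) S) = Submodule.span k (Set.range S) :=
  Module.Basis.constr_range _ _

lemma lin_eq_sum {M : Type*} [AddCommGroup M] [Module k M] (S : ℕ → M) {d : ℕ} (P : k[X])
    (hP : P.natDegree ≤ d) : lin S P = ∑ i ∈ Finset.range (d + 1), P.coeff i • S i := by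
  conv_lhs => rw [P.as_sum_range' (d + 1) (by omega)]
  simp [lin_monomial]

lemma natDegree_lin_le {S : ℕ → k[X]} {m : ℕ} (hS : ∀ n, (S n).natDegree ≤ m + n) {d : ℕ}
    {P : k[X]} (hP : P.natDegree ≤ d) : (lin S P).natDegree ≤ m + d := by
  rw [lin_eq_sum S P hP]
  refine natDegree_sum_le_of_forall_le _ _ fun i hi => (natDegree_smul_le _ _).trans ?_
  have := hS i
  have := Finset.mem_range.1 hi
  omega

lemma coeff_lin {S : ℕ → k[X]} {m : ℕ} (hS : ∀ n, (S n).natDegree ≤ m + n) {d : ℕ}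
    {P : k[X]} (hP : P.natDegree ≤ d) :
    (lin S P).coeff (m + d) = P.coeff d * (S d).coeff (m + d) := by
  rw [lin_eq_sum S P hP, finsetSum_coeff, Finset.sum_range_succ, Finset.sum_eq_zero, zero_add,
    coeff_smul, smul_eq_mul]
  intro i hi
  rw [coeff_smul, coeff_eq_zero_of_natDegree_lt (p := S i), smul_zero]
  have := hS i
  have := Finset.mem_range.1 hi
  omega

lemma exists_lin_eq {S : ℕ → k[X]} (hS : ∀ n, (S n).natDegree ≤ n)
    (hS' : ∀ n, (S n).coeff n ≠ 0) (m : ℕ) : ∀ R : k[X], R.natDegree ≤ m →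
      ∃ P : k[X], P.natDegree ≤ m ∧ lin S P = R := by
  induction m with
  | zero =>
    intro R hR
    obtain ⟨r, rfl⟩ := natDegree_eq_zero.1 (Nat.le_zero.1 hR)
    obtain ⟨s, hs⟩ := natDegree_eq_zero.1 (Nat.le_zero.1 (hS 0))
    have h0 : s ≠ 0 := by have := hS' 0; rwa [← hs, coeff_C_zero] at this
    refine ⟨monomial 0 (r / s), by simp, ?_⟩
    rw [lin_monomial, ← hs, smul_C, smul_eq_mul, div_mul_cancel₀ _ h0]
  | succ m ih =>
    intro R hR
    obtain ⟨P, hP, hPR⟩ := ih (R - (R.coeff (m + 1) / (S (m + 1)).coeff (m + 1)) • S (m + 1)) (by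
      rw [natDegree_le_iff_coeff_eq_zero]
      intro N hN
      rw [coeff_sub, coeff_smul, smul_eq_mul]
      rcases Nat.lt_or_ge (m + 1) N with h | h
      · rw [coeff_eq_zero_of_natDegree_lt (lt_of_le_of_lt hR h),
          coeff_eq_zero_of_natDegree_lt (lt_of_le_of_lt (hS _) h), mul_zero, sub_zero]
      · obtain rfl : N = m + 1 := by omega
        rw [div_mul_cancel₀ _ (hS' _), sub_self])
    refine ⟨P + monomial (m + 1) (R.coeff (m + 1) / (S (m + 1)).coeff (m + 1)), ?_, ?_⟩
    · exact natDegree_add_le_of_degree_le (hP.trans m.le_succ) (natDegree_monomial_le _)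
    · rw [map_add, hPR, lin_monomial, sub_add_cancel]

/-- The members of `S` have the distinct degrees `m, m + 1, …`, so the leading term of a nonzero
combination survives and sits in degree at least `m`. -/
lemma eq_zero_of_mem_span {S : ℕ → k[X]} {m : ℕ} (hS : ∀ n, (S n).natDegree ≤ m + n)
    (hS' : ∀ n, (S n).coeff (m + n) ≠ 0) {R : k[X]} (hR : R ∈ Submodule.span k (Set.range S))
    (hd : R.degree < m) : R = 0 := by
  rw [← range_lin] at hR
  obtain ⟨P, rfl⟩ := hR
  by_contra h
  have hP : P ≠ 0 := by rintro rfl; simp at h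
  have h1 := coeff_lin hS (le_refl P.natDegree)
  rw [coeff_eq_zero_of_degree_lt (hd.trans_le (by exact_mod_cast Nat.le_add_right _ _))] at h1
  exact mul_ne_zero (leadingCoeff_ne_zero.2 hP) (hS' _) h1.symm

end Triangular

/-! ### Left and right multiplication by the Casimir element as polynomials in one variable. -/

section Parabola

variable (k : Type*) [Field k]

/-- With `v` half the adjoint action of the Casimir element on the standard representation, left
multiplication by the Casimir element is `v ^ 2 + v - 3 / 4`. -/
noncomputable def lpoly : k[X] := X ^ 2 + X - C (3 / 4)

/-- With `v` half the adjoint action of the Casimir element on the standard representation, right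
multiplication by the Casimir element is `v ^ 2 - v - 3 / 4`. -/
noncomputable def rpoly : k[X] := X ^ 2 - X - C (3 / 4)

/-- `lpoly ^ n + rpoly ^ n` as a polynomial in `X ^ 2`. -/
noncomputable def powSum : ℕ → k[X]
  | 0 => 2
  | 1 => 2 * X - C (3 / 2)
  | n + 2 => (2 * X - C (3 / 2)) * powSum (n + 1) - ((X - C (3 / 4)) ^ 2 - X) * powSum n

/-- `2 X (lpoly ^ (n + 1) - rpoly ^ (n + 1))`, divided by `X ^ 2`, as a polynomial in `X ^ 2`. -/
noncomputable def powDiff : ℕ → k[X]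
  | 0 => 4
  | 1 => 4 * (2 * X - C (3 / 2))
  | n + 2 => (2 * X - C (3 / 2)) * powDiff (n + 1) - ((X - C (3 / 4)) ^ 2 - X) * powDiff n

variable {k}

lemma natDegree_quad_le : ((X - C (3 / 4 : k)) ^ 2 - X).natDegree ≤ 2 := by compute_degree

lemma coeff_quad : ((X - C (3 / 4 : k)) ^ 2 - X).coeff 2 = 1 := by
  compute_degree!

lemma natDegree_lin_le' : (2 * X - C (3 / 2 : k)).natDegree ≤ 1 := by compute_degree

lemma coeff_lin' : (2 * X - C (3 / 2 : k)).coeff 1 = 2 := by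
  compute_degree!

lemma natDegree_recursion {S : ℕ → k[X]} {n : ℕ}
    (hS : S (n + 2) = (2 * X - C (3 / 2)) * S (n + 1) - ((X - C (3 / 4)) ^ 2 - X) * S n)
    (h0 : (S n).natDegree ≤ n) (h1 : (S (n + 1)).natDegree ≤ n + 1) :
    (S (n + 2)).natDegree ≤ n + 2 ∧
      (S (n + 2)).coeff (n + 2) = 2 * (S (n + 1)).coeff (n + 1) - (S n).coeff n := by
  have e1 : 1 + (n + 1) = n + 2 := by ring
  have e2 : 2 + n = n + 2 := by ring
  constructor
  · rw [hS]
    refine (natDegree_sub_le _ _).trans (max_le ?_ ?_)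
    · exact e1 ▸ natDegree_mul_le_of_le natDegree_lin_le' h1
    · exact e2 ▸ natDegree_mul_le_of_le natDegree_quad_le h0
  · rw [hS, coeff_sub]
    conv_lhs => rw [← e1]
    rw [coeff_mul_add_eq_of_natDegree_le natDegree_lin_le' h1, e1, ← e2,
      coeff_mul_add_eq_of_natDegree_le natDegree_quad_le h0, coeff_lin', coeff_quad, one_mul]

lemma powSum_spec (n : ℕ) : ((powSum k n).natDegree ≤ n ∧ (powSum k n).coeff n = 2) ∧
    ((powSum k (n + 1)).natDegree ≤ n + 1 ∧ (powSum k (n + 1)).coeff (n + 1) = 2) := by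
  induction n with
  | zero =>
    refine ⟨⟨?_, ?_⟩, ?_, ?_⟩
    · simp [powSum]
    · simp [powSum]
    · exact natDegree_lin_le'
    · exact coeff_lin'
  | succ n ih =>
    refine ⟨ih.2, ?_⟩
    obtain ⟨h1, h2⟩ := natDegree_recursion (S := powSum k) (n := n) rfl ih.1.1 ih.2.1
    refine ⟨h1, ?_⟩
    rw [h2, ih.1.2, ih.2.2]; ring

lemma powDiff_spec (n : ℕ) :
    ((powDiff k n).natDegree ≤ n ∧ (powDiff k n).coeff n = 4 * (n + 1)) ∧
    ((powDiff k (n + 1)).natDegree ≤ n + 1 ∧ (powDiff k (n + 1)).coeff (n + 1) = 4 * (n + 2)) := by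
  induction n with
  | zero =>
    refine ⟨⟨?_, ?_⟩, ?_, ?_⟩
    · simp [powDiff]
    · simp [powDiff]
    · rw [powDiff]
      exact (natDegree_mul_le_of_le (m := 0) (n := 1) (by simp) natDegree_lin_le')
    · rw [powDiff, zero_add, show (4 : k[X]) = C 4 from rfl, coeff_C_mul, coeff_lin']; simp
  | succ n ih =>
    obtain ⟨h1, h2⟩ := natDegree_recursion (S := powDiff k) (n := n) rfl ih.1.1 ih.2.1
    refine ⟨⟨ih.2.1, ?_⟩, h1, ?_⟩
    · rw [ih.2.2]; push_cast; ring
    · rw [h2, ih.1.2, ih.2.2]; push_cast; ring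

lemma lpoly_add_rpoly [CharZero k] :
    lpoly k + rpoly k = (2 * X - C (3 / 2) : k[X]).comp (X ^ 2) := by
  have : (C (3 / 2) : k[X]) = C (3 / 4) + C (3 / 4) := by rw [← C_add]; norm_num
  simp only [lpoly, rpoly, sub_comp, mul_comp, ofNat_comp, X_comp, C_comp]
  rw [this]
  ring

lemma lpoly_mul_rpoly :
    lpoly k * rpoly k = ((X - C (3 / 4)) ^ 2 - X : k[X]).comp (X ^ 2) := by
  simp only [lpoly, rpoly, sub_comp, pow_comp, X_comp, C_comp]
  ring

/-- The recursion is the one for power sums of two quantities with given sum and product. The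
substitution `X ↦ -X` exchanges `lpoly` and `rpoly`, so sum and product are polynomials in `X ^ 2`.
-/
lemma powSum_comp [CharZero k] (n : ℕ) :
    (powSum k n).comp (X ^ 2) = lpoly k ^ n + rpoly k ^ n ∧
    (powSum k (n + 1)).comp (X ^ 2) = lpoly k ^ (n + 1) + rpoly k ^ (n + 1) := by
  induction n with
  | zero => exact ⟨by simp [powSum]; norm_num, by rw [powSum, ← lpoly_add_rpoly]; ring⟩
  | succ n ih =>
    refine ⟨ih.2, ?_⟩
    rw [powSum, sub_comp, mul_comp, mul_comp, ih.1, ih.2, ← lpoly_add_rpoly, ← lpoly_mul_rpoly]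
    ring

lemma powDiff_comp [CharZero k] (n : ℕ) :
    X ^ 2 * (powDiff k n).comp (X ^ 2) = 2 * X * (lpoly k ^ (n + 1) - rpoly k ^ (n + 1)) ∧
    X ^ 2 * (powDiff k (n + 1)).comp (X ^ 2) =
      2 * X * (lpoly k ^ (n + 2) - rpoly k ^ (n + 2)) := by
  have hd : lpoly k - rpoly k = 2 * X := by simp only [lpoly, rpoly]; ring
  induction n with
  | zero =>
    refine ⟨?_, ?_⟩
    · simp only [powDiff, ofNat_comp, zero_add, pow_one, hd]; ring
    · rw [zero_add, powDiff, mul_comp, ofNat_comp, ← lpoly_add_rpoly]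
      linear_combination (-2 * X * (lpoly k + rpoly k)) * hd
  | succ n ih =>
    refine ⟨ih.2, ?_⟩
    rw [powDiff, sub_comp, mul_comp, mul_comp, ← lpoly_add_rpoly, ← lpoly_mul_rpoly]
    linear_combination (lpoly k + rpoly k) * ih.2 - (lpoly k * rpoly k) * ih.1

lemma lin_powSum_comp [CharZero k] (P : k[X]) :
    (lin (powSum k) P).comp (X ^ 2) = P.comp (lpoly k) + P.comp (rpoly k) := by
  induction P using Polynomial.induction_on' with
  | add P Q hP hQ => rw [map_add, add_comp, hP, hQ, add_comp, add_comp]; ring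
  | monomial n a =>
    rw [lin_monomial, smul_comp, (powSum_comp n).1, monomial_comp, monomial_comp, smul_eq_C_mul]
    ring

lemma lin_powDiff_comp [CharZero k] (P : k[X]) :
    X ^ 2 * (lin (powDiff k) P).comp (X ^ 2) =
      2 * X * ((X * P).comp (lpoly k) - (X * P).comp (rpoly k)) := by
  induction P using Polynomial.induction_on' with
  | add P Q hP hQ =>
    rw [map_add, add_comp, mul_add, hP, hQ, mul_add, add_comp, add_comp]; ring
  | monomial n a =>
    rw [lin_monomial, smul_comp, smul_eq_C_mul, mul_comp, mul_comp, monomial_comp, monomial_comp,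
      X_comp, X_comp]
    linear_combination C a * (powDiff_comp (k := k) n).1

/-- The right-hand side is even in `X`, and every even polynomial is a combination of the `lpoly ^ n
+ rpoly ^ n`, which have one leading term `2 X ^ (2 n)` for each `n`. It serves to show that the
copy `[Δ, V]` of `V` yields no new relation. -/
lemma exists_powSum_eq_powDiff [CharZero k] (P : k[X]) : ∃ Q : k[X],
    Q.comp (lpoly k) + Q.comp (rpoly k) = 2 * X * (P.comp (lpoly k) - P.comp (rpoly k)) := by
  -- The constant term of `P` cancels in the difference, so `divX` suffices; the factor `X` restores
  -- the `X ^ 2` divided out in `powDiff`.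
  obtain ⟨Q, -, hQ⟩ := exists_lin_eq (S := powSum k) (fun n => (powSum_spec n).1.1)
    (fun n => by rw [(powSum_spec n).1.2]; norm_num) _ (X * lin (powDiff k) P.divX) le_rfl
  refine ⟨Q, ?_⟩
  rw [← lin_powSum_comp, hQ, mul_comp, X_comp, lin_powDiff_comp]
  congr 1
  conv_rhs => rw [← P.X_mul_divX_add]
  simp only [add_comp, C_comp]; ring

/-- The functional equation which makes the quadratic element central. -/
def Balanced (p q : k[X]) : Prop :=
  4 * (q.comp (rpoly k) - q.comp (lpoly k)) =
    2 * X * (p.comp (lpoly k) + p.comp (rpoly k)) - p.comp (lpoly k) + p.comp (rpoly k)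

/-- Multiplied by `2 X`, the functional equation becomes an equation between even polynomials. With
`q = X Q` (the constant term of `q` is irrelevant) it reads `powDiff Q = (1/4) powDiff (divX p) -
powSum p`, which is triangular in `Q`. The leading coefficients `4 (m + 1)` and `2` of the two
families give that of `q`. -/
lemma exists_balanced [CharZero k] (p : k[X]) : ∃ q : k[X], Balanced p q ∧
    q.natDegree ≤ p.natDegree + 1 ∧
    q.coeff (p.natDegree + 1) = - p.leadingCoeff / (2 * (p.natDegree + 1)) := by
  set m := p.natDegree with hm
  have hn : ∀ n : ℕ, (n + 1 : k) ≠ 0 := fun n => by exact_mod_cast n.succ_ne_zero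
  have hG : (lin (powDiff k) p.divX).natDegree ≤ m - 1 := by
    have := natDegree_lin_le (S := powDiff k) (m := 0)
      (fun n => by simpa using (powDiff_spec n).1.1) (P := p.divX) (d := m - 1)
      (by rw [natDegree_divX_eq_natDegree_tsub_one])
    simpa using this
  have hT : (lin (powSum k) p).natDegree ≤ m := by
    have := natDegree_lin_le (S := powSum k) (m := 0)
      (fun n => by simpa using (powSum_spec n).1.1) (P := p) (d := m) le_rfl
    simpa using this
  have hTc : (lin (powSum k) p).coeff m = 2 * p.leadingCoeff := by
    have := coeff_lin (S := powSum k) (m := 0)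
      (fun n => by simpa using (powSum_spec n).1.1) (P := p) (d := m) le_rfl
    simp only [zero_add, (powSum_spec m).1.2] at this
    rw [this, mul_comm]; rfl
  obtain ⟨Q, hQd, hQ⟩ := exists_lin_eq (S := powDiff k) (fun n => (powDiff_spec n).1.1)
    (fun n => by rw [(powDiff_spec n).1.2]; exact mul_ne_zero (by norm_num) (hn n)) m
    (C (1 / 4) * lin (powDiff k) p.divX - lin (powSum k) p) (by
      refine (natDegree_sub_le _ _).trans (max_le ?_ hT)
      exact (natDegree_C_mul_le _ _).trans (hG.trans (Nat.sub_le _ _)))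
  refine ⟨X * Q, ?_, ?_, ?_⟩
  · have h1 := lin_powDiff_comp Q
    have h2 := lin_powDiff_comp p.divX
    have h3 := lin_powSum_comp p
    have h4 : X * p.divX = p - C (p.coeff 0) := eq_sub_of_add_eq p.X_mul_divX_add
    have h5 : (C (1 / 4) : k[X]) * 4 = 1 := by
      rw [show (4 : k[X]) = C 4 from rfl, ← C_mul]; norm_num
    rw [h4, sub_comp, sub_comp, C_comp, C_comp] at h2
    rw [hQ, sub_comp, mul_comp, C_comp] at h1
    have hX : (2 * X : k[X]) ≠ 0 := mul_ne_zero two_ne_zero X_ne_zero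
    refine mul_left_cancel₀ hX ?_
    linear_combination 4 * h1 - 4 * C (1 / 4) * h2 + 4 * X ^ 2 * h3 - (2 * X *
      (p.comp (lpoly k) - p.comp (rpoly k))) * h5
  · rw [add_comm]
    exact natDegree_mul_le_of_le natDegree_X_le hQd
  · have h1 := coeff_lin (S := powDiff k) (m := 0)
      (fun n => by simpa using (powDiff_spec n).1.1) (P := Q) (d := m) hQd
    have h6 : (C (1 / 4) * lin (powDiff k) p.divX).coeff m = 0 := by
      rw [coeff_C_mul]
      rcases Nat.eq_zero_or_pos m with h0 | h0
      · have : p.divX = 0 := by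
          rw [divX_eq_zero_iff]
          exact eq_C_of_natDegree_eq_zero (hm ▸ h0)
        simp [this]
      · rw [coeff_eq_zero_of_natDegree_lt (by omega), mul_zero]
    rw [zero_add, hQ, coeff_sub, h6, hTc, (powDiff_spec m).1.2] at h1
    rw [coeff_X_mul]
    have := hn m
    field_simp
    linear_combination (-1 / 2 : k) * h1

end Parabola

/-! ### Moving powers of the Casimir element to the right. -/

section Reduction

variable (k : Type*) [Field k]

/-- The pair `(a, b)` with `lpoly ^ n = a(rpoly) + 2 X b(rpoly)`. -/
noncomputable def splitPow : ℕ → k[X] × k[X]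
  | 0 => (1, 0)
  | n + 1 => (X * (splitPow n).1 + (4 * X + 3) * (splitPow n).2,
      (splitPow n).1 + (X + 2) * (splitPow n).2)

variable {k}

/-- The recursion behind `splitPow` is multiplication by `lpoly = rpoly + 2 X`, reduced with `4 X² =
4 rpoly + 4 X + 3`. For `n = 0` the subtraction truncates, and the last claim only says that the
constant coefficient of `0` is `0`. -/
lemma splitPow_spec (n : ℕ) : (splitPow k n).1.natDegree ≤ n ∧ (splitPow k n).1.coeff n = 1 ∧
    (splitPow k n).2.natDegree ≤ n - 1 ∧ (splitPow k n).2.coeff (n - 1) = n := by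
  induction n with
  | zero => simp [splitPow]
  | succ n ih =>
    obtain ⟨h1, h2, h3, h4⟩ := ih
    have d1 : ((4 * X + 3 : k[X]) * (splitPow k n).2).natDegree ≤ n := by
      rcases n with _ | n
      · simp [splitPow]
      · exact (natDegree_mul_le_of_le (m := 1) (by compute_degree) h3).trans (by omega)
    have d2 : ((X + 2 : k[X]) * (splitPow k n).2).natDegree ≤ n ∧
        ((X + 2 : k[X]) * (splitPow k n).2).coeff n = n := by
      rcases n with _ | n
      · simp [splitPow]
      · have h5 : (X + 2 : k[X]).natDegree ≤ 1 := by compute_degree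
        refine ⟨?_, ?_⟩
        · exact (natDegree_mul_le_of_le h5 h3).trans (by omega)
        · have h6 : (X + 2 : k[X]).coeff 1 = 1 := by compute_degree!
          have := coeff_mul_add_eq_of_natDegree_le h5 h3
          rw [h4, h6, one_mul, Nat.add_sub_cancel, add_comm 1] at this
          exact this
    have d3 : (X * (splitPow k n).1).natDegree ≤ n + 1 := by
      rw [add_comm]; exact natDegree_mul_le_of_le natDegree_X_le h1
    refine ⟨?_, ?_, ?_, ?_⟩
    · exact natDegree_add_le_of_degree_le d3 (d1.trans n.le_succ)
    · rw [splitPow, coeff_add, coeff_X_mul, h2, coeff_eq_zero_of_natDegree_lt (by omega), add_zero]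
    · exact natDegree_add_le_of_degree_le h1 d2.1
    · rw [Nat.add_sub_cancel, splitPow, coeff_add, h2, d2.2]; push_cast; ring

/-- The relation attached to `Δ ^ n` in the commutator quotient, modulo the quadratic central
element. -/
noncomputable def relPoly (p q : k[X]) (n : ℕ) : k[X] :=
  p * (X ^ n + (splitPow k n).1) + (3 * p - 4 * q) * (splitPow k n).2

/-- Two terms reach degree `m + n`: `p (X ^ n + …)` contributes twice the leading coefficient of
`p`, and `-4 q` times the second half of `splitPow`, whose top coefficient is `n`, contributes the
summand with `n / (m + 1)`. Both have the same sign, so they cannot cancel. -/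
lemma relPoly_spec [CharZero k] {p q : k[X]} (hq : q.natDegree ≤ p.natDegree + 1)
    (hq' : q.coeff (p.natDegree + 1) = - p.leadingCoeff / (2 * (p.natDegree + 1))) (n : ℕ) :
    (relPoly p q n).natDegree ≤ p.natDegree + n ∧ (relPoly p q n).coeff (p.natDegree + n) =
      2 * p.leadingCoeff * (1 + n / (p.natDegree + 1)) := by
  obtain ⟨h1, h2, h3, h4⟩ := splitPow_spec (k := k) n
  have hm : (p.natDegree + 1 : k) ≠ 0 := by exact_mod_cast p.natDegree.succ_ne_zero
  have a1 : (X ^ n + (splitPow k n).1).natDegree ≤ n :=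
    natDegree_add_le_of_degree_le (natDegree_X_pow_le n) h1
  have a2 : (X ^ n + (splitPow k n).1).coeff n = 2 := by
    rw [coeff_add, h2, coeff_X_pow_self]; norm_num
  have a3 : (3 * p - 4 * q).natDegree ≤ p.natDegree + 1 := by
    refine (natDegree_sub_le _ _).trans (max_le ?_ ?_)
    · exact (natDegree_C_mul_le 3 p).trans (Nat.le_succ _)
    · exact (natDegree_C_mul_le 4 q).trans hq
  have a4 : (3 * p - 4 * q).coeff (p.natDegree + 1) =
      2 * p.leadingCoeff / (p.natDegree + 1) := by
    rw [coeff_sub, show (3 : k[X]) = C 3 from rfl, show (4 : k[X]) = C 4 from rfl, coeff_C_mul,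
      coeff_C_mul, hq', coeff_eq_zero_of_natDegree_lt (p := p) (Nat.lt_succ_self _)]
    field_simp
    ring
  have b : ((3 * p - 4 * q) * (splitPow k n).2).natDegree ≤ p.natDegree + n ∧
      ((3 * p - 4 * q) * (splitPow k n).2).coeff (p.natDegree + n) =
        2 * p.leadingCoeff / (p.natDegree + 1) * n := by
    rcases n with _ | n
    · simp [splitPow]
    · have e : p.natDegree + (n + 1) = p.natDegree + 1 + (n + 1 - 1) := by omega
      rw [e]
      refine ⟨natDegree_mul_le_of_le a3 h3, ?_⟩
      rw [coeff_mul_add_eq_of_natDegree_le a3 h3, a4, h4]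
  refine ⟨natDegree_add_le_of_degree_le (natDegree_mul_le_of_le le_rfl a1) b.1, ?_⟩
  rw [relPoly, coeff_add, b.2, coeff_mul_add_eq_of_natDegree_le le_rfl a1, a2]
  change p.leadingCoeff * 2 + _ = _
  field_simp

end Reduction

/-! ### Inner derivations and computations with the defining relations. -/

section Ad

variable (k : Type*) {A : Type*} [Field k] [Ring A] [Algebra k A]

/-- The inner derivation `b ↦ a b - b a`. -/
def ad (a : A) : Module.End k A := LinearMap.mulLeft k a - LinearMap.mulRight k a

variable {k}

lemma ad_apply (a b : A) : ad k a b = a * b - b * a := rfl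

lemma ad_mul (a b c : A) : ad k a (b * c) = ad k a b * c + b * ad k a c := by
  simp only [ad_apply]; noncomm_ring

lemma ad_mul_of_comm {a b : A} (h : a * b = b * a) (c : A) : ad k a (b * c) = b * ad k a c := by
  rw [ad_mul, ad_apply, h, sub_self, zero_mul, zero_add]

end Ad

/-- A ring generated by elements satisfying the relations of the infinitesimal Hecke algebra. -/
structure System {k : Type*} [Field k] (p : k[X]) (A : Type*) [Ring A] [Algebra k A] where
  e : A
  f : A
  h : A
  x : A
  y : A
  he : h * e = e * h + (2 : k) • e
  hf : h * f = f * h - (2 : k) • f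
  ef : e * f = f * e + h
  hx : h * x = x * h + x
  hy : h * y = y * h - y
  ex : e * x = x * e
  ey : e * y = y * e + x
  fx : f * x = x * f + y
  fy : f * y = y * f
  xy : x * y = y * x + aeval (h ^ 2 + (4 : k) • (e * f) - (2 : k) • h) p

namespace System

variable {k : Type*} [Field k] {p : k[X]} {A : Type*} [Ring A] [Algebra k A] (S : System p A)

/-- The Casimir element. -/
def cas : A := S.h ^ 2 + (4 : k) • (S.e * S.f) - (2 : k) • S.h

/-- The commutator of `x` and `y`. -/
noncomputable def z : A := aeval S.cas p

/-- The commutator of the Casimir element and `x`. -/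
def wx : A := ad k S.cas S.x

/-- The commutator of the Casimir element and `y`. -/
def wy : A := ad k S.cas S.y

/-- The quadratic element `e y² + h x y - f x² - (1/2) h z - q(Δ)`. -/
noncomputable def quad (q : k[X]) : A :=
  S.e * S.y ^ 2 + S.h * S.x * S.y - S.f * S.x ^ 2 - (1 / 2 : k) • (S.h * S.z) - aeval S.cas q

lemma xy' : S.x * S.y = S.y * S.x + S.z := S.xy

/-- Rewriting rules for reordering products of generators as `e, f, h, x, y`. -/
lemma order :
    ((S.f * S.e = S.e * S.f - S.h) ∧ (S.h * S.e = S.e * S.h + (2 : k) • S.e) ∧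
    (S.h * S.f = S.f * S.h - (2 : k) • S.f) ∧ (S.x * S.e = S.e * S.x) ∧
    (S.y * S.e = S.e * S.y - S.x) ∧ (S.x * S.f = S.f * S.x - S.y) ∧
    (S.y * S.f = S.f * S.y) ∧ (S.x * S.h = S.h * S.x - S.x) ∧
    (S.y * S.h = S.h * S.y + S.y) ∧ (S.y * S.x = S.x * S.y - S.z)) ∧
    ∀ t, (S.f * (S.e * t) = S.e * (S.f * t) - S.h * t) ∧
    (S.h * (S.e * t) = S.e * (S.h * t) + (2 : k) • (S.e * t)) ∧
    (S.h * (S.f * t) = S.f * (S.h * t) - (2 : k) • (S.f * t)) ∧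
    (S.x * (S.e * t) = S.e * (S.x * t)) ∧
    (S.y * (S.e * t) = S.e * (S.y * t) - S.x * t) ∧
    (S.x * (S.f * t) = S.f * (S.x * t) - S.y * t) ∧
    (S.y * (S.f * t) = S.f * (S.y * t)) ∧
    (S.x * (S.h * t) = S.h * (S.x * t) - S.x * t) ∧
    (S.y * (S.h * t) = S.h * (S.y * t) + S.y * t) ∧
    (S.y * (S.x * t) = S.x * (S.y * t) - S.z * t) := by
  have h0 : ((S.f * S.e = S.e * S.f - S.h) ∧ (S.h * S.e = S.e * S.h + (2 : k) • S.e) ∧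
    (S.h * S.f = S.f * S.h - (2 : k) • S.f) ∧ (S.x * S.e = S.e * S.x) ∧
    (S.y * S.e = S.e * S.y - S.x) ∧ (S.x * S.f = S.f * S.x - S.y) ∧
    (S.y * S.f = S.f * S.y) ∧ (S.x * S.h = S.h * S.x - S.x) ∧
    (S.y * S.h = S.h * S.y + S.y) ∧ (S.y * S.x = S.x * S.y - S.z)) := by
    refine ⟨?_, S.he, S.hf, S.ex.symm, ?_, ?_, S.fy.symm, ?_, ?_, ?_⟩
    · rw [S.ef]; abel
    · rw [S.ey]; abel
    · rw [S.fx]; abel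
    · rw [S.hx]; abel
    · rw [S.hy]; abel
    · rw [S.xy']; abel
  refine ⟨h0, fun t => ?_⟩
  obtain ⟨h1, h2, h3, h4, h5, h6, h7, h8, h9, h10⟩ := h0
  simp only [← mul_assoc, h1, h2, h3, h4, h5, h6, h7, h8, h9, h10, sub_mul, add_mul,
    smul_mul_assoc, and_self]

lemma cas_h : S.cas * S.h = S.h * S.cas := by
  unfold cas
  simp only [mul_add, add_mul, mul_sub, sub_mul, smul_mul_assoc, mul_smul_comm, mul_assoc, pow_two,
    S.order, smul_add, smul_sub]
  module

lemma cas_e : S.cas * S.e = S.e * S.cas := by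
  unfold cas
  simp only [mul_add, add_mul, mul_sub, sub_mul, smul_mul_assoc, mul_smul_comm, mul_assoc, pow_two,
    S.order, smul_add, smul_sub]
  module

lemma cas_f : S.cas * S.f = S.f * S.cas := by
  unfold cas
  simp only [mul_add, add_mul, mul_sub, sub_mul, smul_mul_assoc, mul_smul_comm, mul_assoc, pow_two,
    S.order, smul_add, smul_sub]
  module

lemma z_e : S.z * S.e = S.e * S.z := aeval_mul_comm S.cas_e p
lemma z_f : S.z * S.f = S.f * S.z := aeval_mul_comm S.cas_f p
lemma z_h : S.z * S.h = S.h * S.z := aeval_mul_comm S.cas_h p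
lemma z_cas : S.z * S.cas = S.cas * S.z := aeval_mul_comm rfl p

lemma z_order : ((S.z * S.e = S.e * S.z) ∧ (S.z * S.f = S.f * S.z) ∧ (S.z * S.h = S.h * S.z)) ∧
    ∀ t, (S.z * (S.e * t) = S.e * (S.z * t)) ∧ (S.z * (S.f * t) = S.f * (S.z * t)) ∧
      (S.z * (S.h * t) = S.h * (S.z * t)) := by
  refine ⟨⟨S.z_e, S.z_f, S.z_h⟩, fun t => ?_⟩
  simp only [← mul_assoc, S.z_e, S.z_f, S.z_h, and_self]

lemma wx_eq : S.wx = (2 : k) • (S.h * S.x) - (3 : k) • S.x + (4 : k) • (S.e * S.y) := by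
  unfold wx cas
  rw [ad_apply]
  simp only [mul_add, add_mul, mul_sub, sub_mul, smul_mul_assoc, mul_smul_comm, mul_assoc, pow_two,
    S.order, smul_add, smul_sub]
  module

lemma wy_eq : S.wy = -(2 : k) • (S.h * S.y) - (3 : k) • S.y + (4 : k) • (S.f * S.x) := by
  unfold wy cas
  rw [ad_apply]
  simp only [mul_add, add_mul, mul_sub, sub_mul, smul_mul_assoc, mul_smul_comm, mul_assoc, pow_two,
    S.order, smul_add, smul_sub]
  module

/-- This quadratic equation, shared by `x` and `y`, is all that the calculus with `lpoly` and
`rpoly` uses: together with `ad Δ` being left minus right multiplication, it expresses both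
multiplications through `ad Δ`. -/
lemma ad_cas_wx : ad k S.cas S.wx = (2 : k) • (S.cas * S.x + S.x * S.cas) + (3 : k) • S.x := by
  rw [wx_eq]
  unfold cas
  rw [ad_apply]
  simp only [mul_add, add_mul, mul_sub, sub_mul, smul_mul_assoc, mul_smul_comm, mul_assoc, pow_two,
    S.order, smul_add, smul_sub, smul_neg]
  module

lemma ad_cas_wy : ad k S.cas S.wy = (2 : k) • (S.cas * S.y + S.y * S.cas) + (3 : k) • S.y := by
  rw [wy_eq]
  unfold cas
  rw [ad_apply]
  simp only [mul_add, add_mul, mul_sub, sub_mul, smul_mul_assoc, mul_smul_comm, mul_assoc, pow_two,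
    S.order, smul_add, smul_sub, smul_neg]
  module

lemma ad_e_quad [CharZero k] (q : k[X]) : ad k S.e (S.quad q) = 0 := by
  have hq := aeval_mul_comm S.cas_e q
  unfold quad
  rw [ad_apply, mul_sub, sub_mul _ _ S.e, hq]
  simp only [mul_add, add_mul, mul_sub, sub_mul, smul_mul_assoc, mul_smul_comm, mul_assoc, pow_two,
    S.order, S.z_order, smul_add, smul_sub, smul_neg]
  module

lemma ad_f_quad [CharZero k] (q : k[X]) : ad k S.f (S.quad q) = 0 := by
  have hq := aeval_mul_comm S.cas_f q
  unfold quad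
  rw [ad_apply, mul_sub, sub_mul _ _ S.f, hq]
  simp only [mul_add, add_mul, mul_sub, sub_mul, smul_mul_assoc, mul_smul_comm, mul_assoc, pow_two,
    S.order, S.z_order, smul_add, smul_sub, smul_neg]
  module

lemma ad_h_quad [CharZero k] (q : k[X]) : ad k S.h (S.quad q) = 0 := by
  have hq := aeval_mul_comm S.cas_h q
  unfold quad
  rw [ad_apply, mul_sub, sub_mul _ _ S.h, hq]
  simp only [mul_add, add_mul, mul_sub, sub_mul, smul_mul_assoc, mul_smul_comm, mul_assoc, pow_two,
    S.order, S.z_order, smul_add, smul_sub, smul_neg]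
  module

/-- The factor 4 clears the denominator left by `e y` when it is eliminated in favour of `wx`. Every
term on the right has the form `P(Δ) u` or `u P(Δ)` with `u` equal to `x` or `wx`, so the vanishing
can be checked on polynomials. -/
lemma ad_x_quad [CharZero k] (q : k[X]) : (4 : k) • ad k S.x (S.quad q) =
    S.z * S.wx + S.wx * S.z + S.x * S.z - S.z * S.x
      - (4 : k) • (S.x * aeval S.cas q - aeval S.cas q * S.x) := by
  have h1 : (4 : k) • ad k S.x (S.quad q + aeval S.cas q) =
      S.z * S.wx + S.wx * S.z + S.x * S.z - S.z * S.x := by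
    rw [wx_eq]
    unfold quad
    rw [ad_apply, sub_add_cancel]
    simp only [mul_add, add_mul, mul_sub, sub_mul, smul_mul_assoc, mul_smul_comm, mul_assoc,
      pow_two, S.order, S.z_order, smul_add, smul_sub, smul_neg]
    module
  rw [map_add, smul_add, ad_apply S.x (aeval S.cas q)] at h1
  rw [← h1]; abel

/-- The invariant pairing of `V` with `[Δ, V]` recovers the quadratic element; through this identity
`t` enters the relations of the commutator quotient. -/
lemma x_wy [CharZero k] (q : k[X]) : S.x * S.wy - S.y * S.wx =
    (3 : k) • S.z - (4 : k) • aeval S.cas q - (4 : k) • S.quad q := by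
  rw [wx_eq, wy_eq]
  unfold quad
  simp only [mul_add, add_mul, mul_sub, sub_mul, smul_mul_assoc, mul_smul_comm, mul_assoc,
    pow_two, S.order, S.z_order, smul_add, smul_sub, smul_neg]
  module

end System

/-! ### Centrality of the quadratic element and the relations `rel`. -/

namespace System

variable {k : Type*} [Field k] {p : k[X]} {A : Type*} [Ring A] [Algebra k A] (S : System p A)

/-- The five generators generate the algebra. -/
def Generates : Prop := Algebra.adjoin k {S.e, S.f, S.h, S.x, S.y} = ⊤

lemma comm_of_generates (hg : S.Generates) {a : A} (he : ad k S.e a = 0) (hf : ad k S.f a = 0)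
    (hh : ad k S.h a = 0) (hx : ad k S.x a = 0) (hy : ad k S.y a = 0) (b : A) :
    b * a = a * b := by
  have hb : b ∈ Algebra.adjoin k {S.e, S.f, S.h, S.x, S.y} := by rw [hg]; trivial
  induction hb using Algebra.adjoin_induction with
  | mem b hb =>
    simp only [ad_apply, sub_eq_zero] at he hf hh hx hy
    rcases hb with rfl | rfl | rfl | rfl | rfl <;> assumption
  | algebraMap r => exact Algebra.commutes r a
  | add b c _ _ hb hc => rw [add_mul, mul_add, hb, hc]
  | mul b c _ _ hb hc => rw [mul_assoc, hc, ← mul_assoc, hb, mul_assoc]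

/-- Half of the adjoint action of the Casimir element. -/
noncomputable def v : Module.End k A := (1 / 2 : k) • ad k S.cas

lemma v_cas_mul (a : A) : S.v (S.cas * a) = S.cas * S.v a := by
  simp only [v, LinearMap.smul_apply, ad_apply, mul_smul_comm, mul_sub, mul_assoc]

lemma v_mul_cas (a : A) : S.v (a * S.cas) = S.v a * S.cas := by
  simp only [v, LinearMap.smul_apply, ad_apply, smul_mul_assoc, sub_mul, mul_assoc]

lemma aeval_v_cas_mul (E : k[X]) (a : A) :
    aeval S.v E (S.cas * a) = S.cas * aeval S.v E a := by
  have h : S.v * LinearMap.mulLeft k S.cas = LinearMap.mulLeft k S.cas * S.v := by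
    ext a; exact S.v_cas_mul a
  exact LinearMap.congr_fun (aeval_mul_comm h E) a

lemma aeval_v_mul_cas (E : k[X]) (a : A) :
    aeval S.v E (a * S.cas) = aeval S.v E a * S.cas := by
  have h : S.v * LinearMap.mulRight k S.cas = LinearMap.mulRight k S.cas * S.v := by
    ext a; exact S.v_mul_cas a
  exact LinearMap.congr_fun (aeval_mul_comm h E) a

variable {u : A}

lemma aeval_v_mul (E G : k[X]) (a : A) : aeval S.v (E * G) a = aeval S.v E (aeval S.v G a) := by
  rw [map_mul]; rfl

section

variable [CharZero k]
  (hu : ad k S.cas (ad k S.cas u) = (2 : k) • (S.cas * u + u * S.cas) + (3 : k) • u)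
include hu

lemma aeval_v_lpoly : aeval S.v (lpoly k) u = S.cas * u := by
  rw [lpoly, map_sub, map_add, pow_two, map_mul, aeval_C, aeval_X]
  simp only [LinearMap.sub_apply, LinearMap.add_apply, Module.End.mul_apply,
    Module.algebraMap_end_apply, v, LinearMap.smul_apply, map_smul, hu]
  rw [ad_apply]
  module

lemma aeval_v_rpoly : aeval S.v (rpoly k) u = u * S.cas := by
  rw [rpoly, map_sub, map_sub, pow_two, map_mul, aeval_C, aeval_X]
  simp only [LinearMap.sub_apply, LinearMap.add_apply, Module.End.mul_apply,
    Module.algebraMap_end_apply, v, LinearMap.smul_apply, map_smul, hu]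
  rw [ad_apply]
  module

/-- Together with its right-hand analogue this turns a polynomial identity in `lpoly` and `rpoly`
into an identity between products of `P(Δ)` and `u`; it works because `v` commutes with both
multiplications by `Δ`. -/
lemma aeval_v_mul_lpoly (E P : k[X]) :
    aeval S.v (E * P.comp (lpoly k)) u = aeval S.cas P * aeval S.v E u := by
  induction P using Polynomial.induction_on' with
  | add P Q hP hQ => rw [add_comp, mul_add, map_add, LinearMap.add_apply, hP, hQ, map_add, add_mul]
  | monomial n a =>
    have h : ∀ n : ℕ, aeval S.v (E * lpoly k ^ n) u = S.cas ^ n * aeval S.v E u := by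
      intro n
      induction n with
      | zero => simp
      | succ n ih =>
        rw [pow_succ, ← mul_assoc, aeval_v_mul, S.aeval_v_lpoly hu, S.aeval_v_cas_mul, ih,
          ← mul_assoc, pow_succ']
    rw [monomial_comp, aeval_monomial, mul_left_comm, ← smul_eq_C_mul, map_smul,
      LinearMap.smul_apply, h, ← Algebra.smul_def, smul_mul_assoc]

lemma aeval_v_mul_rpoly (E P : k[X]) :
    aeval S.v (E * P.comp (rpoly k)) u = aeval S.v E u * aeval S.cas P := by
  induction P using Polynomial.induction_on' with
  | add P Q hP hQ => rw [add_comp, mul_add, map_add, LinearMap.add_apply, hP, hQ, map_add, mul_add]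
  | monomial n a =>
    have h : ∀ n : ℕ, aeval S.v (E * rpoly k ^ n) u = aeval S.v E u * S.cas ^ n := by
      intro n
      induction n with
      | zero => simp
      | succ n ih =>
        rw [pow_succ, ← mul_assoc, aeval_v_mul, S.aeval_v_rpoly hu, S.aeval_v_mul_cas, ih,
          mul_assoc, pow_succ]
    rw [monomial_comp, aeval_monomial, mul_left_comm, ← smul_eq_C_mul, map_smul,
      LinearMap.smul_apply, h, ← Algebra.smul_def, mul_smul_comm]

lemma aeval_v_comp_lpoly (P : k[X]) : aeval S.v (P.comp (lpoly k)) u = aeval S.cas P * u := by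
  simpa using S.aeval_v_mul_lpoly hu 1 P

lemma aeval_v_comp_rpoly (P : k[X]) : aeval S.v (P.comp (rpoly k)) u = u * aeval S.cas P := by
  simpa using S.aeval_v_mul_rpoly hu 1 P

lemma aeval_v_two_X_lpoly (P : k[X]) :
    aeval S.v (2 * X * P.comp (lpoly k)) u = aeval S.cas P * ad k S.cas u := by
  rw [S.aeval_v_mul_lpoly hu, show (2 : k[X]) = C 2 from rfl, ← smul_eq_C_mul, map_smul, aeval_X,
    v, smul_smul]
  norm_num

lemma aeval_v_two_X_rpoly (P : k[X]) :
    aeval S.v (2 * X * P.comp (rpoly k)) u = ad k S.cas u * aeval S.cas P := by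
  rw [S.aeval_v_mul_rpoly hu, show (2 : k[X]) = C 2 from rfl, ← smul_eq_C_mul, map_smul, aeval_X,
    v, smul_smul]
  norm_num

end

section Central

variable [CharZero k] {q : k[X]} (hq : Balanced p q)
include hq

/-- Evaluated at `v` and applied to `x`, the equation `Balanced` says precisely that the right-hand
side of `ad_x_quad` vanishes. -/
lemma ad_x_quad_eq_zero : ad k S.x (S.quad q) = 0 := by
  have h1 := S.ad_x_quad q
  have h2 := congrArg (fun P => aeval S.v P S.x) hq
  have hx := S.ad_cas_wx
  have h4 : (4 : k[X]) = C 4 := rfl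
  simp only [h4, mul_add, map_add, map_sub, LinearMap.add_apply, LinearMap.sub_apply,
    ← smul_eq_C_mul, map_smul, LinearMap.smul_apply] at h2
  rw [S.aeval_v_two_X_lpoly hx, S.aeval_v_two_X_rpoly hx, S.aeval_v_comp_lpoly hx,
    S.aeval_v_comp_rpoly hx, S.aeval_v_comp_lpoly hx, S.aeval_v_comp_rpoly hx] at h2
  rw [h2] at h1
  have h3 : (4 : k) • ad k S.x (S.quad q) = 0 := by
    rw [h1]; simp only [z, wx]; abel
  exact (smul_eq_zero.1 h3).resolve_left (by norm_num)

lemma ad_y_quad_eq_zero : ad k S.y (S.quad q) = 0 := by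
  have h1 := S.ad_x_quad_eq_zero hq
  have h2 := S.ad_f_quad q
  rw [ad_apply, sub_eq_zero] at h1 h2 ⊢
  have h3 : S.y = S.f * S.x - S.x * S.f := by rw [S.fx]; abel
  rw [h3, sub_mul, mul_sub, mul_assoc, mul_assoc, h1, h2, ← mul_assoc, ← mul_assoc, h1, h2,
    mul_assoc, mul_assoc]

lemma quad_comm (hg : S.Generates) (b : A) : b * S.quad q = S.quad q * b :=
  S.comm_of_generates hg (S.ad_e_quad q) (S.ad_f_quad q) (S.ad_h_quad q)
    (S.ad_x_quad_eq_zero hq) (S.ad_y_quad_eq_zero hq) b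

end Central

section Relations

/-- Twice the class of `[x, P(Δ) y]` modulo the image of the adjoint action of `sl₂`. -/
noncomputable def rel (P : k[X]) : A :=
  S.x * (aeval S.cas P * S.y) - S.y * (aeval S.cas P * S.x) + aeval S.cas P * S.z

/-- By the Leibniz rule `ad f` of `[x, P(Δ) x]` is `[y, P(Δ) x] + [x, P(Δ) y]`, so modulo `[sl₂, A]`
the bracket may be replaced by half its antisymmetrization, which is the invariant `rel P`. -/
lemma bracket_y (P : k[X]) : (2 : k) • ad k S.x (aeval S.cas P * S.y) =
    S.rel P + ad k S.f (ad k S.x (aeval S.cas P * S.x)) := by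
  have h1 : aeval S.cas P * S.f = S.f * aeval S.cas P := aeval_mul_comm S.cas_f P
  have h2 : ∀ t, aeval S.cas P * (S.f * t) = S.f * (aeval S.cas P * t) := fun t => by
    rw [← mul_assoc, h1, mul_assoc]
  simp only [rel, ad_apply, mul_sub, sub_mul, mul_assoc, S.order, h1, h2]
  module

/-- This is `lpoly ^ n = a(rpoly) + 2 X b(rpoly)` read as operators on `y`, since `2 v` sends `y` to
`wy`. -/
lemma cas_pow_mul_y (n : ℕ) : S.cas ^ n * S.y =
    S.y * aeval S.cas (splitPow k n).1 + S.wy * aeval S.cas (splitPow k n).2 := by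
  induction n with
  | zero => simp [splitPow]
  | succ n ih =>
    have h1 : S.cas * S.y = S.y * S.cas + S.wy := by rw [wy, ad_apply]; abel
    have h2 : S.cas * S.wy = S.wy * S.cas + (2 : k) • S.wy + (4 : k) • (S.y * S.cas)
        + (3 : k) • S.y := by
      have := S.ad_cas_wy
      rw [ad_apply, h1, sub_eq_iff_eq_add] at this
      rw [this]; module
    have h3 : (3 : k[X]) = C 3 := rfl
    have h4 : (4 : k[X]) = C 4 := rfl
    have h5 : (2 : k[X]) = C 2 := rfl
    rw [pow_succ', mul_assoc, ih, mul_add, ← mul_assoc, ← mul_assoc, h1, h2, splitPow]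
    simp only [h3, h4, h5, map_add, map_mul, aeval_X, aeval_C, add_mul, mul_add, smul_mul_assoc,
      mul_assoc, ← Algebra.smul_def, mul_smul_comm]
    module

lemma cas_pow_mul_x (n : ℕ) : S.cas ^ n * S.x =
    S.x * aeval S.cas (splitPow k n).1 + S.wx * aeval S.cas (splitPow k n).2 := by
  induction n with
  | zero => simp [splitPow]
  | succ n ih =>
    have h1 : S.cas * S.x = S.x * S.cas + S.wx := by rw [wx, ad_apply]; abel
    have h2 : S.cas * S.wx = S.wx * S.cas + (2 : k) • S.wx + (4 : k) • (S.x * S.cas)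
        + (3 : k) • S.x := by
      have := S.ad_cas_wx
      rw [ad_apply, h1, sub_eq_iff_eq_add] at this
      rw [this]; module
    have h3 : (3 : k[X]) = C 3 := rfl
    have h4 : (4 : k[X]) = C 4 := rfl
    have h5 : (2 : k[X]) = C 2 := rfl
    rw [pow_succ', mul_assoc, ih, mul_add, ← mul_assoc, ← mul_assoc, h1, h2, splitPow]
    simp only [h3, h4, h5, map_add, map_mul, aeval_X, aeval_C, add_mul, mul_add, smul_mul_assoc,
      mul_assoc, ← Algebra.smul_def, mul_smul_comm]
    module

variable [CharZero k]

lemma rel_X_pow (q : k[X]) (n : ℕ) : S.rel (X ^ n) = aeval S.cas (relPoly p q n)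
    - (4 : k) • (S.quad q * aeval S.cas (splitPow k n).2) := by
  have h1 := S.x_wy q
  have h3 : (3 : k[X]) = C 3 := rfl
  have h4 : (4 : k[X]) = C 4 := rfl
  have h5 : S.cas ^ n * S.z = S.z * S.cas ^ n := by
    have := aeval_mul_comm S.z_cas.symm (X ^ n : k[X])
    simpa using this
  rw [rel, aeval_X_pow, S.cas_pow_mul_y, S.cas_pow_mul_x]
  have h6 : S.x * (S.y * aeval S.cas (splitPow k n).1 + S.wy * aeval S.cas (splitPow k n).2) -
      S.y * (S.x * aeval S.cas (splitPow k n).1 + S.wx * aeval S.cas (splitPow k n).2) +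
      S.cas ^ n * S.z = S.z * aeval S.cas (splitPow k n).1
        + (S.x * S.wy - S.y * S.wx) * aeval S.cas (splitPow k n).2 + S.z * S.cas ^ n := by
    rw [h5]
    simp only [mul_add, sub_mul, ← mul_assoc, S.xy', add_mul]
    abel
  rw [h6, h1, relPoly]
  simp only [h3, h4, map_add, map_mul, map_sub, aeval_X_pow, aeval_C, sub_mul, smul_mul_assoc,
    ← Algebra.smul_def, mul_add, z]
  abel

/-- Since `Δ` commutes with `[x, y]`, one has `wy x - wx y = x wy - y wx`, an element commuting with
`Δ`. The left side therefore becomes `x [P(Δ), wy] - y [P(Δ), wx]`, and the hypothesis rewrites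
`[P(Δ), wy]` as `Q(Δ) y + y Q(Δ)`, and likewise for `x`. -/
lemma rel_eq_of_comp {P Q : k[X]} (h : Q.comp (lpoly k) + Q.comp (rpoly k) =
    2 * X * (P.comp (lpoly k) - P.comp (rpoly k))) :
    ad k S.x (aeval S.cas P * S.wy) - ad k S.y (aeval S.cas P * S.wx) = S.rel Q := by
  obtain ⟨q, -⟩ := exists_balanced p
  have hc : S.cas * (S.x * S.wy - S.y * S.wx) = (S.x * S.wy - S.y * S.wx) * S.cas := by
    have h1 : S.cas * S.quad q = S.quad q * S.cas := by
      have he : S.e * S.quad q = S.quad q * S.e := sub_eq_zero.1 (S.ad_e_quad q)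
      have hf : S.f * S.quad q = S.quad q * S.f := sub_eq_zero.1 (S.ad_f_quad q)
      have hh : S.h * S.quad q = S.quad q * S.h := sub_eq_zero.1 (S.ad_h_quad q)
      have h1 : S.h ^ 2 * S.quad q = S.quad q * S.h ^ 2 := (Commute.pow_left hh 2).eq
      have h2 : S.e * S.f * S.quad q = S.quad q * (S.e * S.f) := (Commute.mul_left he hf).eq
      rw [cas, sub_mul, add_mul, h1, smul_mul_assoc, h2, smul_mul_assoc, hh]
      simp only [mul_sub, mul_add, mul_smul_comm]
    have h2 := aeval_mul_comm (rfl : S.cas * S.cas = _) q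
    rw [S.x_wy q, mul_sub, mul_sub, mul_smul_comm, mul_smul_comm, mul_smul_comm, h1, ← h2,
      ← S.z_cas]
    simp only [sub_mul, smul_mul_assoc]
  have hx := congrArg (fun P => aeval S.v P S.x) h
  have hy := congrArg (fun P => aeval S.v P S.y) h
  simp only [mul_sub, map_add, map_sub, LinearMap.add_apply, LinearMap.sub_apply] at hx hy
  rw [S.aeval_v_comp_lpoly S.ad_cas_wx, S.aeval_v_comp_rpoly S.ad_cas_wx,
    S.aeval_v_two_X_lpoly S.ad_cas_wx, S.aeval_v_two_X_rpoly S.ad_cas_wx] at hx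
  rw [S.aeval_v_comp_lpoly S.ad_cas_wy, S.aeval_v_comp_rpoly S.ad_cas_wy,
    S.aeval_v_two_X_lpoly S.ad_cas_wy, S.aeval_v_two_X_rpoly S.ad_cas_wy] at hy
  rw [← wx] at hx
  rw [← wy] at hy
  have h1 : aeval S.cas Q * S.z = S.x * (S.y * aeval S.cas Q) - S.y * (S.x * aeval S.cas Q) := by
    rw [aeval_mul_comm S.z_cas.symm, ← mul_assoc, ← mul_assoc, ← sub_mul, S.xy',
      add_sub_cancel_left]
  have h2 : aeval S.cas P * (S.x * S.wy - S.y * S.wx) =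
      S.x * (S.wy * aeval S.cas P) - S.y * (S.wx * aeval S.cas P) := by
    rw [aeval_mul_comm hc, sub_mul, mul_assoc, mul_assoc]
  have h3 : S.wy * S.x - S.wx * S.y = S.x * S.wy - S.y * S.wx := by
    have : S.cas * (S.x * S.y - S.y * S.x) = (S.x * S.y - S.y * S.x) * S.cas := by
      rw [S.xy', add_sub_cancel_left, S.z_cas]
    simp only [mul_sub, sub_mul, ← mul_assoc] at this
    simp only [wx, wy, ad_apply, mul_sub, sub_mul, ← mul_assoc]
    linear_combination (norm := noncomm_ring) -this
  calc ad k S.x (aeval S.cas P * S.wy) - ad k S.y (aeval S.cas P * S.wx)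
      = S.x * (aeval S.cas P * S.wy) - S.y * (aeval S.cas P * S.wx)
        - aeval S.cas P * (S.wy * S.x - S.wx * S.y) := by
        simp only [ad_apply, mul_sub, mul_assoc]; abel
    _ = S.x * (aeval S.cas P * S.wy - S.wy * aeval S.cas P)
        - S.y * (aeval S.cas P * S.wx - S.wx * aeval S.cas P) := by
        rw [h3, h2]; simp only [mul_sub]; abel
    _ = S.rel Q := by
        rw [← hx, ← hy, rel, h1]; simp only [mul_add]; abel

end Relations

end System

/-! ### Local finiteness of the adjoint action. -/

lemma ad_pow_mul_eq_zero {k A : Type*} [Field k] [Ring A] [Algebra k A] (g : A) (s : ℕ) :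
    ∀ (n m : ℕ) (a b : A), n + m = s → (ad k g ^ n) a = 0 → (ad k g ^ m) b = 0 →
      (ad k g ^ s) (a * b) = 0 := by
  induction s with
  | zero =>
    intro n m a b h ha _
    obtain rfl : n = 0 := by omega
    rw [pow_zero, Module.End.one_apply] at ha
    simp [ha]
  | succ s ih =>
    intro n m a b h ha hb
    rw [pow_succ, Module.End.mul_apply, ad_mul, map_add]
    rcases n with _ | n
    · rw [pow_zero, Module.End.one_apply] at ha
      simp [ha]
    rcases m with _ | m
    · rw [pow_zero, Module.End.one_apply] at hb
      simp [hb]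
    have h1 := ih n (m + 1) (ad k g a) b (by omega)
      (by rwa [← Module.End.mul_apply, ← pow_succ]) hb
    have h2 := ih (n + 1) m a (ad k g b) (by omega) ha
      (by rwa [← Module.End.mul_apply, ← pow_succ])
    rw [h1, h2, add_zero]

namespace System

variable {k : Type*} [Field k] {p : k[X]} {A : Type*} [Ring A] [Algebra k A] (S : System p A)

lemma induction_generators (hg : S.Generates) {Q : A → Prop} (he : Q S.e) (hf : Q S.f)
    (hh : Q S.h) (hx : Q S.x) (hy : Q S.y) (halg : ∀ r : k, Q (algebraMap k A r))
    (hadd : ∀ a b, Q a → Q b → Q (a + b)) (hmul : ∀ a b, Q a → Q b → Q (a * b)) (a : A) : Q a := by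
  have ha : a ∈ Algebra.adjoin k {S.e, S.f, S.h, S.x, S.y} := by rw [hg]; trivial
  induction ha using Algebra.adjoin_induction with
  | mem b hb => rcases hb with rfl | rfl | rfl | rfl | rfl <;> assumption
  | algebraMap r => exact halg r
  | add b c _ _ hb hc => exact hadd b c hb hc
  | mul b c _ _ hb hc => exact hmul b c hb hc

/-- The image of the adjoint action of `sl₂`. -/
def adImage : Submodule k A :=
  LinearMap.range (ad k S.e) ⊔ LinearMap.range (ad k S.f) ⊔ LinearMap.range (ad k S.h)

lemma ad_e_mem (a : A) : ad k S.e a ∈ S.adImage :=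
  Submodule.mem_sup_left (Submodule.mem_sup_left ⟨a, rfl⟩)

lemma ad_f_mem (a : A) : ad k S.f a ∈ S.adImage :=
  Submodule.mem_sup_left (Submodule.mem_sup_right ⟨a, rfl⟩)

lemma ad_h_mem (a : A) : ad k S.h a ∈ S.adImage := Submodule.mem_sup_right ⟨a, rfl⟩

lemma opTriple : OpTriple (ad k S.e) (ad k S.f) (ad k S.h) where
  he := by
    ext a
    simp only [Module.End.mul_apply, LinearMap.add_apply, LinearMap.smul_apply, ad_apply, mul_sub,
      sub_mul, mul_assoc, S.order, mul_add, mul_smul_comm]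
    module
  hf := by
    ext a
    simp only [Module.End.mul_apply, LinearMap.sub_apply, LinearMap.smul_apply, ad_apply, mul_sub,
      sub_mul, mul_assoc, S.order, mul_add, mul_smul_comm]
    module
  ef := by
    ext a
    simp only [Module.End.mul_apply, LinearMap.add_apply, LinearMap.smul_apply, ad_apply, mul_sub,
      sub_mul, mul_assoc, S.order, mul_add, mul_smul_comm]
    module

lemma ad_h_e : ad k S.h S.e = (2 : k) • S.e := by rw [ad_apply, S.he]; abel
lemma ad_h_f : ad k S.h S.f = (-2 : k) • S.f := by rw [ad_apply, S.hf]; module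
lemma ad_h_x : ad k S.h S.x = (1 : k) • S.x := by rw [ad_apply, S.hx]; module
lemma ad_h_y : ad k S.h S.y = (-1 : k) • S.y := by rw [ad_apply, S.hy]; module
lemma ad_f_e : ad k S.f S.e = - S.h := by rw [ad_apply, S.ef]; abel
lemma ad_f_h : ad k S.f S.h = (2 : k) • S.f := by rw [ad_apply, S.hf]; abel
lemma ad_f_x : ad k S.f S.x = S.y := by rw [ad_apply, S.fx]; abel
lemma ad_f_y : ad k S.f S.y = 0 := by rw [ad_apply, S.fy]; abel
lemma ad_e_f : ad k S.e S.f = S.h := by rw [ad_apply, S.ef]; abel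
lemma ad_e_h : ad k S.e S.h = (-2 : k) • S.e := by rw [ad_apply, S.he]; module
lemma ad_e_x : ad k S.e S.x = 0 := by rw [ad_apply, S.ex]; abel
lemma ad_e_y : ad k S.e S.y = S.x := by rw [ad_apply, S.ey]; abel
lemma ad_self (a : A) : ad k a a = 0 := sub_self _

lemma iSup_eigenspace (hg : S.Generates) : ⨆ r : k, (ad k S.h).eigenspace r = ⊤ := by
  rw [eq_top_iff]
  have hmem : ∀ (r : k) (a : A), ad k S.h a = r • a → a ∈ ⨆ r : k, (ad k S.h).eigenspace r :=
    fun r a ha => Submodule.mem_iSup_of_mem r (Module.End.mem_eigenspace_iff.2 ha)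
  rintro a -
  refine S.induction_generators hg (hmem _ _ S.ad_h_e) (hmem _ _ S.ad_h_f)
    (hmem 0 _ (by rw [ad_self, zero_smul])) (hmem _ _ S.ad_h_x) (hmem _ _ S.ad_h_y) ?_
    (fun a b => add_mem) ?_ a
  · intro r
    refine hmem 0 _ ?_
    rw [ad_apply, Algebra.commutes, sub_self, zero_smul]
  · intro a b ha hb
    induction ha using Submodule.iSup_induction' with
    | mem r a ha =>
      induction hb using Submodule.iSup_induction' with
      | mem s b hb =>
        rw [Module.End.mem_eigenspace_iff] at ha hb
        refine hmem (r + s) _ ?_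
        rw [ad_mul, ha, hb, smul_mul_assoc, mul_smul_comm, add_smul]
      | zero => rw [mul_zero]; exact zero_mem _
      | add b c _ _ hb hc => rw [mul_add]; exact add_mem hb hc
    | zero => rw [zero_mul]; exact zero_mem _
    | add a c _ _ ha hc => rw [add_mul]; exact add_mem ha hc

lemma exists_ad_pow_eq_zero (hg : S.Generates) {g : A} (he : (ad k g ^ 3) S.e = 0)
    (hf : (ad k g ^ 3) S.f = 0) (hh : (ad k g ^ 3) S.h = 0) (hx : (ad k g ^ 3) S.x = 0)
    (hy : (ad k g ^ 3) S.y = 0) (a : A) : ∃ n, (ad k g ^ n) a = 0 := by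
  refine S.induction_generators hg (Q := fun a => ∃ n, (ad k g ^ n) a = 0) ⟨3, he⟩ ⟨3, hf⟩
    ⟨3, hh⟩ ⟨3, hx⟩ ⟨3, hy⟩ ?_ ?_ ?_ a
  · intro r
    refine ⟨1, ?_⟩
    rw [pow_one, ad_apply, Algebra.commutes, sub_self]
  · rintro a b ⟨n, hn⟩ ⟨m, hm⟩
    refine ⟨n + m, ?_⟩
    rw [map_add]
    nth_rw 1 [add_comm n m]
    rw [pow_add, pow_add, Module.End.mul_apply, Module.End.mul_apply, hn, hm, map_zero, map_zero,
      add_zero]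
  · rintro a b ⟨n, hn⟩ ⟨m, hm⟩
    exact ⟨n + m, ad_pow_mul_eq_zero g _ n m a b rfl hn hm⟩

/-- The generators are weight vectors killed by the cubes of `ad e` and `ad f`; both properties pass
to sums and products suitably, so `A` is a locally finite weight module and the general statement on
`sl₂`-triples applies. -/
theorem eq_zero_of_mem_adImage [CharZero k] (hg : S.Generates) {a : A} (he : ad k S.e a = 0)
    (hh : ad k S.h a = 0) (ha : a ∈ S.adImage) : a = 0 := by
  refine S.opTriple.eq_zero_of_invariant (S.iSup_eigenspace hg)
    (S.exists_ad_pow_eq_zero hg ?_ ?_ ?_ ?_ ?_) (S.exists_ad_pow_eq_zero hg ?_ ?_ ?_ ?_ ?_)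
    he hh ha <;>
  simp [pow_succ, Module.End.mul_apply, ad_self, ad_e_f, ad_e_h, ad_e_x, ad_e_y, ad_f_e, ad_f_h,
    ad_f_x, ad_f_y]

/-! ### The filtration by degree in `x` and `y`. -/

section Filtration

/-- The subalgebra generated by `sl₂`. -/
def env : Subalgebra k A := Algebra.adjoin k {S.e, S.f, S.h}

lemma e_mem_env : S.e ∈ S.env := Algebra.subset_adjoin (by simp)
lemma f_mem_env : S.f ∈ S.env := Algebra.subset_adjoin (by simp)
lemma h_mem_env : S.h ∈ S.env := Algebra.subset_adjoin (by simp)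

lemma cas_mem_env : S.cas ∈ S.env :=
  sub_mem (add_mem (pow_mem S.h_mem_env 2) (Subalgebra.smul_mem _
    (mul_mem S.e_mem_env S.f_mem_env) _)) (Subalgebra.smul_mem _ S.h_mem_env _)

lemma aeval_cas_mem_env (P : k[X]) : aeval S.cas P ∈ S.env :=
  Algebra.adjoin_le (Set.singleton_subset_iff.2 S.cas_mem_env) (aeval_mem_adjoin_singleton k S.cas)

/-- The span of the elements of degree less than `n` in `x` and `y`. -/
def filt : ℕ → Submodule k A
  | 0 => ⊥
  | n + 1 => Subalgebra.toSubmodule S.env ⊔ filt n ⊔ (filt n).map (LinearMap.mulRight k S.x) ⊔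
      (filt n).map (LinearMap.mulRight k S.y)

lemma filt_succ_le {n : ℕ} {G : Submodule k A} (h0 : ∀ u ∈ S.env, u ∈ G) (h1 : S.filt n ≤ G)
    (hx : ∀ a ∈ S.filt n, a * S.x ∈ G) (hy : ∀ a ∈ S.filt n, a * S.y ∈ G) :
    S.filt (n + 1) ≤ G := by
  refine sup_le (sup_le (sup_le h0 h1) ?_) ?_
  · rintro _ ⟨a, ha, rfl⟩; exact hx a ha
  · rintro _ ⟨a, ha, rfl⟩; exact hy a ha

lemma env_le_filt (n : ℕ) {u : A} (hu : u ∈ S.env) : u ∈ S.filt (n + 1) :=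
  Submodule.mem_sup_left (Submodule.mem_sup_left (Submodule.mem_sup_left hu))

lemma filt_le_succ (n : ℕ) : S.filt n ≤ S.filt (n + 1) := fun _ ha =>
  Submodule.mem_sup_left (Submodule.mem_sup_left (Submodule.mem_sup_right ha))

lemma filt_mono : Monotone S.filt := monotone_nat_of_le_succ S.filt_le_succ

lemma mul_x_mem {n : ℕ} {a : A} (ha : a ∈ S.filt n) : a * S.x ∈ S.filt (n + 1) :=
  Submodule.mem_sup_left (Submodule.mem_sup_right ⟨a, ha, rfl⟩)

lemma mul_y_mem {n : ℕ} {a : A} (ha : a ∈ S.filt n) : a * S.y ∈ S.filt (n + 1) :=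
  Submodule.mem_sup_right ⟨a, ha, rfl⟩

lemma env_mul_mem {u : A} (hu : u ∈ S.env) (n : ℕ) : ∀ {a : A}, a ∈ S.filt n →
    u * a ∈ S.filt n := by
  induction n with
  | zero => intro a ha; rw [(Submodule.mem_bot k).1 ha, mul_zero]; exact zero_mem _
  | succ n ih =>
    intro a ha
    refine S.filt_succ_le (G := (S.filt (n + 1)).comap (LinearMap.mulLeft k u)) ?_ ?_ ?_ ?_ ha
    · exact fun w hw => S.env_le_filt n (mul_mem hu hw)
    · exact fun b hb => S.filt_le_succ n (ih hb)
    · intro b hb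
      change u * (b * S.x) ∈ S.filt (n + 1)
      rw [← mul_assoc]; exact S.mul_x_mem (ih hb)
    · intro b hb
      change u * (b * S.y) ∈ S.filt (n + 1)
      rw [← mul_assoc]; exact S.mul_y_mem (ih hb)

lemma mul_sl_mem (n : ℕ) : ∀ {a : A}, a ∈ S.filt n →
    a * S.e ∈ S.filt n ∧ a * S.f ∈ S.filt n ∧ a * S.h ∈ S.filt n := by
  induction n with
  | zero => intro a ha; simp [(Submodule.mem_bot k).1 ha]
  | succ n ih =>
    intro a ha
    refine ⟨?_, ?_, ?_⟩
    · refine S.filt_succ_le (G := (S.filt (n + 1)).comap (LinearMap.mulRight k S.e)) ?_ ?_ ?_ ?_ ha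
      · exact fun w hw => S.env_le_filt n (mul_mem hw S.e_mem_env)
      · exact fun b hb => S.filt_le_succ n (ih hb).1
      · intro b hb
        change b * S.x * S.e ∈ S.filt (n + 1)
        rw [mul_assoc, ← S.ex, ← mul_assoc]
        exact S.mul_x_mem (ih hb).1
      · intro b hb
        change b * S.y * S.e ∈ S.filt (n + 1)
        rw [mul_assoc, S.order.1.2.2.2.2.1, mul_sub, ← mul_assoc]
        exact sub_mem (S.mul_y_mem (ih hb).1) (S.mul_x_mem hb)
    · refine S.filt_succ_le (G := (S.filt (n + 1)).comap (LinearMap.mulRight k S.f)) ?_ ?_ ?_ ?_ ha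
      · exact fun w hw => S.env_le_filt n (mul_mem hw S.f_mem_env)
      · exact fun b hb => S.filt_le_succ n (ih hb).2.1
      · intro b hb
        change b * S.x * S.f ∈ S.filt (n + 1)
        rw [mul_assoc, S.order.1.2.2.2.2.2.1, mul_sub, ← mul_assoc]
        exact sub_mem (S.mul_x_mem (ih hb).2.1) (S.mul_y_mem hb)
      · intro b hb
        change b * S.y * S.f ∈ S.filt (n + 1)
        rw [mul_assoc, ← S.fy, ← mul_assoc]
        exact S.mul_y_mem (ih hb).2.1
    · refine S.filt_succ_le (G := (S.filt (n + 1)).comap (LinearMap.mulRight k S.h)) ?_ ?_ ?_ ?_ ha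
      · exact fun w hw => S.env_le_filt n (mul_mem hw S.h_mem_env)
      · exact fun b hb => S.filt_le_succ n (ih hb).2.2
      · intro b hb
        change b * S.x * S.h ∈ S.filt (n + 1)
        rw [mul_assoc, S.order.1.2.2.2.2.2.2.2.1, mul_sub, ← mul_assoc]
        exact sub_mem (S.mul_x_mem (ih hb).2.2) (S.mul_x_mem hb)
      · intro b hb
        change b * S.y * S.h ∈ S.filt (n + 1)
        rw [mul_assoc, S.order.1.2.2.2.2.2.2.2.2.1, mul_add, ← mul_assoc]
        exact add_mem (S.mul_y_mem (ih hb).2.2) (S.mul_y_mem hb)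

lemma mul_env_mem {u : A} (hu : u ∈ S.env) {n : ℕ} : ∀ {a : A}, a ∈ S.filt n →
    a * u ∈ S.filt n := by
  unfold env at hu
  induction hu using Algebra.adjoin_induction with
  | mem b hb =>
    intro a ha
    rcases hb with rfl | rfl | rfl
    exacts [(S.mul_sl_mem n ha).1, (S.mul_sl_mem n ha).2.1, (S.mul_sl_mem n ha).2.2]
  | algebraMap r => intro a ha; rw [← Algebra.commutes, ← Algebra.smul_def]
                    exact Submodule.smul_mem _ _ ha
  | add b c _ _ hb hc => intro a ha; rw [mul_add]; exact add_mem (hb ha) (hc ha)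
  | mul b c _ _ hb hc => intro a ha; rw [← mul_assoc]; exact hc (hb ha)

lemma ad_env_mem {u : A} (hu : u ∈ S.env) {n : ℕ} {a : A} (ha : a ∈ S.filt n) :
    ad k u a ∈ S.filt n :=
  sub_mem (S.env_mul_mem hu n ha) (S.mul_env_mem hu ha)

lemma exists_mem_filt (hg : S.Generates) (a : A) : ∃ n, a ∈ S.filt n := by
  have key : ∀ a, ∀ b n, b ∈ S.filt n → ∃ m, b * a ∈ S.filt m := by
    refine S.induction_generators hg (Q := fun a => ∀ b n, b ∈ S.filt n → ∃ m, b * a ∈ S.filt m)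
      (fun b n hb => ⟨n, (S.mul_sl_mem n hb).1⟩) (fun b n hb => ⟨n, (S.mul_sl_mem n hb).2.1⟩)
      (fun b n hb => ⟨n, (S.mul_sl_mem n hb).2.2⟩) (fun b n hb => ⟨n + 1, S.mul_x_mem hb⟩)
      (fun b n hb => ⟨n + 1, S.mul_y_mem hb⟩) ?_ ?_ ?_
    · intro r b n hb
      refine ⟨n, ?_⟩
      rw [← Algebra.commutes, ← Algebra.smul_def]
      exact Submodule.smul_mem _ _ hb
    · intro a c ha hc b n hb
      obtain ⟨i, hi⟩ := ha b n hb
      obtain ⟨j, hj⟩ := hc b n hb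
      refine ⟨max i j, ?_⟩
      rw [mul_add]
      exact add_mem (S.filt_mono (le_max_left _ _) hi) (S.filt_mono (le_max_right _ _) hj)
    · intro a c ha hc b n hb
      obtain ⟨i, hi⟩ := ha b n hb
      rw [← mul_assoc]
      exact hc _ i hi
  have h1 := key a 1 1 (S.env_le_filt 0 (one_mem _))
  rwa [one_mul] at h1

lemma z_mem_env : S.z ∈ S.env := S.aeval_cas_mem_env p

lemma x_pow_mem (n : ℕ) : S.x ^ n ∈ S.filt (n + 1) := by
  induction n with
  | zero => rw [pow_zero]; exact S.env_le_filt 0 (one_mem _)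
  | succ n ih => rw [pow_succ]; exact S.mul_x_mem ih

lemma ad_f_pow_mem {n : ℕ} {a : A} (ha : a ∈ S.filt n) (b : ℕ) : (ad k S.f ^ b) a ∈ S.filt n := by
  induction b with
  | zero => simpa
  | succ b ih => rw [pow_succ', Module.End.mul_apply]; exact S.ad_env_mem S.f_mem_env ih

/-- Up to lower degree `x` and `y` commute, and then `ad f` acts as the derivation with `x ↦ y`.
Each transposition costs a factor `z` of degree zero, so the error drops by two degrees. -/
lemma ad_f_x_pow (d : ℕ) :
    ((d + 1 : ℕ) : k) • (S.x ^ d * S.y) - ad k S.f (S.x ^ (d + 1)) ∈ S.filt d := by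
  induction d with
  | zero => simp [ad_f_x]
  | succ d ih =>
    have h1 : ((d + 1 + 1 : ℕ) : k) • (S.x ^ (d + 1) * S.y) - ad k S.f (S.x ^ (d + 1 + 1)) =
        (((d + 1 : ℕ) : k) • (S.x ^ d * S.y) - ad k S.f (S.x ^ (d + 1))) * S.x
          + ((d + 1 : ℕ) : k) • (S.x ^ d * S.z) := by
      rw [pow_succ S.x (d + 1), ad_mul, ad_f_x, sub_mul, smul_mul_assoc, mul_assoc _ S.y,
        S.order.1.2.2.2.2.2.2.2.2.2, mul_sub, ← mul_assoc _ S.x S.y, ← pow_succ]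
      push_cast
      module
    rw [h1]
    exact add_mem (S.mul_x_mem ih)
      (Submodule.smul_mem _ _ (S.mul_env_mem S.z_mem_env (S.x_pow_mem d)))

/-- The `env`-span of the `sl₂`-module generated by `x ^ d`. -/
def hw (d : ℕ) : Submodule k A :=
  ⨆ b : ℕ, (Subalgebra.toSubmodule S.env).map (LinearMap.mulRight k ((ad k S.f ^ b) (S.x ^ d)))

lemma mem_hw {u : A} (hu : u ∈ S.env) (b d : ℕ) : u * (ad k S.f ^ b) (S.x ^ d) ∈ S.hw d :=
  Submodule.mem_iSup_of_mem b ⟨u, hu, rfl⟩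

lemma hw_le {d : ℕ} {G : Submodule k A}
    (h : ∀ u ∈ S.env, ∀ b, u * (ad k S.f ^ b) (S.x ^ d) ∈ G) : S.hw d ≤ G := by
  refine iSup_le fun b => ?_
  rintro _ ⟨u, hu, rfl⟩
  exact h u hu b

lemma env_mul_mem_hw {u a : A} (hu : u ∈ S.env) {d : ℕ} (ha : a ∈ S.hw d) : u * a ∈ S.hw d := by
  refine S.hw_le (G := (S.hw d).comap (LinearMap.mulLeft k u)) ?_ ha
  intro w hw b
  change u * (w * _) ∈ S.hw d
  rw [← mul_assoc]
  exact S.mem_hw (mul_mem hu hw) b d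

lemma ad_f_mem_hw {a : A} {d : ℕ} (ha : a ∈ S.hw d) : ad k S.f a ∈ S.hw d := by
  refine S.hw_le (G := (S.hw d).comap (ad k S.f)) ?_ ha
  intro w hw b
  rw [Submodule.mem_comap, ad_mul, ← Module.End.mul_apply, ← pow_succ']
  exact add_mem (S.mem_hw (sub_mem (mul_mem S.f_mem_env hw) (mul_mem hw S.f_mem_env)) b d)
    (S.mem_hw hw _ d)

lemma ad_f_pow_mul_y (b : ℕ) (a : A) : (ad k S.f ^ b) (a * S.y) = (ad k S.f ^ b) a * S.y := by
  induction b with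
  | zero => simp
  | succ b ih =>
    rw [pow_succ', Module.End.mul_apply, Module.End.mul_apply, ih, ad_mul, ad_f_y, mul_zero,
      add_zero]

variable [CharZero k]

lemma x_pow_mul_y (d : ℕ) : ∃ r ∈ S.filt d,
    S.x ^ d * S.y = (((d + 1 : ℕ) : k)⁻¹) • ad k S.f (S.x ^ (d + 1)) + r := by
  refine ⟨((d + 1 : ℕ) : k)⁻¹ • (((d + 1 : ℕ) : k) • (S.x ^ d * S.y) - ad k S.f (S.x ^ (d + 1))),
    Submodule.smul_mem _ _ (S.ad_f_x_pow d), ?_⟩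
  have : ((d + 1 : ℕ) : k) ≠ 0 := Nat.cast_ne_zero.2 d.succ_ne_zero
  rw [smul_sub, smul_smul, inv_mul_cancel₀ this]
  module

lemma ad_f_pow_x_pow_mul_y (b d : ℕ) :
    (ad k S.f ^ b) (S.x ^ d) * S.y ∈ S.hw (d + 1) ⊔ S.filt (d + 1) := by
  obtain ⟨r, hr, h⟩ := S.x_pow_mul_y d
  rw [← ad_f_pow_mul_y, h, map_add, map_smul, ← Module.End.mul_apply, ← pow_succ]
  refine add_mem (Submodule.mem_sup_left (Submodule.smul_mem _ _ ?_))
    (Submodule.mem_sup_right (S.filt_le_succ d (S.ad_f_pow_mem hr b)))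
  simpa using S.mem_hw (one_mem _) (b + 1) (d + 1)

lemma ad_f_pow_x_pow_mul_x (b d : ℕ) :
    (ad k S.f ^ b) (S.x ^ d) * S.x ∈ S.hw (d + 1) ⊔ S.filt (d + 1) := by
  induction b with
  | zero =>
    refine Submodule.mem_sup_left ?_
    simpa [pow_succ] using S.mem_hw (one_mem _) 0 (d + 1)
  | succ b ih =>
    have h1 : (ad k S.f ^ (b + 1)) (S.x ^ d) * S.x = ad k S.f ((ad k S.f ^ b) (S.x ^ d) * S.x) -
        (ad k S.f ^ b) (S.x ^ d) * S.y := by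
      rw [ad_mul, ad_f_x, pow_succ', Module.End.mul_apply]; abel
    rw [h1]
    refine sub_mem ?_ (S.ad_f_pow_x_pow_mul_y b d)
    obtain ⟨w, hw, r, hr, h⟩ := Submodule.mem_sup.1 ih
    rw [← h, map_add]
    exact add_mem (Submodule.mem_sup_left (S.ad_f_mem_hw hw))
      (Submodule.mem_sup_right (S.ad_env_mem S.f_mem_env hr))

/-- The layer of degree `d` is spanned over `U(sl₂)` by the symmetric power of `V`, which is
generated by its highest weight vector `x ^ d` under `f`. -/
lemma filt_succ_le_hw (d : ℕ) : S.filt (d + 1) ≤ S.hw d ⊔ S.filt d := by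
  have hU : ∀ {u a : A} {d : ℕ}, u ∈ S.env → a ∈ S.hw d ⊔ S.filt d → u * a ∈ S.hw d ⊔ S.filt d := by
    intro u a d hu ha
    obtain ⟨w, hw, r, hr, rfl⟩ := Submodule.mem_sup.1 ha
    rw [mul_add]
    exact add_mem (Submodule.mem_sup_left (S.env_mul_mem_hw hu hw))
      (Submodule.mem_sup_right (S.env_mul_mem hu d hr))
  induction d with
  | zero =>
    refine S.filt_succ_le ?_ le_sup_right ?_ ?_
    · intro u hu
      refine Submodule.mem_sup_left ?_
      simpa using S.mem_hw hu 0 0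
    · intro a ha; rw [(Submodule.mem_bot k).1 ha, zero_mul]; exact zero_mem _
    · intro a ha; rw [(Submodule.mem_bot k).1 ha, zero_mul]; exact zero_mem _
  | succ d ih =>
    refine S.filt_succ_le ?_ le_sup_right ?_ ?_
    · intro u hu
      exact Submodule.mem_sup_right (S.env_le_filt d hu)
    · intro a ha
      obtain ⟨w, hw, r, hr, rfl⟩ := Submodule.mem_sup.1 (ih ha)
      rw [add_mul]
      refine add_mem ?_ (Submodule.mem_sup_right (S.mul_x_mem hr))
      refine S.hw_le (G := (S.hw (d + 1) ⊔ S.filt (d + 1)).comap (LinearMap.mulRight k S.x)) ?_ hw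
      intro u hu b
      change u * _ * S.x ∈ S.hw (d + 1) ⊔ S.filt (d + 1)
      rw [mul_assoc]
      exact hU hu (S.ad_f_pow_x_pow_mul_x b d)
    · intro a ha
      obtain ⟨w, hw, r, hr, rfl⟩ := Submodule.mem_sup.1 (ih ha)
      rw [add_mul]
      refine add_mem ?_ (Submodule.mem_sup_right (S.mul_y_mem hr))
      refine S.hw_le (G := (S.hw (d + 1) ⊔ S.filt (d + 1)).comap (LinearMap.mulRight k S.y)) ?_ hw
      intro u hu b
      change u * _ * S.y ∈ S.hw (d + 1) ⊔ S.filt (d + 1)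
      rw [mul_assoc]
      exact hU hu (S.ad_f_pow_x_pow_mul_y b d)

end Filtration
end System

/-! ### The enveloping algebra modulo the image of `ad e`. -/

lemma aeval_mul_of_shift {k A : Type*} [Field k] [Ring A] [Algebra k A] {a g : A} {c : k}
    (h : a * g = g * a + c • g) (P : k[X]) : aeval a P * g = g * aeval a (P.comp (X + C c)) := by
  induction P using Polynomial.induction_on' with
  | add P Q hP hQ => rw [map_add, add_mul, hP, hQ, add_comp, map_add, mul_add]
  | monomial n r =>
    have h1 : a ^ n * g = g * (a + algebraMap k A c) ^ n := by
      induction n with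
      | zero => simp
      | succ n ih =>
        rw [pow_succ', mul_assoc, ih, ← mul_assoc, h, pow_succ', ← mul_assoc, mul_add,
          ← Algebra.commutes c g, ← Algebra.smul_def]
    rw [aeval_monomial, monomial_comp, map_mul, aeval_C, map_pow, map_add, aeval_X, aeval_C,
      mul_assoc, h1, ← mul_assoc, Algebra.commutes, mul_assoc]

namespace System

variable {k : Type*} [Field k] {p : k[X]} {A : Type*} [Ring A] [Algebra k A] (S : System p A)

lemma h_mul_f_pow (j : ℕ) : S.h * S.f ^ j = S.f ^ j * S.h + (-(2 * j) : k) • S.f ^ j := by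
  induction j with
  | zero => simp
  | succ j ih =>
    rw [pow_succ, ← mul_assoc, ih, add_mul, mul_assoc, S.hf, mul_sub, smul_mul_assoc,
      mul_smul_comm, ← mul_assoc]
    push_cast
    module

lemma h_mul_e_pow (j : ℕ) : S.h * S.e ^ j = S.e ^ j * S.h + (2 * j : k) • S.e ^ j := by
  induction j with
  | zero => simp
  | succ j ih =>
    rw [pow_succ, ← mul_assoc, ih, add_mul, mul_assoc, S.he, mul_add, smul_mul_assoc,
      mul_smul_comm, ← mul_assoc]
    push_cast
    module

lemma cas_f_pow (j : ℕ) : S.cas * S.f ^ j = S.f ^ j * S.cas :=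
  (Commute.pow_right (a := S.cas) (b := S.f) S.cas_f j).eq

lemma four_e_f : (4 : k) • (S.e * S.f) = S.cas - aeval S.h (X ^ 2 - (2 : k) • X : k[X]) := by
  rw [map_sub, map_smul, aeval_X_pow, aeval_X, cas]
  abel

lemma four_f_e : (4 : k) • (S.f * S.e) = S.cas - aeval S.h (X ^ 2 + (2 : k) • X : k[X]) := by
  rw [map_add, map_smul, aeval_X_pow, aeval_X, cas, S.ef]
  module

/-- Products spanning the enveloping algebra. -/
def envBasis : Submodule k A := Submodule.span k
  ({b | ∃ (Q : k[X]) (j : ℕ) (P : k[X]), b = aeval S.cas Q * (S.f ^ j * aeval S.h P)} ∪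
    {b | ∃ (Q : k[X]) (j : ℕ) (P : k[X]), b = aeval S.cas Q * (S.e ^ j * aeval S.h P)})

lemma f_mem_envBasis (Q : k[X]) (j : ℕ) (P : k[X]) :
    aeval S.cas Q * (S.f ^ j * aeval S.h P) ∈ S.envBasis :=
  Submodule.subset_span (Or.inl ⟨Q, j, P, rfl⟩)

lemma e_mem_envBasis (Q : k[X]) (j : ℕ) (P : k[X]) :
    aeval S.cas Q * (S.e ^ j * aeval S.h P) ∈ S.envBasis :=
  Submodule.subset_span (Or.inr ⟨Q, j, P, rfl⟩)

lemma mul_mem_envBasis {g : A} (hg : S.cas * g = g * S.cas)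
    (h1 : ∀ j (P : k[X]), g * (S.f ^ j * aeval S.h P) ∈ S.envBasis)
    (h2 : ∀ j (P : k[X]), g * (S.e ^ j * aeval S.h P) ∈ S.envBasis) {b : A} (hb : b ∈ S.envBasis) :
    g * b ∈ S.envBasis := by
  have hQ : ∀ (Q : k[X]) (b : A), b ∈ S.envBasis → aeval S.cas Q * b ∈ S.envBasis := by
    intro Q b hb
    refine (Submodule.span_le (p := S.envBasis.comap (LinearMap.mulLeft k (aeval S.cas Q)))).2 ?_ hb
    rintro _ (⟨Q', j, P, rfl⟩ | ⟨Q', j, P, rfl⟩)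
    · change aeval S.cas Q * (aeval S.cas Q' * _) ∈ S.envBasis
      rw [← mul_assoc, ← map_mul]
      exact S.f_mem_envBasis _ _ _
    · change aeval S.cas Q * (aeval S.cas Q' * _) ∈ S.envBasis
      rw [← mul_assoc, ← map_mul]
      exact S.e_mem_envBasis _ _ _
  refine (Submodule.span_le (p := S.envBasis.comap (LinearMap.mulLeft k g))).2 ?_ hb
  rintro _ (⟨Q, j, P, rfl⟩ | ⟨Q, j, P, rfl⟩)
  · change g * (aeval S.cas Q * _) ∈ S.envBasis
    rw [← mul_assoc, ← aeval_mul_comm hg, mul_assoc]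
    exact hQ Q _ (h1 j P)
  · change g * (aeval S.cas Q * _) ∈ S.envBasis
    rw [← mul_assoc, ← aeval_mul_comm hg, mul_assoc]
    exact hQ Q _ (h2 j P)

variable [CharZero k]

/-- The span contains 1 and is stable under left multiplication by the generators: when `e` meets
`f` the product is a quarter of `Δ` minus a polynomial in `h`, and `h` moves past powers of `e` or
`f` by a shift. -/
lemma env_le_envBasis {u : A} (hu : u ∈ S.env) : u ∈ S.envBasis := by
  have key : ∀ b ∈ S.envBasis, u * b ∈ S.envBasis := by
    have f0 : ∀ j (P : k[X]), S.f ^ j * aeval S.h P ∈ S.envBasis := fun j P => by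
      simpa using S.f_mem_envBasis 1 j P
    have e0 : ∀ j (P : k[X]), S.e ^ j * aeval S.h P ∈ S.envBasis := fun j P => by
      simpa using S.e_mem_envBasis 1 j P
    have f1 : ∀ j (P : k[X]), S.cas * (S.f ^ j * aeval S.h P) ∈ S.envBasis := fun j P => by
      simpa using S.f_mem_envBasis X j P
    have e1 : ∀ j (P : k[X]), S.cas * (S.e ^ j * aeval S.h P) ∈ S.envBasis := fun j P => by
      simpa using S.e_mem_envBasis X j P
    have quarter : ∀ a : A, (4 : k) • a ∈ S.envBasis → a ∈ S.envBasis := fun a ha => by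
      have := Submodule.smul_mem _ (4 : k)⁻¹ ha
      rwa [smul_smul, inv_mul_cancel₀ (by norm_num), one_smul] at this
    unfold env at hu
    induction hu using Algebra.adjoin_induction with
    | mem g hg =>
      intro b hb
      rcases hg with rfl | rfl | rfl
      · refine S.mul_mem_envBasis S.cas_e ?_ ?_ hb
        · rintro (_ | j) P
          · simpa using e0 1 P
          · apply quarter
            rw [pow_succ', mul_assoc, ← mul_assoc, ← smul_mul_assoc, S.four_e_f, sub_mul,
              ← mul_assoc (aeval S.h _), aeval_mul_of_shift (S.h_mul_f_pow j), mul_assoc (S.f ^ j),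
              ← map_mul]
            exact sub_mem (f1 j P) (f0 _ _)
        · intro j P
          rw [← mul_assoc, ← pow_succ']
          exact e0 _ _
      · refine S.mul_mem_envBasis S.cas_f ?_ ?_ hb
        · intro j P
          rw [← mul_assoc, ← pow_succ']
          exact f0 _ _
        · rintro (_ | j) P
          · simpa using f0 1 P
          · apply quarter
            rw [pow_succ', mul_assoc, ← mul_assoc, ← smul_mul_assoc, S.four_f_e, sub_mul,
              ← mul_assoc (aeval S.h _), aeval_mul_of_shift (S.h_mul_e_pow j), mul_assoc (S.e ^ j),
              ← map_mul]
            exact sub_mem (e1 j P) (e0 _ _)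
      · refine S.mul_mem_envBasis S.cas_h ?_ ?_ hb
        · intro j P
          have := aeval_mul_of_shift (S.h_mul_f_pow j) (X : k[X])
          rw [aeval_X] at this
          rw [← mul_assoc, this, mul_assoc, ← map_mul]
          exact f0 _ _
        · intro j P
          have := aeval_mul_of_shift (S.h_mul_e_pow j) (X : k[X])
          rw [aeval_X] at this
          rw [← mul_assoc, this, mul_assoc, ← map_mul]
          exact e0 _ _
    | algebraMap r =>
      intro b hb
      rw [← Algebra.smul_def]
      exact Submodule.smul_mem _ _ hb
    | add a c _ _ ha hc => intro b hb; rw [add_mul]; exact add_mem (ha b hb) (hc b hb)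
    | mul a c _ _ ha hc => intro b hb; rw [mul_assoc]; exact ha _ (hc b hb)
  have h1 : (1 : A) ∈ S.envBasis := by simpa using S.f_mem_envBasis 1 0 1
  simpa using key 1 h1

/-- The span of the lowest weight vectors of the enveloping algebra. -/
def lowest : Submodule k A :=
  Submodule.span k {b | ∃ (Q : k[X]) (j : ℕ), b = aeval S.cas Q * S.f ^ j}

lemma natDegree_sub_comp_le (c : k) (r : ℕ) :
    ((X : k[X]) ^ (r + 1) - (X ^ (r + 1) : k[X]).comp (X + C c)).natDegree ≤ r ∧
    ((X : k[X]) ^ (r + 1) - (X ^ (r + 1) : k[X]).comp (X + C c)).coeff r = -((r + 1) * c) := by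
  have hc : ∀ i, ((X ^ (r + 1) : k[X]).comp (X + C c)).coeff i =
      c ^ (r + 1 - i) * ((r + 1).choose i : k) := fun i => by
    rw [X_pow_comp, coeff_X_add_C_pow]
  refine ⟨?_, ?_⟩
  · rw [natDegree_le_iff_coeff_eq_zero]
    intro N hN
    rw [coeff_sub, hc, coeff_X_pow]
    rcases Nat.lt_or_ge (r + 1) N with h | h
    · rw [if_neg (by omega), Nat.choose_eq_zero_of_lt h]; simp
    · obtain rfl : N = r + 1 := by omega
      simp
  · rw [coeff_sub, hc, coeff_X_pow, if_neg (by omega)]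
    simp
    ring

/-- The leading part of the polynomial governing `ad e` on `f ^ (j + 1) h ^ d`. -/
lemma natDegree_lowering (j d : ℕ) :
    ((X ^ 2 + (2 : k) • X) * (X ^ d : k[X]).comp (X + C 2) -
      (X ^ 2 - (2 : k) • X : k[X]).comp (X + C (-(2 * (j : k)))) * X ^ d).natDegree ≤ d + 1 ∧
    ((X ^ 2 + (2 : k) • X) * (X ^ d : k[X]).comp (X + C 2) -
      (X ^ 2 - (2 : k) • X : k[X]).comp (X + C (-(2 * (j : k)))) * X ^ d).coeff (d + 1) =
      4 + 4 * (j : k) + 2 * d := by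
  set W := (X : k[X]) ^ d - (X ^ d : k[X]).comp (X + C 2) with hW
  have e1 : (X ^ 2 + (2 : k) • X) * (X ^ d : k[X]).comp (X + C 2) -
      (X ^ 2 - (2 : k) • X : k[X]).comp (X + C (-(2 * (j : k)))) * X ^ d =
      (C (4 + 4 * (j : k)) * X - C (4 * (j : k) ^ 2 + 4 * j)) * X ^ d - (X ^ 2 + C 2 * X) * W := by
    rw [hW, smul_eq_C_mul]
    simp only [sub_comp, mul_comp, X_comp, C_comp, X_pow_comp, map_neg, map_mul, map_add,
      map_natCast, map_pow, map_ofNat, ofNat_comp]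
    ring
  have a1 : (C (4 + 4 * (j : k)) * X - C (4 * (j : k) ^ 2 + 4 * j)).natDegree ≤ 1 := by
      compute_degree
  have a2 : (C (4 + 4 * (j : k)) * X - C (4 * (j : k) ^ 2 + 4 * j)).coeff 1 = 4 + 4 * (j : k) := by
    rw [coeff_sub, coeff_C_mul, coeff_X_one, coeff_C_succ]; ring
  have b1 : (X ^ 2 + C 2 * X : k[X]).natDegree ≤ 2 := by compute_degree
  have b2 : (X ^ 2 + C 2 * X : k[X]).coeff 2 = 1 := by compute_degree!
  have c1 : ((X ^ 2 + C 2 * X) * W).natDegree ≤ d + 1 ∧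
      ((X ^ 2 + C 2 * X) * W).coeff (d + 1) = - (2 * (d : k)) := by
    rcases d with _ | d
    · simp [hW]
    · obtain ⟨h1, h2⟩ := natDegree_sub_comp_le (2 : k) d
      rw [show d + 1 + 1 = 2 + d by ring]
      refine ⟨natDegree_mul_le_of_le b1 h1, ?_⟩
      rw [coeff_mul_add_eq_of_natDegree_le b1 h1, h2, b2]; push_cast; ring
  rw [e1]
  refine ⟨(natDegree_sub_le _ _).trans (max_le ?_ c1.1), ?_⟩
  · rw [add_comm d]
    exact natDegree_mul_le_of_le a1 (natDegree_X_pow_le d)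
  · rw [coeff_sub, c1.2, add_comm d, coeff_mul_add_eq_of_natDegree_le a1 (natDegree_X_pow_le d), a2,
      coeff_X_pow_self]
    ring

/-- In a finite-dimensional simple module the cokernel of `e` is the lowest weight line, and the
vectors `Q(Δ) f ^ j` supply these lines. The proof removes all positive powers of `e` and of `h`
from the spanning products. -/
lemma env_le_lowest {u : A} (hu : u ∈ S.env) :
    u ∈ S.lowest ⊔ (Subalgebra.toSubmodule S.env).map (ad k S.e) := by
  set Y := S.lowest ⊔ (Subalgebra.toSubmodule S.env).map (ad k S.e) with hY
  have hcas : ∀ (Q : k[X]) (b : A), b ∈ Y → aeval S.cas Q * b ∈ Y := by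
    intro Q b hb
    obtain ⟨a, ha, _, ⟨w, hw, rfl⟩, rfl⟩ := Submodule.mem_sup.1 hb
    rw [mul_add]
    refine add_mem (Submodule.mem_sup_left ?_) (Submodule.mem_sup_right ?_)
    · refine (Submodule.span_le (p := S.lowest.comap (LinearMap.mulLeft k _))).2 ?_ ha
      rintro _ ⟨Q', j, rfl⟩
      refine Submodule.subset_span ⟨Q * Q', j, ?_⟩
      rw [map_mul (aeval S.cas), mul_assoc]; rfl
    · refine ⟨aeval S.cas Q * w, S.env.mul_mem (S.aeval_cas_mem_env Q) hw, ?_⟩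
      rw [ad_mul_of_comm (aeval_mul_comm S.cas_e Q).symm]
  have hP : ∀ P : k[X], aeval S.h P ∈ S.env := fun P =>
    Algebra.adjoin_le (Set.singleton_subset_iff.2 S.h_mem_env) (aeval_mem_adjoin_singleton k S.h)
  have had : ∀ w ∈ S.env, ad k S.e w ∈ Y := fun w hw => Submodule.mem_sup_right ⟨w, hw, rfl⟩
  have he : S.h * S.e = S.e * S.h + (2 : k) • S.e := S.he
  -- Commuting `e ^ j P(h)` with `e` gives `e ^ (j + 1)` times the difference `P(h) - P(h + 2)`, and
  -- the difference operator is onto in characteristic zero.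
  have ecase : ∀ j (P : k[X]), S.e ^ (j + 1) * aeval S.h P ∈ Y := by
    intro j P
    obtain ⟨G, -, hG⟩ := exists_lin_eq
      (S := fun r => (X : k[X]) ^ (r + 1) - (X ^ (r + 1) : k[X]).comp (X + C 2))
      (fun r => (natDegree_sub_comp_le 2 r).1)
      (fun r => by
        rw [(natDegree_sub_comp_le 2 r).2, neg_ne_zero]
        exact mul_ne_zero (by exact_mod_cast r.succ_ne_zero) two_ne_zero) _ P le_rfl
    have h1 : ∀ G : k[X], lin
        (fun r => (X : k[X]) ^ (r + 1) - (X ^ (r + 1) : k[X]).comp (X + C 2)) G =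
        X * G - (X * G).comp (X + C 2) := by
      intro G
      induction G using Polynomial.induction_on' with
      | add P Q hP hQ => rw [map_add, hP, hQ, mul_add, add_comp]; ring
      | monomial n r =>
        rw [lin_monomial, ← C_mul_X_pow_eq_monomial, smul_eq_C_mul]
        simp only [mul_comp, C_comp, X_comp, X_pow_comp]
        ring
    have h2 : S.e ^ (j + 1) * aeval S.h P = ad k S.e (S.e ^ j * aeval S.h (X * G)) := by
      rw [ad_apply, mul_assoc, aeval_mul_of_shift he, ← hG, h1, map_sub, mul_sub, ← mul_assoc,
        ← mul_assoc, ← pow_succ', ← pow_succ]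
    rw [h2]
    exact had _ (mul_mem (pow_mem S.e_mem_env _) (hP _))
  -- Four times `ad e (f ^ (j + 1) h ^ d)` is `f ^ j R(h)` plus `Δ` times a term of smaller degree
  -- in `h`. As `R` has degree `d + 1` with coefficient `4 + 4 j + 2 d`, it lowers the degree in `h`
  -- by one.
  have fcase : ∀ j d, ∀ P : k[X], P.natDegree ≤ d → S.f ^ j * aeval S.h P ∈ Y := by
    intro j d
    induction d with
    | zero =>
      intro P hd
      obtain ⟨c, rfl⟩ := natDegree_eq_zero.1 (Nat.le_zero.1 hd)
      rw [aeval_C, ← Algebra.commutes, ← Algebra.smul_def]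
      exact Submodule.smul_mem _ _ (Submodule.mem_sup_left (Submodule.subset_span
        ⟨1, j, by simp⟩))
    | succ d ih =>
      obtain ⟨r1, r2⟩ := natDegree_lowering (k := k) j d
      set R := (X ^ 2 + (2 : k) • X) * (X ^ d : k[X]).comp (X + C 2) -
        (X ^ 2 - (2 : k) • X : k[X]).comp (X + C (-(2 * (j : k)))) * X ^ d with hR
      have hr : (4 + 4 * j + 2 * d : k) ≠ 0 := by
        exact_mod_cast (by omega : 4 + 4 * j + 2 * d ≠ 0)
      have hRY : S.f ^ j * aeval S.h R ∈ Y := by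
        have h1 : S.f ^ j * aeval S.h R = (4 : k) • ad k S.e (S.f ^ (j + 1) *
            aeval S.h (X ^ d : k[X])) -
            aeval S.cas (X : k[X]) * (S.f ^ j *
              aeval S.h ((X : k[X]) ^ d - (X ^ d : k[X]).comp (X + C 2))) := by
          have h2 : (4 : k) • (S.e * (S.f ^ (j + 1) * aeval S.h (X ^ d : k[X]))) =
              S.cas * (S.f ^ j * aeval S.h (X ^ d : k[X])) - S.f ^ j * aeval S.h
                ((X ^ 2 - (2 : k) • X : k[X]).comp (X + C (-(2 * (j : k)))) * X ^ d) := by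
            rw [pow_succ', mul_assoc, ← mul_assoc, ← smul_mul_assoc, S.four_e_f, sub_mul,
              ← mul_assoc (aeval S.h _), aeval_mul_of_shift (S.h_mul_f_pow j), mul_assoc (S.f ^ j),
              ← map_mul]
          have h3 : (4 : k) • (S.f ^ (j + 1) * aeval S.h (X ^ d : k[X]) * S.e) =
              S.cas * (S.f ^ j * aeval S.h ((X ^ d : k[X]).comp (X + C 2))) - S.f ^ j * aeval S.h
                ((X ^ 2 + (2 : k) • X) * (X ^ d : k[X]).comp (X + C 2)) := by
            rw [pow_succ, mul_assoc, aeval_mul_of_shift he, ← mul_assoc, mul_assoc _ S.f,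
              ← smul_mul_assoc, ← mul_smul_comm, S.four_f_e, mul_sub, sub_mul, ← S.cas_f_pow,
              map_mul]
            simp only [mul_assoc]
          rw [ad_apply, smul_sub, h2, h3, hR, aeval_X, map_sub, map_sub]
          simp only [mul_sub]
          abel
        rw [h1]
        refine sub_mem (Submodule.smul_mem _ _ (had _ (mul_mem (pow_mem S.f_mem_env _) (hP _))))
          (hcas _ _ (ih _ ?_))
        rcases d with _ | d
        · simp
        · exact (natDegree_sub_comp_le (2 : k) d).1.trans d.le_succ
      intro P hd
      have h4 : P = (P - (P.coeff (d + 1) / (4 + 4 * j + 2 * d)) • R) +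
        (P.coeff (d + 1) / (4 + 4 * j + 2 * d)) • R := by abel
      rw [h4, map_add, mul_add, map_smul, mul_smul_comm]
      refine add_mem (ih _ ?_) (Submodule.smul_mem _ _ hRY)
      rw [natDegree_le_iff_coeff_eq_zero]
      intro N hN
      rw [coeff_sub, coeff_smul, smul_eq_mul]
      rcases Nat.lt_or_ge (d + 1) N with h | h
      · rw [coeff_eq_zero_of_natDegree_lt (lt_of_le_of_lt hd h),
          coeff_eq_zero_of_natDegree_lt (lt_of_le_of_lt r1 h), mul_zero, sub_zero]
      · obtain rfl : N = d + 1 := by omega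
        rw [r2, div_mul_cancel₀ _ hr, sub_self]
  have hle : S.envBasis ≤ Y := by
    refine Submodule.span_le.2 ?_
    rintro _ (⟨Q, j, P, rfl⟩ | ⟨Q, _ | j, P, rfl⟩)
    · exact hcas _ _ (fcase j _ P le_rfl)
    · exact hcas _ _ (by simpa using fcase 0 _ P le_rfl)
    · exact hcas _ _ (ecase j P)
  exact hle (S.env_le_envBasis hu)

end System

/-! ### Reduction of the filtration by multiplication by the quadratic element. -/

lemma mul_ad_ad {k A : Type*} [Field k] [Ring A] [Algebra k A] (g u w : A) :
    u * ad k g (ad k g w) = ad k g (ad k g (u * w)) - (2 : k) • ad k g (ad k g u * w)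
      + ad k g (ad k g u) * w := by
  simp only [ad_mul, map_add]; module

lemma mul_ad {k A : Type*} [Field k] [Ring A] [Algebra k A] (g u w : A) :
    u * ad k g w = ad k g (u * w) - ad k g u * w := by
  rw [ad_mul]; abel

lemma mem_of_smul_mem {k A : Type*} [Field k] [AddCommGroup A] [Module k A] {N : Submodule k A}
    {c : k} (hc : c ≠ 0) {a : A} (h : c • a ∈ N) : a ∈ N := by
  have := Submodule.smul_mem _ c⁻¹ h
  rwa [smul_smul, inv_mul_cancel₀ hc, one_smul] at this

/-- The coefficient in the reduction of the quadratic element times a lowest weight vector. -/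
noncomputable def stepCoeff (k : Type*) [Field k] (d : ℕ) : k :=
  2 * ((d + 1 : k) * (d + 2))⁻¹ + 2 * (d + 2 : k)⁻¹ + 1

lemma stepCoeff_ne_zero {k : Type*} [Field k] [CharZero k] (d : ℕ) : stepCoeff k d ≠ 0 := by
  have h1 : (d + 1 : k) ≠ 0 := by exact_mod_cast (by omega : d + 1 ≠ 0)
  have h2 : (d + 2 : k) ≠ 0 := by exact_mod_cast (by omega : d + 2 ≠ 0)
  have h3 : ((2 + 2 * (d + 1) + (d + 1) * (d + 2) : ℕ) : k) ≠ 0 :=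
    Nat.cast_ne_zero.2 (by positivity)
  have h4 : stepCoeff k d =
      ((2 + 2 * (d + 1) + (d + 1) * (d + 2) : ℕ) : k) * ((d + 1 : k) * (d + 2))⁻¹ := by
    rw [stepCoeff]; field_simp; push_cast; ring
  rw [h4]
  exact mul_ne_zero h3 (inv_ne_zero (mul_ne_zero h1 h2))

/-- The coefficient in the reduction of the quadratic element times a vector of weight `-1`. -/
noncomputable def weightStepCoeff (k : Type*) [Field k] (l : ℕ) : k :=
  ((((2 * l + 1 : ℕ) : k) + 1) * (((2 * l + 1 : ℕ) : k) + 2))⁻¹ * (2 * (l + 2 : k)⁻¹ - 2) +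
    (((2 * l + 1 : ℕ) : k) + 2)⁻¹ * ((l + 2 : k)⁻¹ - 2) - 1

/-- Since the inverse of `l + 2` is at most one half, all three summands are negative as rational
numbers; the closed formula below exhibits the sign. -/
lemma weightStepCoeff_ne_zero {k : Type*} [Field k] [CharZero k] (l : ℕ) :
    weightStepCoeff k l ≠ 0 := by
  have h1 : (l + 2 : k) ≠ 0 := by exact_mod_cast (by omega : l + 2 ≠ 0)
  have h2 : (2 * l + 3 : k) ≠ 0 := by exact_mod_cast (by omega : 2 * l + 3 ≠ 0)
  have h3 : (l + 1 : k) ≠ 0 := by exact_mod_cast (by omega : l + 1 ≠ 0)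
  have h4 : ((1 + (2 * l + 3) + (l + 2) * (2 * l + 3) : ℕ) : k) ≠ 0 :=
    Nat.cast_ne_zero.2 (by positivity)
  have h5 : weightStepCoeff k l = -(((1 + (2 * l + 3) + (l + 2) * (2 * l + 3) : ℕ) : k) *
      ((l + 2 : k) * (2 * l + 3))⁻¹) := by
    rw [weightStepCoeff]
    push_cast
    rw [show (2 * l + 1 + 1 : k) = 2 * (l + 1) by ring,
      show (2 * l + 1 + 2 : k) = 2 * l + 3 by ring]
    field_simp
    ring
  rw [h5]
  exact neg_ne_zero.2 (mul_ne_zero h4 (inv_ne_zero (mul_ne_zero h1 h2)))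

namespace System

variable {k : Type*} [Field k] {p : k[X]} {A : Type*} [Ring A] [Algebra k A] (S : System p A)

lemma ad_e_x_pow (d : ℕ) : ad k S.e (S.x ^ d) = 0 := by
  induction d with
  | zero => simp [ad_apply]
  | succ d ih => rw [pow_succ, ad_mul, ih, ad_e_x]; simp

lemma ad_e_mul_x_pow (u : A) (d : ℕ) : ad k S.e (u * S.x ^ d) = ad k S.e u * S.x ^ d := by
  rw [ad_mul, ad_e_x_pow, mul_zero, add_zero]

lemma ad_h_x_pow (d : ℕ) : ad k S.h (S.x ^ d) = (d : k) • S.x ^ d := by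
  induction d with
  | zero => simp [ad_apply]
  | succ d ih =>
    rw [pow_succ, ad_mul, ih, ad_h_x]
    push_cast
    simp only [smul_mul_assoc, mul_smul_comm]
    module

lemma ad_h_f_pow_mul_x_pow (j d : ℕ) :
    ad k S.h (S.f ^ j * S.x ^ d) = (d - 2 * j : k) • (S.f ^ j * S.x ^ d) := by
  have h1 : ad k S.h (S.f ^ j) = (-(2 * j) : k) • S.f ^ j := by
    rw [ad_apply, S.h_mul_f_pow]; abel
  rw [ad_mul, h1, ad_h_x_pow, smul_mul_assoc, mul_smul_comm]
  module

lemma ad_f_f_pow_mul (j : ℕ) (a : A) : ad k S.f (S.f ^ j * a) = S.f ^ j * ad k S.f a :=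
  ad_mul_of_comm (pow_mul_comm' S.f j).symm a

lemma ad_f_f_pow_mul_e (j : ℕ) : ad k S.f (S.f ^ j * S.e) = - (S.f ^ j * S.h) := by
  rw [ad_f_f_pow_mul, ad_f_e, mul_neg]

lemma ad_f_f_pow_mul_h (j : ℕ) : ad k S.f (S.f ^ j * S.h) = (2 : k) • S.f ^ (j + 1) := by
  rw [ad_f_f_pow_mul, ad_f_h, mul_smul_comm, pow_succ]

lemma ad_e_f_pow (j : ℕ) : ad k S.e (S.f ^ (j + 1)) =
    (j + 1 : k) • (S.f ^ j * S.h) - (j * (j + 1) : k) • S.f ^ j := by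
  induction j with
  | zero => simp [ad_e_f]
  | succ j ih =>
    rw [pow_succ', ad_mul, ih, ad_e_f, S.h_mul_f_pow, mul_sub, mul_smul_comm, mul_smul_comm,
      ← mul_assoc, ← pow_succ', pow_succ']
    push_cast
    module

section Steps

lemma mul_x_pow_mem {n : ℕ} {a : A} (ha : a ∈ S.filt n) (d : ℕ) : a * S.x ^ d ∈ S.filt (n + d) := by
  induction d with
  | zero => simpa
  | succ d ih => rw [pow_succ, ← mul_assoc]; exact S.mul_x_mem ih

lemma mul_y_mul_x_pow {n : ℕ} {a : A} (ha : a ∈ S.filt n) (d : ℕ) :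
    a * S.y * S.x ^ d - a * S.x ^ d * S.y ∈ S.filt (n + d) := by
  induction d with
  | zero => simp
  | succ d ih =>
    have h1 : a * S.y * S.x ^ (d + 1) - a * S.x ^ (d + 1) * S.y =
        (a * S.y * S.x ^ d - a * S.x ^ d * S.y) * S.x - a * S.x ^ d * S.z := by
      have : a * S.x ^ d * S.y * S.x = a * S.x ^ d * S.x * S.y - a * S.x ^ d * S.z := by
        rw [mul_assoc, S.order.1.2.2.2.2.2.2.2.2.2, mul_sub, ← mul_assoc]
      rw [sub_mul, this, pow_succ]
      simp only [← mul_assoc]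
      abel
    rw [h1]
    exact sub_mem (S.mul_x_mem ih)
      (S.filt_le_succ _ (S.mul_env_mem S.z_mem_env (S.mul_x_pow_mem ha d)))

variable [CharZero k]

lemma x_pow_mul_y_sq (d : ℕ) : ∃ r ∈ S.filt (d + 1), S.x ^ d * S.y * S.y =
    ((d + 1 : k) * (d + 2))⁻¹ • ad k S.f (ad k S.f (S.x ^ (d + 2))) + r := by
  obtain ⟨r, hr, h⟩ := S.x_pow_mul_y d
  obtain ⟨r', hr', h'⟩ := S.x_pow_mul_y (d + 1)
  refine ⟨((d + 1 : ℕ) : k)⁻¹ • ad k S.f r' + r * S.y, add_mem (Submodule.smul_mem _ _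
    (S.ad_env_mem S.f_mem_env hr')) (S.mul_y_mem hr), ?_⟩
  have h2 : ad k S.f (S.x ^ (d + 1)) * S.y = ad k S.f (S.x ^ (d + 1) * S.y) := by
    rw [ad_mul, ad_f_y, mul_zero, add_zero]
  rw [h, add_mul, smul_mul_assoc, h2, h', map_add, map_smul, smul_add, smul_smul, mul_inv,
    add_assoc]
  push_cast
  norm_num [add_assoc]

/-- Up to lower degree only `e y² + h x y - f x²` matters. Writing `x ^ d y²` and `x ^ (d + 1) y` as
multiples of `ad f` images of `x ^ (d + 2)` prepares an integration by parts, which moves `ad f`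
onto the factors `f ^ j e` and `f ^ j h`. -/
lemma quad_mul (q : k[X]) (j d : ℕ) : ∃ r ∈ S.filt (d + 2), S.quad q * (S.f ^ j * S.x ^ d) =
    ((d + 1 : k) * (d + 2))⁻¹ • (S.f ^ j * S.e * ad k S.f (ad k S.f (S.x ^ (d + 2)))) +
    (d + 2 : k)⁻¹ • (S.f ^ j * S.h * ad k S.f (S.x ^ (d + 2))) - S.f ^ (j + 1) * S.x ^ (d + 2)
      + r := by
  have hf : S.quad q * S.f ^ j = S.f ^ j * S.quad q := by
    have h : S.quad q * S.f = S.f * S.quad q := (sub_eq_zero.1 (S.ad_f_quad q)).symm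
    exact (Commute.pow_right (a := S.quad q) (b := S.f) h j).eq
  obtain ⟨r1, hr1, h1⟩ := S.x_pow_mul_y_sq d
  obtain ⟨r2, hr2, h2⟩ := S.x_pow_mul_y (d + 1)
  have he : S.e * S.y ∈ S.filt 2 := S.mul_y_mem (S.env_le_filt 0 S.e_mem_env)
  have he' : S.e ∈ S.filt 1 := S.env_le_filt 0 S.e_mem_env
  have hh : S.h * S.x ∈ S.filt 2 := S.mul_x_mem (S.env_le_filt 0 S.h_mem_env)
  have m1 := S.mul_y_mul_x_pow he d
  have m2 := S.mul_y_mem (S.mul_y_mul_x_pow he' d)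
  have m3 := S.mul_y_mul_x_pow hh d
  have m4 : (1 / 2 : k) • (S.h * S.z * S.x ^ d) + aeval S.cas q * S.x ^ d ∈ S.filt (d + 2) := by
    refine S.filt_mono (show 1 + d ≤ d + 2 by omega) (add_mem (Submodule.smul_mem _ _ ?_) ?_)
    · exact S.mul_x_pow_mem (S.env_le_filt 0 (mul_mem S.h_mem_env S.z_mem_env)) d
    · exact S.mul_x_pow_mem (S.env_le_filt 0 (S.aeval_cas_mem_env q)) d
  have m5 : S.e * r1 + S.h * r2 ∈ S.filt (d + 2) :=
    add_mem (S.filt_le_succ _ (S.env_mul_mem S.e_mem_env _ hr1))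
      (S.filt_le_succ _ (S.env_mul_mem S.h_mem_env _ hr2))
  rw [add_comm 2 d] at m1 m3
  rw [show 1 + d + 1 = d + 2 by omega] at m2
  refine ⟨_, S.env_mul_mem (pow_mem S.f_mem_env j) _
    (add_mem (sub_mem (add_mem (add_mem m1 m2) m3) m4) m5), ?_⟩
  have h3 : S.quad q * S.x ^ d = S.e * (S.x ^ d * S.y * S.y) + S.h * (S.x ^ (d + 1) * S.y)
      - S.f * S.x ^ (d + 2) + (S.e * S.y * S.y * S.x ^ d - S.e * S.y * S.x ^ d * S.y +
        (S.e * S.y * S.x ^ d - S.e * S.x ^ d * S.y) * S.y +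
        (S.h * S.x * S.y * S.x ^ d - S.h * S.x * S.x ^ d * S.y) -
        ((1 / 2 : k) • (S.h * S.z * S.x ^ d) + aeval S.cas q * S.x ^ d)) := by
    rw [quad, pow_succ' S.x d, show d + 2 = 2 + d by ring, pow_add S.x 2 d]
    simp only [sub_mul, add_mul, smul_mul_assoc, pow_two, mul_assoc]
    abel
  rw [← mul_assoc, hf, mul_assoc, h3, h1, h2]
  push_cast
  have h4 : (d + 1 + 1 : k) = d + 2 := by ring
  rw [h4]
  simp only [mul_add, mul_sub, mul_smul_comm, pow_succ S.f j, mul_assoc]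
  abel

end Steps

section Spanning

variable [CharZero k] {q : k[X]} {N : Submodule k A}
  (ht : ∀ a ∈ N, S.quad q * a ∈ N) (hQ : ∀ (Q : k[X]), ∀ a ∈ N, aeval S.cas Q * a ∈ N)
include ht hQ

/-- By induction on the degree only `f ^ j x ^ d` needs attention: integration by parts along `f`
reduces a layer to `U(sl₂) x ^ d`, and `env_le_lowest` reduces that to products of `Q(Δ)` with
lowest weight vectors. -/
lemma filt_le_of_ad_mem (he : ∀ a, ad k S.e a ∈ N) (hf : ∀ a, ad k S.f a ∈ N)
    (hh : ∀ a, ad k S.h a ∈ N) (h1 : 1 ∈ N) (d : ℕ) : S.filt d ≤ N := by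
  induction d with
  | zero => exact bot_le
  | succ d ih =>
    have key : ∀ j, S.f ^ j * S.x ^ d ∈ N := by
      intro j
      -- The weight is `d - 2 j`; if it is nonzero the element is a multiple of its own image under
      -- `ad h`. In weight zero it is, up to `N` and lower degree, a nonzero multiple of `t f ^ (j -
      -- 1) x ^ (d - 2)`.
      by_cases hd : d = 2 * j
      · rcases j with _ | j
        · simpa [hd]
        · obtain ⟨r, hr, h⟩ := S.quad_mul q j (2 * j)
          have hm := ht _ (ih (S.filt_mono (show 2 * j + 1 ≤ d by omega)
            (S.env_mul_mem (pow_mem S.f_mem_env j) _ (S.x_pow_mem (2 * j)))))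
          rw [show 2 * j + 2 = d by omega] at h hr
          rw [h, mul_ad_ad, mul_ad, ad_f_f_pow_mul_e, ad_f_f_pow_mul_h, map_neg,
            ad_f_f_pow_mul_h] at hm
          have h2 := ih hr
          refine mem_of_smul_mem (stepCoeff_ne_zero (2 * j)) ?_
          have h3 := sub_mem (add_mem (add_mem (Submodule.smul_mem _
            ((((2 * j : ℕ) : k) + 1) * (((2 * j : ℕ) : k) + 2))⁻¹ (sub_mem (hf (ad k S.f
              (S.f ^ j * S.e * S.x ^ d))) (Submodule.smul_mem _ (2 : k)
              (hf (-(S.f ^ j * S.h) * S.x ^ d))))) (Submodule.smul_mem _ (((2 * j : ℕ) : k) + 2)⁻¹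
            (hf (S.f ^ j * S.h * S.x ^ d)))) h2) hm
          convert h3 using 1
          simp only [stepCoeff, neg_mul, smul_mul_assoc, map_neg]
          module
      · have h2 := hh (S.f ^ j * S.x ^ d)
        rw [ad_h_f_pow_mul_x_pow] at h2
        refine mem_of_smul_mem ?_ h2
        rw [sub_ne_zero]
        exact_mod_cast hd
    refine (S.filt_succ_le_hw d).trans (sup_le (S.hw_le ?_) ih)
    intro u hu b
    induction b generalizing u with
    | zero =>
      rw [pow_zero, Module.End.one_apply]
      obtain ⟨a, ha, _, ⟨w, hw, rfl⟩, rfl⟩ := Submodule.mem_sup.1 (S.env_le_lowest hu)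
      rw [add_mul, ← ad_e_mul_x_pow]
      refine add_mem ?_ (he _)
      refine (Submodule.span_le (p := N.comap (LinearMap.mulRight k (S.x ^ d)))).2 ?_ ha
      rintro _ ⟨Q, j, rfl⟩
      change aeval S.cas Q * S.f ^ j * S.x ^ d ∈ N
      rw [mul_assoc]
      exact hQ Q _ (key j)
    | succ b ihb =>
      rw [pow_succ', Module.End.mul_apply, mul_ad]
      exact sub_mem (hf _) (ihb _ (S.env.sub_mem (S.env.mul_mem S.f_mem_env hu)
        (S.env.mul_mem hu S.f_mem_env)))

/-- The quotient by the images of `ad e`, `ad h + 1` and `(ad f)²` retains only the lowest weight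
vectors of the copies of `V`. The claim is that over `k[t, Δ]` these are generated by `y` and `f x`.
The argument follows the weight zero case, but single images of `ad f` no longer vanish and have to
be carried along. -/
lemma filt_le_of_weight_neg_one (he : ∀ a, ad k S.e a ∈ N) (hf : ∀ a, ad k S.f (ad k S.f a) ∈ N)
    (hh : ∀ a, ad k S.h a + a ∈ N) (hy : S.y ∈ N) (hfx : S.f * S.x ∈ N) (d : ℕ) :
    S.filt d ≤ N := by
  -- As operators `f e = e f - (h + 1) + 1`, so this composite is the identity modulo `N`.
  have hfe : ∀ a, a ∈ N → ad k S.f (ad k S.e a) ∈ N := fun a ha => by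
    have h1 := LinearMap.congr_fun S.opTriple.ef a
    simp only [Module.End.mul_apply, LinearMap.add_apply] at h1
    have h2 : ad k S.f (ad k S.e a) = ad k S.e (ad k S.f a) - (ad k S.h a + a) + a := by
      rw [h1]; abel
    rw [h2]
    exact add_mem (sub_mem (he _) (hh _)) ha
  induction d with
  | zero => exact bot_le
  | succ d ih =>
    -- The weight is `d - 2 j - 2`, which equals `-1` exactly when `d = 2 j + 1`; there `ad f` is
    -- applied to the reduction by `t`, and the square of `ad f` kills the parts that are images of
    -- `ad f`.
    have key1 : ∀ j, ad k S.f (S.f ^ j * S.x ^ d) ∈ N := by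
      intro j
      by_cases hd : d = 2 * j + 1
      · rcases j with _ | j
        · simpa [hd, ad_f_x]
        · obtain ⟨r, hr, h⟩ := S.quad_mul q j (2 * j + 1)
          have hm := ht _ (ih (S.filt_mono (show 2 * j + 2 ≤ d by omega) (S.ad_env_mem S.f_mem_env
            (S.env_mul_mem (pow_mem S.f_mem_env j) _ (S.x_pow_mem (2 * j + 1))))))
          have hc : S.f * S.quad q = S.quad q * S.f := sub_eq_zero.1 (S.ad_f_quad q)
          rw [← ad_mul_of_comm hc, h] at hm
          rw [show 2 * j + 1 + 2 = d by omega] at hm hr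
          rw [mul_ad_ad, mul_ad, ad_f_f_pow_mul_e, ad_f_f_pow_mul_h, map_neg,
            ad_f_f_pow_mul_h] at hm
          have h2 := ih (S.ad_env_mem S.f_mem_env hr)
          refine mem_of_smul_mem (stepCoeff_ne_zero (2 * j + 1)) ?_
          have h3 := sub_mem (add_mem (add_mem (Submodule.smul_mem _
            ((((2 * j + 1 : ℕ) : k) + 1) * (((2 * j + 1 : ℕ) : k) + 2))⁻¹ (sub_mem (hf (ad k S.f
              (S.f ^ j * S.e * S.x ^ d))) (Submodule.smul_mem _ (2 : k)
              (hf (-(S.f ^ j * S.h) * S.x ^ d))))) (Submodule.smul_mem _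
                (((2 * j + 1 : ℕ) : k) + 2)⁻¹ (hf (S.f ^ j * S.h * S.x ^ d)))) h2) hm
          convert h3 using 1
          simp only [stepCoeff, neg_mul, smul_mul_assoc, map_neg, map_add, map_sub, map_smul]
          module
      · have h2 := hh (ad k S.f (S.f ^ j * S.x ^ d))
        have h3 := LinearMap.congr_fun S.opTriple.hf (S.f ^ j * S.x ^ d)
        simp only [Module.End.mul_apply, LinearMap.sub_apply, LinearMap.smul_apply,
          ad_h_f_pow_mul_x_pow, map_smul] at h3
        rw [h3] at h2
        refine mem_of_smul_mem (c := (d - (2 * j + 1) : k)) ?_ ?_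
        · rw [sub_ne_zero]
          exact_mod_cast hd
        · convert h2 using 1
          module
    -- The weight `d - 2 j` equals `-1` exactly when `d + 1 = 2 j`. The base case `d = j = 1` is the
    -- generator `f x`.
    have key2 : ∀ j, S.f ^ j * S.x ^ d ∈ N := by
      intro j
      by_cases hd : d + 1 = 2 * j
      · obtain ⟨i, rfl⟩ : ∃ i, j = i + 1 := ⟨j - 1, by omega⟩
        rcases i with _ | l
        · obtain rfl : d = 1 := by omega
          simpa using hfx
        · obtain ⟨r, hr, h⟩ := S.quad_mul q (l + 1) (2 * l + 1)
          have hm := ht _ (ih (S.filt_mono (show 2 * l + 2 ≤ d by omega)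
            (S.env_mul_mem (pow_mem S.f_mem_env (l + 1)) _ (S.x_pow_mem (2 * l + 1)))))
          rw [show 2 * l + 1 + 2 = d by omega] at h hr
          rw [h, mul_ad_ad, mul_ad, ad_f_f_pow_mul_e, ad_f_f_pow_mul_h, map_neg,
            ad_f_f_pow_mul_h] at hm
          have h2 := ih hr
          have hl : (l + 2 : k) ≠ 0 := by exact_mod_cast (by omega : l + 2 ≠ 0)
          -- The leftover image of `ad f` is evaluated by writing `f ^ (l + 1) h x ^ d` as an image
          -- of `ad e` plus a multiple of `f ^ (l + 1) x ^ d`, and then commuting `ad f` past `ad e`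
          -- in weight `-1`.
          have hE : ad k S.f (S.f ^ (l + 1) * S.h * S.x ^ d) -
              (l + 2 : k)⁻¹ • (S.f ^ (l + 2) * S.x ^ d) ∈ N := by
            have h3 := LinearMap.congr_fun S.opTriple.ef (S.f ^ (l + 2) * S.x ^ d)
            simp only [Module.End.mul_apply, LinearMap.add_apply] at h3
            have h4 : S.f ^ (l + 1) * S.h * S.x ^ d = (l + 2 : k)⁻¹ •
                ad k S.e (S.f ^ (l + 2) * S.x ^ d) + (l + 1 : k) • (S.f ^ (l + 1) * S.x ^ d) := by
              rw [ad_e_mul_x_pow, show l + 2 = l + 1 + 1 from rfl, ad_e_f_pow, sub_mul,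
                smul_mul_assoc, smul_mul_assoc, smul_sub, smul_smul, smul_smul]
              push_cast
              rw [show (l + 1 + 1 : k) = l + 2 by ring, inv_mul_cancel₀ hl,
                show (l + 2 : k)⁻¹ * ((l + 1) * (l + 2)) = l + 1 by field_simp]
              module
            have h5 := Submodule.smul_mem _ (l + 2 : k)⁻¹ (sub_mem
              (he (ad k S.f (S.f ^ (l + 2) * S.x ^ d))) (hh (S.f ^ (l + 2) * S.x ^ d)))
            convert add_mem h5 (Submodule.smul_mem _ (l + 1 : k) (key1 (l + 1))) using 1
            rw [h4, h3, map_add, map_smul, map_smul]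
            module
          refine mem_of_smul_mem (weightStepCoeff_ne_zero l) ?_
          have h3 := sub_mem (sub_mem (sub_mem hm h2) (Submodule.smul_mem _
            ((((2 * l + 1 : ℕ) : k) + 1) * (((2 * l + 1 : ℕ) : k) + 2))⁻¹
              (hf (S.f ^ (l + 1) * S.e * S.x ^ d)))) (Submodule.smul_mem _
            (2 * ((((2 * l + 1 : ℕ) : k) + 1) * (((2 * l + 1 : ℕ) : k) + 2))⁻¹ +
              (((2 * l + 1 : ℕ) : k) + 2)⁻¹) hE)
          convert h3 using 1
          simp only [weightStepCoeff, neg_mul, smul_mul_assoc, map_neg]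
          module
      · have h2 := hh (S.f ^ j * S.x ^ d)
        rw [ad_h_f_pow_mul_x_pow] at h2
        refine mem_of_smul_mem (c := (d + 1 - 2 * j : k)) ?_ ?_
        · rw [sub_ne_zero]
          exact_mod_cast hd
        · convert h2 using 1
          module
    refine (S.filt_succ_le_hw d).trans (sup_le (S.hw_le ?_) ih)
    have allmem : ∀ u ∈ S.env, u * S.x ^ d ∈ N := by
      intro u hu
      obtain ⟨a, ha, _, ⟨w, hw, rfl⟩, rfl⟩ := Submodule.mem_sup.1 (S.env_le_lowest hu)
      rw [add_mul, ← ad_e_mul_x_pow]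
      refine add_mem ?_ (he _)
      refine (Submodule.span_le (p := N.comap (LinearMap.mulRight k (S.x ^ d)))).2 ?_ ha
      rintro _ ⟨Q, j, rfl⟩
      change aeval S.cas Q * S.f ^ j * S.x ^ d ∈ N
      rw [mul_assoc]
      exact hQ Q _ (key2 j)
    -- Integration by parts produces an outer `ad f`, so membership of the element and of its image
    -- under `ad f` must be proved together.
    have main : ∀ b, ∀ u ∈ S.env, u * (ad k S.f ^ b) (S.x ^ d) ∈ N ∧
        ad k S.f (u * (ad k S.f ^ b) (S.x ^ d)) ∈ N := by
      intro b
      induction b with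
      | zero =>
        intro u hu
        rw [pow_zero, Module.End.one_apply]
        obtain ⟨a, ha, _, ⟨w, hw, rfl⟩, rfl⟩ := Submodule.mem_sup.1 (S.env_le_lowest hu)
        have hlow : ad k S.f (a * S.x ^ d) ∈ N := by
          refine (Submodule.span_le
            (p := N.comap (ad k S.f * LinearMap.mulRight k (S.x ^ d)))).2 ?_ ha
          rintro _ ⟨Q, j, rfl⟩
          change ad k S.f (aeval S.cas Q * S.f ^ j * S.x ^ d) ∈ N
          rw [mul_assoc, ad_mul_of_comm (aeval_mul_comm S.cas_f Q).symm]
          exact hQ Q _ (key1 j)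
        refine ⟨allmem _ hu, ?_⟩
        rw [add_mul, map_add, ← ad_e_mul_x_pow]
        exact add_mem hlow (hfe _ (allmem w hw))
      | succ b ihb =>
        intro u hu
        have hu' : ad k S.f u ∈ S.env := S.env.sub_mem (S.env.mul_mem S.f_mem_env hu)
          (S.env.mul_mem hu S.f_mem_env)
        rw [pow_succ', Module.End.mul_apply, mul_ad, map_sub]
        exact ⟨sub_mem (ihb u hu).2 (ihb _ hu').1, sub_mem (hf _) (ihb _ hu').2⟩
    exact fun u hu b => (main b u hu).1

end Spanning
end System

/-! ### The space of commutators. -/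

namespace System

variable {k : Type*} [Field k] {p : k[X]} {A : Type*} [Ring A] [Algebra k A] (S : System p A)

lemma mul_mem_adImage {c : A} (he : S.e * c = c * S.e) (hf : S.f * c = c * S.f)
    (hh : S.h * c = c * S.h) {a : A} (ha : a ∈ S.adImage) : c * a ∈ S.adImage := by
  have h : S.adImage ≤ S.adImage.comap (LinearMap.mulLeft k c) := by
    refine sup_le (sup_le ?_ ?_) ?_ <;> rintro _ ⟨b, rfl⟩ <;> rw [Submodule.mem_comap] <;>
      rw [LinearMap.mulLeft_apply]
    · rw [← ad_mul_of_comm he]; exact S.ad_e_mem _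
    · rw [← ad_mul_of_comm hf]; exact S.ad_f_mem _
    · rw [← ad_mul_of_comm hh]; exact S.ad_h_mem _
  exact h ha

lemma aeval_cas_mul_mem_adImage (P : k[X]) {a : A} (ha : a ∈ S.adImage) :
    aeval S.cas P * a ∈ S.adImage :=
  S.mul_mem_adImage (aeval_mul_comm S.cas_e P).symm (aeval_mul_comm S.cas_f P).symm
    (aeval_mul_comm S.cas_h P).symm ha

/-- The span of the products of powers of the quadratic element and of the Casimir element. -/
def inv (q : k[X]) : Submodule k A :=
  Submodule.span k (Set.range fun r : ℕ × k[X] => S.quad q ^ r.1 * aeval S.cas r.2)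

lemma mem_inv (q : k[X]) (i : ℕ) (P : k[X]) : S.quad q ^ i * aeval S.cas P ∈ S.inv q :=
  Submodule.subset_span ⟨(i, P), rfl⟩

/-- The span of the relations between the elements of `inv` in the commutator quotient. -/
def rels (q : k[X]) : Submodule k A :=
  Submodule.span k (Set.range fun r : ℕ × ℕ => S.quad q ^ r.1 * S.rel (X ^ r.2))

/-- The span of all commutators. -/
def brackets (k A : Type*) [Field k] [Ring A] [Algebra k A] : Submodule k A :=
  Submodule.span k {c : A | ∃ a b : A, c = a * b - b * a}

lemma ad_mem_brackets (a b : A) : ad k a b ∈ brackets k A := Submodule.subset_span ⟨a, b, rfl⟩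

lemma adImage_le_brackets : S.adImage ≤ brackets k A := by
  refine sup_le (sup_le ?_ ?_) ?_ <;> rintro _ ⟨b, rfl⟩ <;> exact ad_mem_brackets _ _

lemma mul_mem_brackets {c : A} (hc : ∀ b, b * c = c * b) {a : A} (ha : a ∈ brackets k A) :
    c * a ∈ brackets k A := by
  have h : brackets k A ≤ (brackets k A).comap (LinearMap.mulLeft k c) := by
    refine Submodule.span_le.2 ?_
    rintro _ ⟨a, b, rfl⟩
    refine Submodule.subset_span ⟨c * a, b, ?_⟩
    rw [LinearMap.mulLeft_apply, mul_sub, ← mul_assoc, ← mul_assoc, ← mul_assoc, hc b]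
  exact h ha

lemma rel_add (P Q : k[X]) : S.rel (P + Q) = S.rel P + S.rel Q := by
  simp only [rel, map_add, add_mul, mul_add]; abel

lemma rel_smul (r : k) (P : k[X]) : S.rel (r • P) = r • S.rel P := by
  simp only [rel, map_smul, smul_mul_assoc, mul_smul_comm]; module

section

variable [CharZero k] {q : k[X]} (hq : Balanced p q) (hg : S.Generates)
include hq hg

lemma quad_mul_mem_adImage {a : A} (ha : a ∈ S.adImage) : S.quad q * a ∈ S.adImage :=
  S.mul_mem_adImage (S.quad_comm hq hg _) (S.quad_comm hq hg _) (S.quad_comm hq hg _) ha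

lemma quad_pow_comm (i : ℕ) (b : A) : b * S.quad q ^ i = S.quad q ^ i * b :=
  (Commute.pow_right (a := b) (S.quad_comm hq hg b) i).eq

theorem inv_sup_adImage : S.inv q ⊔ S.adImage = ⊤ := by
  rw [eq_top_iff]
  rintro a -
  obtain ⟨n, hn⟩ := S.exists_mem_filt hg a
  refine S.filt_le_of_ad_mem (q := q) ?_ ?_ (fun a => Submodule.mem_sup_right (S.ad_e_mem a))
    (fun a => Submodule.mem_sup_right (S.ad_f_mem a))
    (fun a => Submodule.mem_sup_right (S.ad_h_mem a)) (Submodule.mem_sup_left ?_) n hn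
  · intro a ha
    have h : S.inv q ⊔ S.adImage ≤
        (S.inv q ⊔ S.adImage).comap (LinearMap.mulLeft k (S.quad q)) := by
      refine sup_le (Submodule.span_le.2 ?_)
        fun a ha => Submodule.mem_sup_right (S.quad_mul_mem_adImage hq hg ha)
      rintro _ ⟨⟨i, P⟩, rfl⟩
      refine Submodule.mem_sup_left ?_
      rw [LinearMap.mulLeft_apply, ← mul_assoc, ← pow_succ']
      exact S.mem_inv q _ _
    exact h ha
  · intro Q a ha
    have h : S.inv q ⊔ S.adImage ≤
        (S.inv q ⊔ S.adImage).comap (LinearMap.mulLeft k (aeval S.cas Q)) := by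
      refine sup_le (Submodule.span_le.2 ?_)
        fun a ha => Submodule.mem_sup_right (S.aeval_cas_mul_mem_adImage Q ha)
      rintro _ ⟨⟨i, P⟩, rfl⟩
      refine Submodule.mem_sup_left ?_
      rw [LinearMap.mulLeft_apply, ← mul_assoc, S.quad_pow_comm hq hg, mul_assoc, ← map_mul]
      exact S.mem_inv q _ _
    exact h ha
  · simpa using S.mem_inv q 0 1

lemma quad_mul_mem_rels {a : A} (ha : a ∈ S.adImage ⊔ S.rels q) (i : ℕ) :
    S.quad q ^ i * a ∈ S.adImage ⊔ S.rels q := by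
  have h : S.adImage ⊔ S.rels q ≤
      (S.adImage ⊔ S.rels q).comap (LinearMap.mulLeft k (S.quad q ^ i)) := by
    refine sup_le (fun a ha => Submodule.mem_sup_left (S.mul_mem_adImage
      (S.quad_pow_comm hq hg i _) (S.quad_pow_comm hq hg i _) (S.quad_pow_comm hq hg i _) ha))
      (Submodule.span_le.2 ?_)
    rintro _ ⟨⟨j, n⟩, rfl⟩
    refine Submodule.mem_sup_right ?_
    rw [LinearMap.mulLeft_apply, ← mul_assoc, ← pow_add]
    exact Submodule.subset_span ⟨(i + j, n), rfl⟩
  exact h ha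

omit hq hg [CharZero k] in
lemma rel_mem_rels (P : k[X]) : S.rel P ∈ S.rels q := by
  induction P using Polynomial.induction_on' with
  | add P Q hP hQ => rw [rel_add]; exact add_mem hP hQ
  | monomial n r =>
    rw [← mul_one r, ← smul_eq_mul, ← smul_monomial, rel_smul, monomial_one_right_eq_X_pow]
    refine Submodule.smul_mem _ _ (Submodule.subset_span ⟨(0, n), ?_⟩)
    simp

omit hq hg [CharZero k] in
lemma ad_ad (a b c : A) : ad k a (ad k b c) = ad k (ad k a b) c + ad k b (ad k a c) := by
  simp only [ad_apply]; noncomm_ring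

omit hq hg in
lemma ad_x_aeval_cas_mul_y_mem (P : k[X]) :
    ad k S.x (aeval S.cas P * S.y) ∈ S.adImage ⊔ S.rels q := by
  refine mem_of_smul_mem (c := (2 : k)) two_ne_zero ?_
  rw [bracket_y]
  exact add_mem (Submodule.mem_sup_right (S.rel_mem_rels P)) (Submodule.mem_sup_left (S.ad_f_mem _))

-- Symmetrizing with `ad f` as in `bracket_y` gives half of `[x, P(Δ) wy] - [y, P(Δ) wx]`, which is
-- again some `rel Q`.
omit hq hg in
lemma ad_x_aeval_cas_mul_wy_mem (P : k[X]) :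
    ad k S.x (aeval S.cas P * S.wy) ∈ S.adImage ⊔ S.rels q := by
  obtain ⟨Q, hQ⟩ := exists_powSum_eq_powDiff P
  have h1 := S.rel_eq_of_comp hQ
  have h2 : ad k S.f (ad k S.x (aeval S.cas P * S.wx)) =
      ad k S.y (aeval S.cas P * S.wx) + ad k S.x (aeval S.cas P * S.wy) := by
    have h3 : ad k S.f S.cas = 0 := by rw [ad_apply, S.cas_f, sub_self]
    rw [ad_ad, ad_f_x, ad_mul_of_comm (aeval_mul_comm S.cas_f P).symm, wx, ad_ad, h3, ad_f_x, wy]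
    simp [ad_apply]
  refine mem_of_smul_mem (c := (2 : k)) two_ne_zero ?_
  have h4 : (2 : k) • ad k S.x (aeval S.cas P * S.wy) =
      S.rel Q + ad k S.f (ad k S.x (aeval S.cas P * S.wx)) := by
    rw [← h1, h2]; module
  rw [h4]
  exact add_mem (Submodule.mem_sup_right (S.rel_mem_rels Q)) (Submodule.mem_sup_left (S.ad_f_mem _))

/-- Modulo `[sl₂, A]` the map `[x, ·]` kills the images of `ad e`, `ad h + 1` and `(ad f)²`, because
`x` is a highest weight vector of weight 1 generating `V`. Hence only the generators `y` and `wy`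
over `k[t, Δ]` matter. -/
lemma ad_x_mem (a : A) : ad k S.x a ∈ S.adImage ⊔ S.rels q := by
  obtain ⟨n, hn⟩ := S.exists_mem_filt hg a
  let N : Submodule k A := LinearMap.range (ad k S.e) ⊔ LinearMap.range (ad k S.h + 1) ⊔
    LinearMap.range (ad k S.f * ad k S.f) ⊔
    Submodule.span k (Set.range fun r : ℕ × k[X] => S.quad q ^ r.1 * (aeval S.cas r.2 * S.y)) ⊔
    Submodule.span k (Set.range fun r : ℕ × k[X] => S.quad q ^ r.1 * (aeval S.cas r.2 * S.wy))
  have me : ∀ a, ad k S.e a ∈ N := fun a => Submodule.mem_sup_left <| Submodule.mem_sup_left <|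
    Submodule.mem_sup_left <| Submodule.mem_sup_left ⟨a, rfl⟩
  have mh : ∀ a, ad k S.h a + a ∈ N := fun a => Submodule.mem_sup_left <|
    Submodule.mem_sup_left <| Submodule.mem_sup_left <| Submodule.mem_sup_right ⟨a, rfl⟩
  have mf : ∀ a, ad k S.f (ad k S.f a) ∈ N := fun a => Submodule.mem_sup_left <|
    Submodule.mem_sup_left <| Submodule.mem_sup_right ⟨a, rfl⟩
  have my : ∀ (i : ℕ) (P : k[X]), S.quad q ^ i * (aeval S.cas P * S.y) ∈ N := fun i P =>
    Submodule.mem_sup_left <| Submodule.mem_sup_right <| Submodule.subset_span ⟨(i, P), rfl⟩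
  have mwy : ∀ (i : ℕ) (P : k[X]), S.quad q ^ i * (aeval S.cas P * S.wy) ∈ N := fun i P =>
    Submodule.mem_sup_right <| Submodule.subset_span ⟨(i, P), rfl⟩
  have induct : ∀ G : Submodule k A, (∀ a, ad k S.e a ∈ G) → (∀ a, ad k S.h a + a ∈ G) →
      (∀ a, ad k S.f (ad k S.f a) ∈ G) →
      (∀ (i : ℕ) (P : k[X]), S.quad q ^ i * (aeval S.cas P * S.y) ∈ G) →
      (∀ (i : ℕ) (P : k[X]), S.quad q ^ i * (aeval S.cas P * S.wy) ∈ G) → N ≤ G := by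
    intro G h1 h2 h3 h4 h5
    refine sup_le (sup_le (sup_le (sup_le ?_ ?_) ?_) (Submodule.span_le.2 ?_))
      (Submodule.span_le.2 ?_)
    · rintro _ ⟨a, rfl⟩; exact h1 a
    · rintro _ ⟨a, rfl⟩; exact h2 a
    · rintro _ ⟨a, rfl⟩; exact h3 a
    · rintro _ ⟨⟨i, P⟩, rfl⟩; exact h4 i P
    · rintro _ ⟨⟨i, P⟩, rfl⟩; exact h5 i P
  have hN : a ∈ N := by
    refine S.filt_le_of_weight_neg_one (q := q) ?_ ?_ me mf mh ?_ ?_ n hn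
    · intro b hb
      refine (induct (N.comap (LinearMap.mulLeft k (S.quad q))) ?_ ?_ ?_ ?_ ?_) hb <;> intros <;>
        rw [Submodule.mem_comap, LinearMap.mulLeft_apply]
      · rw [← ad_mul_of_comm (S.quad_comm hq hg _)]; exact me _
      · rw [mul_add, ← ad_mul_of_comm (S.quad_comm hq hg _)]; exact mh _
      · rw [← ad_mul_of_comm (S.quad_comm hq hg _), ← ad_mul_of_comm (S.quad_comm hq hg _)]
        exact mf _
      · rw [← mul_assoc, ← pow_succ']; exact my _ _
      · rw [← mul_assoc, ← pow_succ']; exact mwy _ _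
    · intro Q b hb
      have he := (aeval_mul_comm S.cas_e Q).symm
      have hf := (aeval_mul_comm S.cas_f Q).symm
      have hh := (aeval_mul_comm S.cas_h Q).symm
      refine (induct (N.comap (LinearMap.mulLeft k (aeval S.cas Q))) ?_ ?_ ?_ ?_ ?_) hb <;>
        intros <;> rw [Submodule.mem_comap, LinearMap.mulLeft_apply]
      · rw [← ad_mul_of_comm he]; exact me _
      · rw [mul_add, ← ad_mul_of_comm hh]; exact mh _
      · rw [← ad_mul_of_comm hf, ← ad_mul_of_comm hf]; exact mf _
      · rw [← mul_assoc, S.quad_pow_comm hq hg, mul_assoc, ← mul_assoc (aeval S.cas Q), ← map_mul]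
        exact my _ _
      · rw [← mul_assoc, S.quad_pow_comm hq hg, mul_assoc, ← mul_assoc (aeval S.cas Q), ← map_mul]
        exact mwy _ _
    · simpa using my 0 1
    -- The generator `f x` is traded for `wy`: up to multiples of `y`, six times `f x` is `wy` plus
    -- elements in the images of `ad e` and `ad h + 1`.
    · have h1 : S.f * S.x = (6 : k)⁻¹ • (S.wy + (3 : k) • S.y + (2 : k) •
          (ad k S.e (ad k S.f (S.f * S.x)) - (ad k S.h (S.f * S.x) + S.f * S.x))) := by
        have h6 : (6 : k) ≠ 0 := by norm_num
        rw [eq_inv_smul_iff₀ h6, wy_eq]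
        simp only [ad_apply, mul_add, add_mul, mul_sub, sub_mul, smul_mul_assoc, mul_smul_comm,
          mul_assoc, pow_two, S.order, S.z_order, smul_add, smul_sub, smul_neg]
        module
      rw [h1]
      have h2 := my 0 1
      have h3 := mwy 0 1
      rw [pow_zero, one_mul, map_one, one_mul] at h2 h3
      exact Submodule.smul_mem _ _ (add_mem (add_mem h3 (Submodule.smul_mem _ _ h2))
        (Submodule.smul_mem _ _ (sub_mem (me _) (mh _))))
  refine (induct ((S.adImage ⊔ S.rels q).comap (ad k S.x)) ?_ ?_ ?_ ?_ ?_) hN <;> intros <;>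
    rw [Submodule.mem_comap]
  · rename_i b
    refine Submodule.mem_sup_left ?_
    have h := ad_ad (k := k) S.e S.x b
    rw [ad_e_x] at h
    have h' : ad k S.x (ad k S.e b) = ad k S.e (ad k S.x b) := by rw [h]; simp [ad_apply]
    rw [h']
    exact S.ad_e_mem _
  · rename_i b
    refine Submodule.mem_sup_left ?_
    have h := ad_ad (k := k) S.h S.x b
    rw [ad_h_x, one_smul] at h
    rw [map_add, add_comm, ← h]
    exact S.ad_h_mem _
  · rename_i b
    refine Submodule.mem_sup_left ?_
    have h := ad_ad (k := k) S.f S.x (ad k S.f b)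
    have h' := ad_ad (k := k) S.f S.y b
    rw [ad_f_x] at h
    rw [ad_f_y] at h'
    have h2 : ad k S.x (ad k S.f (ad k S.f b)) =
        ad k S.f (ad k S.x (ad k S.f b)) - ad k S.f (ad k S.y b) := by
      rw [h, h']; simp [ad_apply]
    rw [h2]
    exact sub_mem (S.ad_f_mem _) (S.ad_f_mem _)
  · rw [ad_mul_of_comm (S.quad_pow_comm hq hg _ _)]
    exact S.quad_mul_mem_rels hq hg (S.ad_x_aeval_cas_mul_y_mem _) _
  · rw [ad_mul_of_comm (S.quad_pow_comm hq hg _ _)]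
    exact S.quad_mul_mem_rels hq hg (S.ad_x_aeval_cas_mul_wy_mem _) _

/-- The identity `[a b, c] = [a, b c] + [b, c a]` reduces the first entry of a commutator to the
generators, and `y = [f, x]` reduces `y` to `x`. -/
theorem brackets_eq : brackets k A = S.adImage ⊔ S.rels q := by
  refine le_antisymm (Submodule.span_le.2 ?_) (sup_le S.adImage_le_brackets
    (Submodule.span_le.2 ?_))
  · rintro _ ⟨a, b, rfl⟩
    change ad k a b ∈ S.adImage ⊔ S.rels q
    refine S.induction_generators hg (Q := fun a => ∀ b, ad k a b ∈ S.adImage ⊔ S.rels q)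
      (fun b => Submodule.mem_sup_left (S.ad_e_mem b))
      (fun b => Submodule.mem_sup_left (S.ad_f_mem b))
      (fun b => Submodule.mem_sup_left (S.ad_h_mem b)) (S.ad_x_mem hq hg) ?_ ?_ ?_ ?_ a b
    · intro b
      have h := ad_ad (k := k) S.f S.x b
      rw [ad_f_x] at h
      rw [← add_sub_cancel_right (ad k S.y b) (ad k S.x (ad k S.f b)), ← h]
      exact sub_mem (Submodule.mem_sup_left (S.ad_f_mem _)) (S.ad_x_mem hq hg _)
    · intro r b
      rw [ad_apply, Algebra.commutes, sub_self]
      exact zero_mem _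
    · intro a b ha hb c
      have h : ad k (a + b) c = ad k a c + ad k b c := by simp only [ad_apply]; noncomm_ring
      rw [h]
      exact add_mem (ha c) (hb c)
    · intro a b ha hb c
      have h : ad k (a * b) c = ad k a (b * c) + ad k b (c * a) := by
        simp only [ad_apply]; noncomm_ring
      rw [h]
      exact add_mem (ha _) (hb _)
  · rintro _ ⟨⟨i, n⟩, rfl⟩
    refine mul_mem_brackets (fun b => S.quad_pow_comm hq hg i b) ?_
    have h := S.bracket_y (X ^ n)
    rw [← sub_eq_iff_eq_add] at h
    rw [← h]
    exact sub_mem (Submodule.smul_mem _ _ (ad_mem_brackets _ _)) (ad_mem_brackets _ _)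

end
end System

/-! ### Small powers of the Casimir element span the commutator quotient over `k[t]`. -/

lemma relPoly_coeff_ne_zero {k : Type*} [Field k] [CharZero k] {p : k[X]} (hp : p ≠ 0) (n : ℕ) :
    (2 * p.leadingCoeff * (1 + n / (p.natDegree + 1)) : k) ≠ 0 := by
  have h3 : (p.natDegree + 1 : k) ≠ 0 := by exact_mod_cast p.natDegree.succ_ne_zero
  have h4 : (1 + n / (p.natDegree + 1) : k) = ((p.natDegree + 1 + n : ℕ) : k) /
    (p.natDegree + 1) := by field_simp; push_cast; ring
  rw [h4]
  refine mul_ne_zero (mul_ne_zero two_ne_zero (leadingCoeff_ne_zero.2 hp))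
    (div_ne_zero (Nat.cast_ne_zero.2 (by omega)) h3)

namespace System

variable {k : Type*} [Field k] {p : k[X]} {A : Type*} [Ring A] [Algebra k A] (S : System p A)

lemma mul_aeval_mem {W : Submodule k A} {c a : A} {n : ℕ} (h : ∀ j < n, a * c ^ j ∈ W) {P : k[X]}
    (hP : P.degree < n) : a * aeval c P ∈ W := by
  rw [aeval_eq_sum_range, Finset.mul_sum]
  refine sum_mem fun j hj => ?_
  rw [mul_smul_comm]
  by_cases h0 : P = 0
  · simp [h0]
  · refine Submodule.smul_mem _ _ (h j (lt_of_le_of_lt (Finset.mem_range_succ_iff.1 hj) ?_))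
    rwa [degree_eq_natDegree h0, Nat.cast_lt] at hP

variable [CharZero k] {q : k[X]} (hq : Balanced p q) (hg : S.Generates)
  (hd : q.natDegree ≤ p.natDegree + 1)
  (hc : q.coeff (p.natDegree + 1) = - p.leadingCoeff / (2 * (p.natDegree + 1))) (hp : p ≠ 0)
include hq hg hd hc hp

/-- The span of the products of powers of the quadratic element and of small powers of the
Casimir element. -/
def smallInv (q : k[X]) : Submodule k A :=
  Submodule.span k {a | ∃ i l : ℕ, l < p.natDegree ∧ a = S.quad q ^ i * S.cas ^ l}

/-- For `j = m + n` the relation `tⁱ rel(Δⁿ)` has leading term a nonzero multiple of `tⁱ Δʲ`. The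
remaining terms have smaller powers of `Δ`, though possibly one more power of `t`, so the induction
runs over `j` with `i` arbitrary. -/
lemma quad_pow_mul_cas_pow_mem (j : ℕ) :
    ∀ i, S.quad q ^ i * S.cas ^ j ∈ brackets k A ⊔ S.smallInv q := by
  induction j using Nat.strong_induction_on with
  | _ j ih =>
    intro i
    by_cases hj : j < p.natDegree
    · exact Submodule.mem_sup_right (Submodule.subset_span ⟨i, j, hj, rfl⟩)
    · obtain ⟨n, rfl⟩ := Nat.exists_eq_add_of_le (not_lt.1 hj)
      obtain ⟨h1, h2⟩ := relPoly_spec hd hc n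
      have hne := relPoly_coeff_ne_zero hp n
      rw [← h2] at hne
      have h5 : (relPoly p q n - C ((relPoly p q n).coeff (p.natDegree + n)) *
          X ^ (p.natDegree + n)).degree < ((p.natDegree + n : ℕ) : WithBot ℕ) := by
        rw [degree_lt_iff_coeff_zero]
        intro r hr
        rw [coeff_sub, coeff_C_mul, coeff_X_pow]
        split_ifs with h
        · rw [h]; ring
        · rw [coeff_eq_zero_of_natDegree_lt (lt_of_le_of_lt h1 (lt_of_le_of_ne hr (Ne.symm h)))]
          ring
      have h6 : (splitPow k n).2.degree < ((p.natDegree + n : ℕ) : WithBot ℕ) := by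
        rcases n with _ | n
        · rw [splitPow, degree_zero]; exact WithBot.bot_lt_coe _
        · have h := (splitPow_spec (k := k) (n + 1)).2.2.1
          refine lt_of_le_of_lt degree_le_natDegree (Nat.cast_lt.2 ?_)
          omega
      have h7 := mul_aeval_mem (fun r hr => ih r hr i) h5
      have h8 := mul_aeval_mem (fun r hr => ih r hr (i + 1)) h6
      have h9 : S.quad q ^ i * S.rel (X ^ n) ∈ brackets k A ⊔ S.smallInv q := by
        refine Submodule.mem_sup_left ?_
        rw [S.brackets_eq hq hg]
        exact Submodule.mem_sup_right (Submodule.subset_span ⟨(i, n), rfl⟩)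
      refine mem_of_smul_mem hne ?_
      convert add_mem (sub_mem h9 h7) (Submodule.smul_mem _ (4 : k) h8) using 1
      rw [S.rel_X_pow q, map_sub, map_mul, aeval_C, aeval_X_pow, ← Algebra.smul_def, mul_sub,
        mul_sub, mul_smul_comm, mul_smul_comm, ← mul_assoc, ← pow_succ]
      abel

theorem brackets_sup_smallInv : brackets k A ⊔ S.smallInv q = ⊤ := by
  rw [eq_top_iff, ← S.inv_sup_adImage hq hg]
  refine sup_le (Submodule.span_le.2 ?_) (S.adImage_le_brackets.trans le_sup_left)
  rintro _ ⟨⟨i, P⟩, rfl⟩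
  exact mul_aeval_mem (n := P.natDegree + 1)
    (fun j _ => S.quad_pow_mul_cas_pow_mem hq hg hd hc hp j i)
    (lt_of_le_of_lt degree_le_natDegree (Nat.cast_lt.2 (Nat.lt_succ_self _)))

end System

/-! ### Representations by difference operators. -/

section Model

variable {k : Type*} [Field k]

/-- The weighted shift operator on functions on the lattice. -/
def wshift (w : ℤ → ℤ → k) (s t : ℤ) : Module.End k (ℤ → ℤ → k) where
  toFun φ a b := w a b * φ (a + s) (b + t)
  map_add' φ ψ := by ext a b; simp [mul_add]
  map_smul' r φ := by ext a b; simp [mul_left_comm]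

lemma wshift_apply (w : ℤ → ℤ → k) (s t : ℤ) (φ : ℤ → ℤ → k) (a b : ℤ) :
    wshift w s t φ a b = w a b * φ (a + s) (b + t) := rfl

lemma end_ext {T U : Module.End k (ℤ → ℤ → k)} (h : ∀ φ a b, T φ a b = U φ a b) : T = U :=
  LinearMap.ext fun φ => funext fun a => funext fun b => h φ a b

lemma aeval_diagonal {T : Module.End k (ℤ → ℤ → k)} {d : ℤ → ℤ → k}
    (hT : ∀ φ a b, T φ a b = d a b * φ a b) (P : k[X]) (φ : ℤ → ℤ → k) (a b : ℤ) :
    aeval T P φ a b = P.eval (d a b) * φ a b := by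
  induction P using Polynomial.induction_on' with
  | add P Q hP hQ =>
    rw [map_add, LinearMap.add_apply, Pi.add_apply, Pi.add_apply, hP, hQ, eval_add, add_mul]
  | monomial n r =>
    have h : ∀ n : ℕ, (T ^ n) φ a b = d a b ^ n * φ a b := by
      intro n
      induction n with
      | zero => simp
      | succ n ih => rw [pow_succ', Module.End.mul_apply, hT, ih]; ring
    rw [← C_mul_X_pow_eq_monomial, map_mul, aeval_C, aeval_X_pow, Module.End.mul_apply,
      Module.algebraMap_end_apply, Pi.smul_apply, Pi.smul_apply, h]
    simp [mul_assoc]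

variable (k) in
/-- The degree of the monomial with exponents `a` and `b + 1/2`. -/
noncomputable def deg (N : ℤ) : k := N + 1 / 2

variable (k) in
/-- The value of the Casimir element in degree `deg N`. -/
noncomputable def casVal (N : ℤ) : k := deg k N ^ 2 + 2 * deg k N

/-- The potential with difference `(n + 1) z`. -/
noncomputable def potential (p q : k[X]) (c : k) (N : ℤ) : k :=
  -(c + 1 / 2 * deg k N * p.eval (casVal k N) + q.eval (casVal k N))

/-- The coefficient of the derivatives in the operators `x` and `y`. -/
noncomputable def modelCoeff (p q : k[X]) (c : k) (N : ℤ) : k :=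
  potential p q c (N + 1) / ((deg k N + 1) * (deg k N + 2))

variable [CharZero k]

/-- This is the reason for the half-integral exponents: degrees are never integers, so the
denominators in `modelCoeff` never vanish. -/
lemma deg_add_ne_zero (N i : ℤ) : deg k N + i ≠ 0 := by
  intro h
  have h1 : ((2 * N + 1 + 2 * i : ℤ) : k) = 0 := by
    push_cast
    rw [deg] at h
    linear_combination 2 * h
  have h2 := Int.cast_eq_zero.1 h1
  omega

lemma casVal_injOn : Set.InjOn (fun n : ℕ => casVal k (n : ℤ)) Set.univ := by
  intro m _ n _ h
  simp only [casVal, deg] at h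
  have h2 : ((((m : ℤ) - n) * ((m : ℤ) + n + 3) : ℤ) : k) = 0 := by
    push_cast at h ⊢
    linear_combination h
  rcases mul_eq_zero.1 (Int.cast_eq_zero.1 h2) with h3 | h3 <;> omega

lemma eq_zero_of_eval_casVal {P : k[X]} (h : ∀ n : ℕ, P.eval (casVal k (n : ℤ)) = 0) : P = 0 := by
  refine Polynomial.eq_zero_of_infinite_isRoot P (Set.infinite_of_injective_forall_mem
    (f := fun n : ℕ => casVal k (n : ℤ)) (Set.injOn_univ.1 casVal_injOn) h)

variable {p q : k[X]}

/-- At the point `n + 3/2` the polynomials `lpoly` and `rpoly` take the Casimir values of the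
degrees `n + 1` and `n`, so `Balanced` specializes to this difference equation. -/
lemma potential_add_one (hq : Balanced p q) (c : k) (N : ℤ) :
    potential p q c (N + 1) = potential p q c N + (deg k N + 1) * p.eval (casVal k N) := by
  have h := congrArg (eval (deg k N + 3 / 2)) hq
  have h1 : casVal k (N + 1) = (lpoly k).eval (deg k N + 3 / 2) := by
    simp only [casVal, deg, lpoly, eval_add, eval_sub, eval_pow, eval_X, eval_C]
    push_cast
    ring
  have h2 : casVal k N = (rpoly k).eval (deg k N + 3 / 2) := by
    simp only [casVal, deg, rpoly, eval_add, eval_sub, eval_pow, eval_X, eval_C]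
    ring
  have h3 : deg k (N + 1) = deg k N + 1 := by simp only [deg]; push_cast; ring
  simp only [eval_mul, eval_sub, eval_add, eval_comp, eval_X, eval_ofNat, ← h1, ← h2] at h
  rw [potential, potential, h3]
  linear_combination 1 / 4 * h

/-- Multiplied by the degree plus one, this is the difference equation for the potential; it is what
`[x, y] = z` requires of the model. -/
lemma modelCoeff_spec (hq : Balanced p q) (c : k) (N : ℤ) :
    (deg k N + 2) * modelCoeff p q c N - deg k N * modelCoeff p q c (N - 1) =
      p.eval (casVal k N) := by
  have h0 := deg_add_ne_zero (k := k) N 0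
  have h1 := deg_add_ne_zero (k := k) N 1
  have h2 := deg_add_ne_zero (k := k) N 2
  have h3 : deg k (N - 1) = deg k N - 1 := by simp only [deg]; push_cast; ring
  push_cast at h0 h1 h2
  rw [add_zero] at h0
  rw [modelCoeff, modelCoeff, h3, sub_add_cancel, sub_add_cancel, potential_add_one hq,
    show deg k N - 1 + 2 = deg k N + 1 by ring]
  field_simp
  ring

lemma potential_eq (c : k) (N : ℤ) :
    potential p q c N = deg k N * (deg k N + 1) * modelCoeff p q c (N - 1) := by
  have h0 := deg_add_ne_zero (k := k) N 0
  have h1 := deg_add_ne_zero (k := k) N 1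
  have h3 : deg k (N - 1) = deg k N - 1 := by simp only [deg]; push_cast; ring
  push_cast at h0 h1
  rw [add_zero] at h0
  rw [modelCoeff, h3, sub_add_cancel, sub_add_cancel,
    show deg k N - 1 + 2 = deg k N + 1 by ring]
  field_simp

lemma model_cas (φ : ℤ → ℤ → k) (a b : ℤ) :
    ((wshift (fun a b => (a - (b + 1 / 2) : k)) 0 0) ^ 2 + (4 : k) •
      (wshift (fun _ b => (b + 3 / 2 : k)) (-1) 1 * wshift (fun a _ => (a + 1 : k)) 1 (-1)) -
      (2 : k) • wshift (fun a b => (a - (b + 1 / 2) : k)) 0 0 : Module.End k (ℤ → ℤ → k)) φ a b =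
      casVal k (a + b) * φ a b := by
  simp only [pow_two, LinearMap.sub_apply, LinearMap.add_apply, LinearMap.smul_apply,
    Module.End.mul_apply, Pi.sub_apply, Pi.add_apply, Pi.smul_apply, wshift_apply, smul_eq_mul,
    casVal, deg]
  push_cast
  ring_nf

/-- The representation by difference operators on which the quadratic element acts by `c`. -/
noncomputable def model (hq : Balanced p q) (c : k) : System p (Module.End k (ℤ → ℤ → k)) where
  -- A function on the lattice stands for a formal combination of monomials `X^a Y^(b + 1/2)`. Then
  -- `e, f, h` are `X ∂_Y`, `Y ∂_X` and `X ∂_X - Y ∂_Y`, while `x` and `y` are `X + g ∂_Y` and `Y -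
  -- g ∂_X`, where `g` acts on each degree by the scalar `modelCoeff`.
  e := wshift (fun _ b => b + 3 / 2) (-1) 1
  f := wshift (fun a _ => a + 1) 1 (-1)
  h := wshift (fun a b => a - (b + 1 / 2)) 0 0
  x := wshift 1 (-1) 0 + wshift (fun a b => modelCoeff p q c (a + b) * (b + 3 / 2)) 0 1
  y := wshift 1 0 (-1) - wshift (fun a b => modelCoeff p q c (a + b) * (a + 1)) 1 0
  he := end_ext fun φ a b => by
    simp only [LinearMap.sub_apply, LinearMap.add_apply, LinearMap.smul_apply, Pi.one_apply,
      Module.End.mul_apply, Pi.sub_apply, Pi.add_apply, Pi.smul_apply, wshift_apply, smul_eq_mul]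
    push_cast
    ring_nf
  hf := end_ext fun φ a b => by
    simp only [LinearMap.sub_apply, LinearMap.add_apply, LinearMap.smul_apply, Pi.one_apply,
      Module.End.mul_apply, Pi.sub_apply, Pi.add_apply, Pi.smul_apply, wshift_apply, smul_eq_mul]
    push_cast
    ring_nf
  ef := end_ext fun φ a b => by
    simp only [LinearMap.sub_apply, LinearMap.add_apply, LinearMap.smul_apply, Pi.one_apply,
      Module.End.mul_apply, Pi.sub_apply, Pi.add_apply, Pi.smul_apply, wshift_apply, smul_eq_mul]
    push_cast
    ring_nf
  hx := end_ext fun φ a b => by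
    simp only [LinearMap.sub_apply, LinearMap.add_apply, LinearMap.smul_apply, Pi.one_apply,
      Module.End.mul_apply, Pi.sub_apply, Pi.add_apply, Pi.smul_apply, wshift_apply, smul_eq_mul]
    push_cast
    ring_nf
  hy := end_ext fun φ a b => by
    simp only [LinearMap.sub_apply, LinearMap.add_apply, LinearMap.smul_apply, Pi.one_apply,
      Module.End.mul_apply, Pi.sub_apply, Pi.add_apply, Pi.smul_apply, wshift_apply, smul_eq_mul]
    push_cast
    ring_nf
  ex := end_ext fun φ a b => by
    simp only [LinearMap.sub_apply, LinearMap.add_apply, LinearMap.smul_apply, Pi.one_apply,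
      Module.End.mul_apply, Pi.sub_apply, Pi.add_apply, Pi.smul_apply, wshift_apply, smul_eq_mul]
    push_cast
    ring_nf
  ey := end_ext fun φ a b => by
    simp only [LinearMap.sub_apply, LinearMap.add_apply, LinearMap.smul_apply, Pi.one_apply,
      Module.End.mul_apply, Pi.sub_apply, Pi.add_apply, Pi.smul_apply, wshift_apply, smul_eq_mul]
    push_cast
    ring_nf
  fx := end_ext fun φ a b => by
    simp only [LinearMap.sub_apply, LinearMap.add_apply, LinearMap.smul_apply, Pi.one_apply,
      Module.End.mul_apply, Pi.sub_apply, Pi.add_apply, Pi.smul_apply, wshift_apply, smul_eq_mul]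
    push_cast
    ring_nf
  fy := end_ext fun φ a b => by
    simp only [LinearMap.sub_apply, LinearMap.add_apply, LinearMap.smul_apply, Pi.one_apply,
      Module.End.mul_apply, Pi.sub_apply, Pi.add_apply, Pi.smul_apply, wshift_apply, smul_eq_mul]
    push_cast
    ring_nf
  xy := end_ext fun φ a b => by
    rw [LinearMap.add_apply, Pi.add_apply, Pi.add_apply, aeval_diagonal model_cas,
      ← modelCoeff_spec hq c]
    simp only [LinearMap.sub_apply, LinearMap.add_apply, LinearMap.smul_apply, Pi.one_apply,
      Module.End.mul_apply, Pi.sub_apply, Pi.add_apply, Pi.smul_apply, wshift_apply, smul_eq_mul,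
      deg]
    push_cast
    ring_nf

lemma model_aeval_cas (hq : Balanced p q) (c : k) (P : k[X]) (φ : ℤ → ℤ → k) (a b : ℤ) :
    aeval (model hq c).cas P φ a b = P.eval (casVal k (a + b)) * φ a b :=
  aeval_diagonal model_cas P φ a b

lemma model_e_apply (hq : Balanced p q) (c : k) (φ : ℤ → ℤ → k) (a b : ℤ) :
    (model hq c).e φ a b = (b + 3 / 2) * φ (a - 1) (b + 1) := rfl

lemma model_f_apply (hq : Balanced p q) (c : k) (φ : ℤ → ℤ → k) (a b : ℤ) :
    (model hq c).f φ a b = (a + 1) * φ (a + 1) (b - 1) := rfl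

lemma model_h_apply (hq : Balanced p q) (c : k) (φ : ℤ → ℤ → k) (a b : ℤ) :
    (model hq c).h φ a b = (a - (b + 1 / 2)) * φ a b := by
  simp [model, wshift_apply]

lemma model_x_apply (hq : Balanced p q) (c : k) (φ : ℤ → ℤ → k) (a b : ℤ) :
    (model hq c).x φ a b =
      φ (a - 1) b + modelCoeff p q c (a + b) * (b + 3 / 2) * φ a (b + 1) := by
  simp [model, wshift_apply, sub_eq_add_neg]

lemma model_y_apply (hq : Balanced p q) (c : k) (φ : ℤ → ℤ → k) (a b : ℤ) :
    (model hq c).y φ a b =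
      φ a (b - 1) - modelCoeff p q c (a + b) * (a + 1) * φ (a + 1) b := by
  simp [model, wshift_apply, sub_eq_add_neg]

lemma model_quad (hq : Balanced p q) (c : k) : (model hq c).quad q = algebraMap k _ c :=
  end_ext fun φ a b => by
    have h1 := potential_eq (p := p) (q := q) c (a + b)
    have h2 := modelCoeff_spec hq c (a + b)
    have h3 : (q.eval (casVal k (a + b))) = -(c + 1 / 2 * deg k (a + b) *
        p.eval (casVal k (a + b)) + potential p q c (a + b)) := by rw [potential]; ring
    rw [h1, ← h2] at h3
    simp only [System.quad, System.z, LinearMap.sub_apply, LinearMap.add_apply,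
      LinearMap.smul_apply, Module.End.mul_apply, Pi.sub_apply, Pi.add_apply, Pi.smul_apply,
      smul_eq_mul, model_aeval_cas, h3]
    simp only [pow_two, Module.End.mul_apply, model_aeval_cas, model_x_apply, model_y_apply,
      model_e_apply, model_f_apply, model_h_apply,
      Module.algebraMap_end_apply, Pi.smul_apply, smul_eq_mul, ← h2]
    simp only [show a + 1 - 1 = a by ring, sub_add_cancel, show b + 1 - 1 = b by ring, deg]
    push_cast
    ring_nf

lemma eq_zero_of_model_aeval_cas (hq : Balanced p q) (c : k) {P : k[X]}
    (h : aeval (model hq c).cas P = 0) : P = 0 := by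
  refine eq_zero_of_eval_casVal fun n => ?_
  have h1 := congrFun (congrFun (LinearMap.congr_fun h (fun _ _ => 1)) n) 0
  rw [model_aeval_cas] at h1
  simpa using h1

/-- The `X` in `x` raises the degree by one, so commuting with it forces `P` to take equal values at
consecutive Casimir values; these are infinitely many distinct numbers. -/
lemma eq_C_of_model_commute (hq : Balanced p q) (c : k) {P : k[X]}
    (h : (model hq c).x * aeval (model hq c).cas P = aeval (model hq c).cas P * (model hq c).x) :
    P = C (P.eval (casVal k 0)) := by
  have h1 : ∀ n : ℕ, P.eval (casVal k (n : ℤ)) = P.eval (casVal k 0) := by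
    intro n
    induction n with
    | zero => simp
    | succ n ih =>
      -- Tested on a single monomial of exponents `n` and `1/2`, reading off the coefficient one
      -- degree higher, where only the `X` part of `x` contributes.
      have h2 := congrFun (congrFun (LinearMap.congr_fun h
        (fun a b => if a = n ∧ b = 0 then 1 else 0))
        (n + 1)) 0
      rw [Module.End.mul_apply, Module.End.mul_apply, model_aeval_cas, model_x_apply,
        model_x_apply, model_aeval_cas, model_aeval_cas] at h2
      rw [← ih]
      simpa using h2.symm
  rw [← sub_eq_zero]
  refine eq_zero_of_eval_casVal fun n => ?_
  rw [eval_sub, h1, eval_C, sub_self]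

end Model

/-! ### The presented algebra and its universal property. -/

section Presentation

variable {k : Type*} [Field k] {p : k[X]}

variable (p) in
/-- The generators of the infinitesimal Hecke algebra. -/
def heckeSystem : System p (Hecke p) where
  e := elt p Gen.e
  f := elt p Gen.f
  h := elt p Gen.h
  x := elt p Gen.x
  y := elt p Gen.y
  he := by
    have := RingQuot.mkAlgHom_rel k (Rel.he (p := p))
    simp only [map_sub, map_mul, map_smul] at this
    rw [← sub_eq_iff_eq_add']; exact this
  hf := by
    have := RingQuot.mkAlgHom_rel k (Rel.hf (p := p))
    simp only [map_sub, map_mul, map_smul, map_neg] at this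
    rw [sub_eq_add_neg, ← sub_eq_iff_eq_add']; exact this
  ef := by
    have := RingQuot.mkAlgHom_rel k (Rel.ef (p := p))
    simp only [map_sub, map_mul] at this
    rw [← sub_eq_iff_eq_add']; exact this
  hx := by
    have := RingQuot.mkAlgHom_rel k (Rel.hx (p := p))
    simp only [map_sub, map_mul] at this
    rw [← sub_eq_iff_eq_add']; exact this
  hy := by
    have := RingQuot.mkAlgHom_rel k (Rel.hy (p := p))
    simp only [map_sub, map_mul, map_neg] at this
    rw [sub_eq_add_neg, ← sub_eq_iff_eq_add']; exact this
  ex := by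
    have := RingQuot.mkAlgHom_rel k (Rel.ex (p := p))
    simp only [map_sub, map_mul, map_zero] at this
    exact sub_eq_zero.1 this
  ey := by
    have := RingQuot.mkAlgHom_rel k (Rel.ey (p := p))
    simp only [map_sub, map_mul] at this
    rw [← sub_eq_iff_eq_add']; exact this
  fx := by
    have := RingQuot.mkAlgHom_rel k (Rel.fx (p := p))
    simp only [map_sub, map_mul] at this
    rw [← sub_eq_iff_eq_add']; exact this
  fy := by
    have := RingQuot.mkAlgHom_rel k (Rel.fy (p := p))
    simp only [map_sub, map_mul, map_zero] at this
    exact sub_eq_zero.1 this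
  xy := by
    have := RingQuot.mkAlgHom_rel k (Rel.xy (p := p))
    rw [map_sub, map_mul, map_mul, ← aeval_algHom_apply, freeCasimir] at this
    simp only [map_sub, map_add, map_mul, map_pow, map_smul] at this
    rw [← sub_eq_iff_eq_add']; exact this

variable (p) in
lemma heckeSystem_generates : (heckeSystem p).Generates := by
  rw [System.Generates, eq_top_iff]
  have h1 : (RingQuot.mkAlgHom k (Rel p)).range = ⊤ :=
    AlgHom.range_eq_top _ |>.2 (RingQuot.mkAlgHom_surjective k (Rel p))
  rw [← h1, ← Algebra.map_top, ← FreeAlgebra.adjoin_range_ι, AlgHom.map_adjoin]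
  refine Algebra.adjoin_mono ?_
  rintro _ ⟨_, ⟨g, rfl⟩, rfl⟩
  change elt p g ∈ _
  cases g <;> simp [heckeSystem]

variable {B : Type*} [Ring B] [Algebra k B] (T : System p B)

/-- The value of a generator in a system. -/
def System.val : Gen → B
  | Gen.e => T.e
  | Gen.f => T.f
  | Gen.h => T.h
  | Gen.x => T.x
  | Gen.y => T.y

/-- The universal property of the infinitesimal Hecke algebra. -/
def System.lift : Hecke p →ₐ[k] B :=
  RingQuot.liftAlgHom k ⟨FreeAlgebra.lift k T.val, by
    intro a b h
    have hg : ∀ g, FreeAlgebra.lift k T.val (gen g) = T.val g := fun g =>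
      FreeAlgebra.lift_ι_apply _ _
    cases h <;>
      simp only [map_sub, map_mul, map_smul, map_neg, map_zero, hg, System.val, sub_eq_iff_eq_add',
        add_zero, ← sub_eq_add_neg]
    · exact T.he
    · exact T.hf
    · exact T.ef
    · exact T.hx
    · exact T.hy
    · exact T.ex
    · exact T.ey
    · exact T.fx
    · exact T.fy
    · rw [T.xy, ← aeval_algHom_apply, freeCasimir]
      simp only [map_sub, map_add, map_mul, map_pow, map_smul, hg, System.val]⟩

lemma System.lift_elt (g : Gen) : T.lift (elt p g) = T.val g := by
  rw [elt, System.lift, RingQuot.liftAlgHom_mkAlgHom_apply]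
  exact FreeAlgebra.lift_ι_apply _ _

lemma System.lift_x : T.lift (heckeSystem p).x = T.x := T.lift_elt Gen.x

lemma System.lift_cas : T.lift (heckeSystem p).cas = T.cas := by
  simp only [System.cas, map_sub, map_add, map_mul, map_pow, map_smul]
  simp only [heckeSystem, T.lift_elt, System.val]

lemma System.lift_aeval_cas (P : k[X]) :
    T.lift (aeval (heckeSystem p).cas P) = aeval T.cas P := by
  rw [← aeval_algHom_apply, T.lift_cas]

lemma System.lift_quad (q : k[X]) : T.lift ((heckeSystem p).quad q) = T.quad q := by
  simp only [System.quad, System.z, map_sub, map_add, map_mul, map_pow, map_smul, T.lift_aeval_cas]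
  simp only [heckeSystem, T.lift_elt, System.val]

end Presentation

/-! ### Invariants, the center, and independence modulo the quadratic element. -/

namespace System

variable {k : Type*} [Field k] {p : k[X]} {A : Type*} [Ring A] [Algebra k A] (S : System p A)
variable {q : k[X]}

lemma comm_of_mem_inv {g : A} (hg : g * S.quad q = S.quad q * g) (hc : g * S.cas = S.cas * g)
    {a : A} (ha : a ∈ S.inv q) : ad k g a = 0 := by
  have h : S.inv q ≤ LinearMap.ker (ad k g) := by
    refine Submodule.span_le.2 ?_
    rintro _ ⟨⟨i, P⟩, rfl⟩
    rw [SetLike.mem_coe, LinearMap.mem_ker, ad_apply, sub_eq_zero]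
    exact ((Commute.pow_right (a := g) hg i).mul_right
      (show Commute g (aeval S.cas P) from (aeval_mul_comm hc.symm P).symm)).eq
  exact h ha

lemma ad_e_of_mem_inv [CharZero k] {a : A} (ha : a ∈ S.inv q) : ad k S.e a = 0 :=
  S.comm_of_mem_inv (sub_eq_zero.1 (S.ad_e_quad q)) S.cas_e.symm ha

lemma ad_h_of_mem_inv [CharZero k] {a : A} (ha : a ∈ S.inv q) : ad k S.h a = 0 :=
  S.comm_of_mem_inv (sub_eq_zero.1 (S.ad_h_quad q)) S.cas_h.symm ha

lemma rels_le_inv [CharZero k] : S.rels q ≤ S.inv q := by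
  refine Submodule.span_le.2 ?_
  rintro _ ⟨⟨i, n⟩, rfl⟩
  change S.quad q ^ i * S.rel (X ^ n) ∈ S.inv q
  rw [S.rel_X_pow q, mul_sub, mul_smul_comm, ← mul_assoc, ← pow_succ]
  exact sub_mem (S.mem_inv q _ _) (Submodule.smul_mem _ _ (S.mem_inv q _ _))

lemma quad_mul_mem_inv {a : A} (ha : a ∈ S.inv q) : S.quad q * a ∈ S.inv q := by
  have h : S.inv q ≤ (S.inv q).comap (LinearMap.mulLeft k (S.quad q)) := by
    refine Submodule.span_le.2 ?_
    rintro _ ⟨⟨i, P⟩, rfl⟩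
    rw [SetLike.mem_coe, Submodule.mem_comap, LinearMap.mulLeft_apply, ← mul_assoc, ← pow_succ']
    exact S.mem_inv q _ _
  exact h ha

end System

section Hecke

variable {k : Type*} [Field k] [CharZero k] {p q : k[X]} (hq : Balanced p q)

include hq

/-- Evaluation of a polynomial in the quadratic element with coefficients in `k[Δ]`. -/
lemma exists_eval₂_of_mem_inv {a : Hecke p} (ha : a ∈ (heckeSystem p).inv q) : ∃ R : k[X][X],
    a = eval₂ (aeval (heckeSystem p).cas : k[X] →ₐ[k] Hecke p).toRingHom
      ((heckeSystem p).quad q) R := by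
  set S := heckeSystem p
  have hc : ∀ (i : ℕ) (P : k[X]), S.quad q ^ i * aeval S.cas P =
      aeval S.cas P * S.quad q ^ i := fun i P =>
    (S.quad_pow_comm hq (heckeSystem_generates p) i (aeval S.cas P)).symm
  induction ha using Submodule.span_induction with
  | mem _ h =>
    obtain ⟨⟨i, P⟩, rfl⟩ := h
    exact ⟨monomial i P, by rw [eval₂_monomial]; exact hc i P⟩
  | zero => exact ⟨0, by simp⟩
  | add _ _ _ _ ha hb =>
    obtain ⟨R, rfl⟩ := ha
    obtain ⟨R', rfl⟩ := hb
    exact ⟨R + R', by rw [eval₂_add]⟩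
  | smul r _ hm ha =>
    obtain ⟨R, rfl⟩ := ha
    refine ⟨r • R, ?_⟩
    clear hm
    induction R using Polynomial.induction_on' with
    | add P Q hP hQ => rw [eval₂_add, smul_add, hP, hQ, smul_add, eval₂_add]
    | monomial n P =>
      rw [smul_monomial, eval₂_monomial, eval₂_monomial, ← smul_mul_assoc]
      exact congrArg (· * _) (map_smul (aeval S.cas) r P).symm

/-- Write `a` as a polynomial in `t` over `k[Δ]`. In the model with `t = c` it becomes a polynomial
in `Δ` commuting with `x`, hence a constant. So every positive coefficient in `Δ` is a polynomial in
`c` vanishing for all `c`, and is zero. -/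
lemma mem_adjoin_of_mem_inv [Infinite k] {a : Hecke p} (ha : a ∈ (heckeSystem p).inv q)
    (hx : (heckeSystem p).x * a = a * (heckeSystem p).x) :
    a ∈ Algebra.adjoin k {(heckeSystem p).quad q} := by
  obtain ⟨R, rfl⟩ := exists_eval₂_of_mem_inv hq ha
  have h1 : ∀ c : k, (model hq c).lift (eval₂ (aeval (heckeSystem p).cas :
      k[X] →ₐ[k] Hecke p).toRingHom ((heckeSystem p).quad q) R) =
      aeval (model hq c).cas (R.eval (C c)) := by
    intro c
    have h := hom_eval₂ R (aeval (heckeSystem p).cas : k[X] →ₐ[k] Hecke p).toRingHom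
      (model hq c).lift.toRingHom ((heckeSystem p).quad q)
    have h' := hom_eval₂ R (RingHom.id _) (aeval (model hq c).cas :
      k[X] →ₐ[k] Module.End k (ℤ → ℤ → k)).toRingHom (C c)
    have h2 : (model hq c).lift.toRingHom.comp (aeval (heckeSystem p).cas :
      k[X] →ₐ[k] Hecke p).toRingHom = (aeval (model hq c).cas :
      k[X] →ₐ[k] Module.End k (ℤ → ℤ → k)).toRingHom.comp (RingHom.id _) :=
      RingHom.ext fun P => (model hq c).lift_aeval_cas P
    have h3 : (model hq c).lift.toRingHom ((heckeSystem p).quad q) = (aeval (model hq c).cas :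
      k[X] →ₐ[k] Module.End k (ℤ → ℤ → k)).toRingHom (C c) :=
      ((model hq c).lift_quad q).trans ((model_quad hq c).trans (aeval_C _ c).symm)
    rw [h2, h3, ← h'] at h
    exact h
  have h2 : ∀ (c : k) (j : ℕ), j ≠ 0 → (R.eval (C c)).coeff j = 0 := by
    intro c j hj
    have h := congrArg (model hq c).lift hx
    rw [map_mul, map_mul, h1, System.lift_x] at h
    rw [eq_C_of_model_commute hq c h, coeff_C, if_neg hj]
  have h3 : ∀ i j, j ≠ 0 → (R.coeff i).coeff j = 0 := by
    intro i j hj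
    have h4 : (∑ i ∈ Finset.range (R.natDegree + 1),
        monomial i ((R.coeff i).coeff j) : k[X]) = 0 := by
      refine Polynomial.funext fun c => ?_
      rw [eval_zero, ← h2 c j hj, R.eval_eq_sum_range, finsetSum_coeff, eval_finsetSum]
      refine Finset.sum_congr rfl fun i _ => ?_
      rw [← C_pow, coeff_mul_C, eval_monomial]
    have h5 := congrArg (fun P => P.coeff i) h4
    simp only [finsetSum_coeff, coeff_monomial, coeff_zero] at h5
    rw [Finset.sum_ite_eq'] at h5
    split_ifs at h5 with h6
    · exact h5
    · rw [coeff_eq_zero_of_natDegree_lt (p := R) (by simpa using h6), coeff_zero]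
  obtain ⟨R', rfl⟩ : ∃ R' : k[X], R'.map C = R := by
    rw [← mem_lifts, lifts_iff_coeff_lifts]
    intro i
    refine ⟨(R.coeff i).coeff 0, ?_⟩
    ext j
    rw [coeff_C]
    split_ifs with hj
    · rw [hj]
    · exact (h3 i j hj).symm
  rw [eval₂_map]
  have h4 : (aeval (heckeSystem p).cas : k[X] →ₐ[k] Hecke p).toRingHom.comp C =
      algebraMap k (Hecke p) := RingHom.ext fun r => aeval_C _ r
  rw [h4, ← aeval_def]
  exact aeval_mem_adjoin_singleton k _

/-- Split a central element into a part in `k[t, Δ]` and a part in `[sl₂, A]`. Both are invariant,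
so the second vanishes; the first commutes with `x`. -/
theorem center_eq_adjoin [Infinite k] :
    Algebra.adjoin k {(heckeSystem p).quad q} = Subalgebra.center k (Hecke p) := by
  set S := heckeSystem p with hS
  have hg := heckeSystem_generates p
  refine le_antisymm (Algebra.adjoin_le (Set.singleton_subset_iff.2
    (Subalgebra.mem_center_iff.2 (S.quad_comm hq hg)))) fun a ha => ?_
  have ha' := Subalgebra.mem_center_iff.1 ha
  have hz : ∀ b, ad k b a = 0 := fun b => sub_eq_zero.2 (ha' b)
  obtain ⟨κ, hκ, j, hj, rfl⟩ := Submodule.mem_sup.1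
    (show a ∈ S.inv q ⊔ S.adImage by rw [S.inv_sup_adImage hq hg]; trivial)
  have he := hz S.e
  have hh := hz S.h
  rw [map_add, S.ad_e_of_mem_inv hκ, zero_add] at he
  rw [map_add, S.ad_h_of_mem_inv hκ, zero_add] at hh
  obtain rfl := S.eq_zero_of_mem_adImage hg he hh hj
  rw [add_zero] at ha' ⊢
  exact mem_adjoin_of_mem_inv hq hκ (ha' _)

-- Two such elements differ by a polynomial in `Δ`. If both are central, so is the difference, and a
-- model forces it to be constant; thus the degree and leading-coefficient information on one `q`
-- holds for all.
omit hq in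
lemma exists_eq_add_C {q' : k[X]} (hq : Balanced p q)
    (h : (heckeSystem p).quad q' ∈ Subalgebra.center k (Hecke p)) : ∃ c, q' = q + C c := by
  set S := heckeSystem p with hS
  have h1 : S.quad q - S.quad q' ∈ Subalgebra.center k (Hecke p) := sub_mem
    (Subalgebra.mem_center_iff.2 (S.quad_comm hq (heckeSystem_generates p))) h
  have h2 : S.quad q - S.quad q' = aeval S.cas (q' - q) := by
    rw [System.quad, System.quad, map_sub]; abel
  rw [h2] at h1
  have h3 := congrArg (model hq 0).lift (Subalgebra.mem_center_iff.1 h1 S.x)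
  rw [map_mul, map_mul, System.lift_x, System.lift_aeval_cas] at h3
  exact ⟨_, by rw [← eq_C_of_model_commute hq 0 h3]; ring⟩

/-- Modulo `[sl₂, A]` the hypothesis is an equation between invariants, hence an equality in `A`. In
the model with `t = 0` it places `P` in the span of the `relPoly n`, whose degrees are `m, m + 1,
…`. -/
theorem eq_zero_of_aeval_cas_mem (hd : q.natDegree ≤ p.natDegree + 1)
    (hc : q.coeff (p.natDegree + 1) = - p.leadingCoeff / (2 * (p.natDegree + 1))) (hp : p ≠ 0)
    {P : k[X]} (hP : P.degree < p.natDegree) (a : Hecke p)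
    (h : aeval (heckeSystem p).cas P - (heckeSystem p).quad q * a ∈
      System.brackets k (Hecke p)) : P = 0 := by
  set S := heckeSystem p with hS
  have hg := heckeSystem_generates p
  rw [S.brackets_eq hq hg] at h
  obtain ⟨j, hj, r, hr, hjr⟩ := Submodule.mem_sup.1 h
  obtain ⟨κ, hκ, j', hj', rfl⟩ := Submodule.mem_sup.1
    (show a ∈ S.inv q ⊔ S.adImage by rw [S.inv_sup_adImage hq hg]; trivial)
  have h1 : aeval S.cas P - S.quad q * κ - r = j + S.quad q * j' := by
    rw [← sub_eq_zero] at hjr ⊢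
    rw [mul_add] at hjr
    rw [← neg_eq_zero, ← hjr]
    abel
  have h2 : aeval S.cas P - S.quad q * κ - r ∈ S.inv q := by
    refine sub_mem (sub_mem ?_ (S.quad_mul_mem_inv hκ)) (S.rels_le_inv hr)
    simpa using S.mem_inv q 0 P
  have h3 : aeval S.cas P - S.quad q * κ - r = 0 := by
    refine S.eq_zero_of_mem_adImage hg (S.ad_e_of_mem_inv h2) (S.ad_h_of_mem_inv h2) ?_
    rw [h1]
    exact add_mem hj (S.quad_mul_mem_adImage hq hg hj')
  have h4 : ∃ R ∈ Submodule.span k (Set.range (relPoly p q)),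
      (model hq 0).lift r = aeval (model hq 0).cas R := by
    clear h1 h2 h3 hjr
    induction hr using Submodule.span_induction with
    | mem _ h =>
      obtain ⟨⟨i, n⟩, rfl⟩ := h
      rcases i with _ | i
      · refine ⟨_, Submodule.subset_span ⟨n, rfl⟩, ?_⟩
        change (model hq 0).lift (S.quad q ^ 0 * S.rel (X ^ n)) = _
        rw [S.rel_X_pow q, pow_zero, one_mul, map_sub, map_smul, map_mul, System.lift_quad,
          model_quad, map_zero, zero_mul, smul_zero, sub_zero, System.lift_aeval_cas]
      · refine ⟨0, zero_mem _, ?_⟩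
        change (model hq 0).lift (S.quad q ^ (i + 1) * S.rel (X ^ n)) = _
        rw [map_mul, map_pow, System.lift_quad, model_quad, map_zero, pow_succ, mul_zero, zero_mul,
          map_zero]
    | zero => exact ⟨0, zero_mem _, by simp⟩
    | add _ _ _ _ ha hb =>
      obtain ⟨R, hR, ha⟩ := ha
      obtain ⟨R', hR', hb⟩ := hb
      exact ⟨R + R', add_mem hR hR', by rw [map_add, ha, hb, map_add]⟩
    | smul c _ _ ha =>
      obtain ⟨R, hR, ha⟩ := ha
      exact ⟨c • R, Submodule.smul_mem _ _ hR, by rw [map_smul, ha, map_smul]⟩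
  obtain ⟨R, hR, hr'⟩ := h4
  have h5 := congrArg (model hq 0).lift h3
  rw [map_sub, map_sub, map_mul, System.lift_quad, model_quad, map_zero, zero_mul, sub_zero, hr',
    System.lift_aeval_cas, map_zero, ← map_sub] at h5
  have h6 := sub_eq_zero.1 (eq_zero_of_model_aeval_cas hq 0 h5)
  rw [← h6] at hR
  refine eq_zero_of_mem_span (m := p.natDegree) (fun n => (relPoly_spec hd hc n).1) (fun n => ?_)
    hR hP
  rw [(relPoly_spec hd hc n).2]
  exact relPoly_coeff_ne_zero hp n

end Hecke

/-! ### Passage to the commutator quotient as a module over the center. -/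

section CommutatorQuotient

lemma mem_span_singleton_smul_top {R M : Type*} [CommRing R] [AddCommGroup M] [Module R M] (t : R)
    (v : M) : v ∈ Ideal.span {t} • (⊤ : Submodule R M) ↔ ∃ w, t • w = v := by
  rw [Submodule.ideal_span_singleton_smul, Submodule.mem_smul_pointwise_iff_exists]
  simp

variable {k A : Type*} [Field k] [Ring A] [Algebra k A]

lemma mk_commutators_eq_zero {a : A} :
    (Submodule.Quotient.mk a : CommQuot k A) = 0 ↔ a ∈ System.brackets k A :=
  Submodule.Quotient.mk_eq_zero _

lemma linearIndependent_map_pow {V : Type*} [AddCommGroup V] [Module k V] (π : A →ₗ[k] V) (c : A)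
    (m : ℕ) (h : ∀ P : k[X], P.degree < m → π (aeval c P) = 0 → P = 0) :
    LinearIndependent k (fun i : Fin m => π (c ^ (i : ℕ))) := by
  rw [Fintype.linearIndependent_iff]
  intro g hg i
  have h1 := h (∑ i : Fin m, monomial (i : ℕ) (g i)) ?_ ?_
  · have h2 := congrArg (fun P => P.coeff (i : ℕ)) h1
    simp only [finsetSum_coeff, coeff_monomial, coeff_zero] at h2
    simpa [Fin.val_inj] using h2
  · rw [degree_lt_iff_coeff_zero]
    intro j hj
    rw [finsetSum_coeff]
    refine Finset.sum_eq_zero fun i _ => ?_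
    rw [coeff_monomial, if_neg]
    have := i.2
    omega
  · rw [map_sum, map_sum, ← hg]
    refine Finset.sum_congr rfl fun i _ => ?_
    rw [aeval_monomial, ← Algebra.smul_def, map_smul]

variable (t : Subalgebra.center k A) (c : A) (m : ℕ)

lemma linearIndependent_commQuot
    (h : ∀ P : k[X], P.degree < m → aeval c P ∈ System.brackets k A → P = 0) :
    LinearIndependent k (fun i : Fin m => (Submodule.Quotient.mk (c ^ (i : ℕ)) : CommQuot k A)) :=
  linearIndependent_map_pow ((commutators k A).mkQ.restrictScalars k) c m
    fun P hP h0 => h P hP (mk_commutators_eq_zero.1 h0)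

variable (hsp : System.brackets k A ⊔
  Submodule.span k {a | ∃ i l : ℕ, l < m ∧ a = (t : A) ^ i * c ^ l} = ⊤)
include hsp

lemma span_commQuot_eq_top : Submodule.span (Subalgebra.center k A) (Set.range
    (fun i : Fin m => (Submodule.Quotient.mk (c ^ (i : ℕ)) : CommQuot k A))) = ⊤ := by
  rw [eq_top_iff]
  rintro a -
  obtain ⟨a, rfl⟩ := Submodule.Quotient.mk_surjective _ a
  obtain ⟨b, hb, s, hs, rfl⟩ := Submodule.mem_sup.1 (show a ∈ _ by rw [hsp]; trivial)
  have h0 : (Submodule.Quotient.mk b : CommQuot k A) = 0 := mk_commutators_eq_zero.2 hb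
  rw [Submodule.Quotient.mk_add, h0, zero_add]
  induction hs using Submodule.span_induction with
  | mem _ h =>
    obtain ⟨i, l, hl, rfl⟩ := h
    have h1 : (Submodule.Quotient.mk (c ^ l) : CommQuot k A) ∈
        Submodule.span (Subalgebra.center k A) (Set.range
          (fun i : Fin m => (Submodule.Quotient.mk (c ^ (i : ℕ)) : CommQuot k A))) :=
      Submodule.subset_span ⟨⟨l, hl⟩, rfl⟩
    exact Submodule.smul_mem _ (t ^ i) h1
  | zero => exact zero_mem _
  | add _ _ _ _ ha hb => rw [Submodule.Quotient.mk_add]; exact add_mem ha hb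
  | smul r x _ ha =>
    rw [Algebra.smul_def]
    exact Submodule.smul_mem _ (algebraMap k (Subalgebra.center k A) r) ha

/-- Modulo `t` only the generators with exponent `i = 0` survive, so the powers `c ^ l` with `l < m`
form a basis. -/
lemma rank_commQuot_quotient (h : ∀ P : k[X], P.degree < m → ∀ a,
    aeval c P - t * a ∈ System.brackets k A → P = 0) :
    Module.rank k (CommQuot k A ⧸ (Ideal.span {t} • (⊤ : Submodule (Subalgebra.center k A)
      (CommQuot k A)))) = m := by
  let N := (Ideal.span {t} • (⊤ : Submodule (Subalgebra.center k A) (CommQuot k A)))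
  let π : A →ₗ[k] CommQuot k A ⧸ N :=
    N.mkQ.restrictScalars k ∘ₗ (commutators k A).mkQ.restrictScalars k
  have hπ : ∀ a, π a = 0 ↔ ∃ b, a - t * b ∈ System.brackets k A := by
    intro a
    have h1 : π a = 0 ↔ (Submodule.Quotient.mk a : CommQuot k A) ∈ N :=
      Submodule.Quotient.mk_eq_zero _
    rw [h1, mem_span_singleton_smul_top]
    constructor
    · rintro ⟨w, hw⟩
      obtain ⟨b, rfl⟩ := Submodule.Quotient.mk_surjective _ w
      exact ⟨b, (Submodule.Quotient.eq _).1 hw.symm⟩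
    · rintro ⟨b, hb⟩
      exact ⟨Submodule.Quotient.mk b, ((Submodule.Quotient.eq _).2 hb).symm⟩
  have hli : LinearIndependent k (fun i : Fin m => π (c ^ (i : ℕ))) :=
    linearIndependent_map_pow π c m fun P hP h0 => by
      obtain ⟨b, hb⟩ := (hπ _).1 h0
      exact h P hP b hb
  have hs : ⊤ ≤ Submodule.span k (Set.range fun i : Fin m => π (c ^ (i : ℕ))) := by
    rintro v -
    obtain ⟨v, rfl⟩ := Submodule.Quotient.mk_surjective _ v
    obtain ⟨a, rfl⟩ := Submodule.Quotient.mk_surjective _ v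
    change π a ∈ _
    obtain ⟨b, hb, s, hs, rfl⟩ := Submodule.mem_sup.1 (show a ∈ _ by rw [hsp]; trivial)
    rw [map_add, (hπ b).2 ⟨0, by rwa [mul_zero, sub_zero]⟩, zero_add]
    induction hs using Submodule.span_induction with
    | mem _ h =>
      obtain ⟨i, l, hl, rfl⟩ := h
      rcases i with _ | i
      · rw [pow_zero, one_mul]
        exact Submodule.subset_span ⟨⟨l, hl⟩, rfl⟩
      · rw [(hπ _).2 ⟨t ^ i * c ^ l, by rw [pow_succ', mul_assoc, sub_self]; exact zero_mem _⟩]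
        exact zero_mem _
    | zero => rw [map_zero]; exact zero_mem _
    | add _ _ _ _ ha hb => rw [map_add]; exact add_mem ha hb
    | smul r x _ ha => rw [map_smul]; exact Submodule.smul_mem _ _ ha
  rw [rank_eq_card_basis (Module.Basis.mk hli hs), Fintype.card_fin]

end CommutatorQuotient

/-! ### Assembly of the theorem. -/

section Assembly

variable {k : Type*} [Field k] [CharZero k] {p q : k[X]}

/-- The polynomials for which the quadratic element is central. -/
lemma balanced_of_mem_center (hq : quadElt p q ∈ Subalgebra.center k (Hecke p)) :
    Balanced p q ∧ q.natDegree ≤ p.natDegree + 1 ∧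
      q.coeff (p.natDegree + 1) = - p.leadingCoeff / (2 * (p.natDegree + 1)) := by
  obtain ⟨q₀, h1, h2, h3⟩ := exists_balanced p
  obtain ⟨c, rfl⟩ := exists_eq_add_C h1 hq
  refine ⟨?_, natDegree_add_le_of_degree_le h2 (by simp), ?_⟩
  · unfold Balanced at h1 ⊢
    simp only [add_comp, C_comp]
    rw [add_sub_add_right_eq_sub, h1]
  · rw [coeff_add, coeff_C_succ, add_zero, h3]

lemma exists_quadElt_mem_center (p : k[X]) :
    ∃ q : k[X], quadElt p q ∈ Subalgebra.center k (Hecke p) := by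
  obtain ⟨q, hq, -⟩ := exists_balanced p
  exact ⟨q, Subalgebra.mem_center_iff.2 ((heckeSystem p).quad_comm hq (heckeSystem_generates p))⟩

lemma hecke_span_eq_top (hp : p ≠ 0) (hq : quadElt p q ∈ Subalgebra.center k (Hecke p)) :
    System.brackets k (Hecke p) ⊔ Submodule.span k {a | ∃ i l : ℕ, l < p.natDegree ∧
      a = (quadElt p q) ^ i * casimir p ^ l} = ⊤ := by
  obtain ⟨h1, h2, h3⟩ := balanced_of_mem_center hq
  exact (heckeSystem p).brackets_sup_smallInv h1 (heckeSystem_generates p) h2 h3 hp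

lemma hecke_eq_zero (hp : p ≠ 0) (hq : quadElt p q ∈ Subalgebra.center k (Hecke p)) {P : k[X]}
    (hP : P.degree < p.natDegree) (a : Hecke p)
    (h : aeval (casimir p) P - quadElt p q * a ∈ System.brackets k (Hecke p)) : P = 0 := by
  obtain ⟨h1, h2, h3⟩ := balanced_of_mem_center hq
  exact eq_zero_of_aeval_cas_mem h1 h2 h3 hp hP a h

end Assembly
end InfHecke

theorem theorem3p6 (k : Type*) [Field k] [IsAlgClosed k] [CharZero k]
    (p : k[X]) (hp : p ≠ 0) :
    -- if `z` is a constant, the commutator quotient is trivial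
    (p.natDegree = 0 → Subsingleton (InfHecke.CommQuot k (InfHecke.Hecke p))) ∧
    -- if `m = deg z ≥ 1`, the images of `1, Δ, …, Δ^(m-1)` are linearly independent over `k`
    -- and generate the commutator quotient over the center
    (1 ≤ p.natDegree →
      LinearIndependent k (fun i : Fin p.natDegree =>
        (Submodule.Quotient.mk (InfHecke.casimir p ^ (i : ℕ)) :
          InfHecke.CommQuot k (InfHecke.Hecke p))) ∧
      Submodule.span (Subalgebra.center k (InfHecke.Hecke p))
        (Set.range (fun i : Fin p.natDegree =>
          (Submodule.Quotient.mk (InfHecke.casimir p ^ (i : ℕ)) :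
            InfHecke.CommQuot k (InfHecke.Hecke p)))) = ⊤) ∧
    -- there is a central element `t_z = e y² + h x y - f x² - (1/2) h z - q(Δ)`, and
    -- each such element generates the center and cuts the commutator quotient down to
    -- dimension `m`
    (∃ q : k[X], InfHecke.quadElt p q ∈ Subalgebra.center k (InfHecke.Hecke p)) ∧
    (∀ (q : k[X]) (t : Subalgebra.center k (InfHecke.Hecke p)),
      (t : InfHecke.Hecke p) = InfHecke.quadElt p q →
      Algebra.adjoin k {(t : InfHecke.Hecke p)} = Subalgebra.center k (InfHecke.Hecke p) ∧
      Module.rank k (InfHecke.CommQuot k (InfHecke.Hecke p) ⧸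
        (Ideal.span {t} • (⊤ : Submodule (Subalgebra.center k (InfHecke.Hecke p))
          (InfHecke.CommQuot k (InfHecke.Hecke p))))) = p.natDegree) := by
  obtain ⟨q, hq⟩ := InfHecke.exists_quadElt_mem_center p
  have hspan := InfHecke.span_commQuot_eq_top ⟨_, hq⟩ (InfHecke.casimir p) p.natDegree
    (InfHecke.hecke_span_eq_top hp hq)
  refine ⟨fun hm => ?_, fun _ => ⟨?_, hspan⟩, ⟨q, hq⟩, fun q t ht => ?_⟩
  -- For `m = 0` the generating family is empty, so the whole module is zero.
  · rw [hm, Set.range_eq_empty, Submodule.span_empty] at hspan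
    exact Submodule.subsingleton_iff _ |>.1 (subsingleton_of_bot_eq_top hspan)
  -- Independence in the commutator quotient is the case `a = 0` of independence modulo `t`.
  · refine InfHecke.linearIndependent_commQuot _ _ fun P hP h =>
      InfHecke.hecke_eq_zero hp hq hP 0 ?_
    rwa [mul_zero, sub_zero]
  · have hq' : InfHecke.quadElt p q ∈ Subalgebra.center k (InfHecke.Hecke p) := ht ▸ t.2
    refine ⟨?_, InfHecke.rank_commQuot_quotient t (InfHecke.casimir p) _ ?_ fun P hP a h =>
      InfHecke.hecke_eq_zero hp hq' hP a (by rwa [← ht])⟩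
    · rw [ht]
      exact InfHecke.center_eq_adjoin (InfHecke.balanced_of_mem_center hq').1
    · rw [ht]
      exact InfHecke.hecke_span_eq_top hp hq'
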